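/- Work over $\mathbb{Q}$, and let $n\ge 0$ be an integer. Let $\Gamma$ be the category of finite pointed sets. **The graph algebras.** For a finite set $S$, an admissible graph is an undirected graph with set of external vertices $S$ and finitely many internal vertices (tadpoles and multiple edges are allowed) such that every connected component contains an external vertex and every internal vertex has valence at least $3$. Its degree is $(n-1)\#E-n\#V$, where $\#E$ is the number of edges and $\#V$ the number of internal vertices. An orientation is, for $n$ even, an ordering of the edges up to even permutations and, for $n$ odd, an ordering of the half-edges and internal vertices up to even permutations. Let $\mathsf{Graphs}_n(S)$ be the graded vector space spanned by the isomorphism classes of oriented admissible graphs (isomorphisms fix the external vertices), where a graph with the opposite orientation is identified with minus the graph. It is a dg commutative algebra: the product glues graphs along the external vertices (and concatenates orientations), and the differential, of degree $+1$, is the signed sum over the contractions of all edges that are not tadpoles and have at least one internal end point, the sign being that of moving the contracted edge, and the internal vertex that disappears, to the front of the orientation. **The $\Gamma$-structure.** $\mathsf{Graphs}_n$ is the functor on $\Gamma$ that sends $S_*=\{*\}\sqcup S$ to $\mathsf{Graphs}_n(S)$. For a pointed map $f:S_*\to T_*$ and a graph $\gamma$, put $f_*\gamma=0$ if some external vertex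 $s\in f^{-1}(*)$ has an incident edge; otherwise $f_*\gamma$ is obtained by discarding these vertices and, for every $t\in T$, merging the external vertices in $f^{-1}(t)$ into one vertex $t$ (a new isolated vertex if the fibre is empty). **The model structure.** In the projective model structure on $\Gamma$-diagrams of dg commutative algebras, the weak equivalences are the objectwise quasi-isomorphisms, the fibrations are the morphisms that are objectwise surjective in every degree, and the cofibrations are the morphisms with the left lifting property with respect to the fibrations that are weak equivalences. An object is cofibrant if the morphism from the initial object (the constant diagram $\mathbb{Q}$) to it is a cofibration. **Claim.** For every $n\ge 0$, $\mathsf{Graphs}_n$ is cofibrant in the category of $\Gamma$-diagrams of $\mathbb{Z}$-graded dg commutative $\mathbb{Q}$-algebras. If $n\ge 3$, then $\mathsf{Graphs}_n$ is concentrated in non-negative degrees, and it is cofibrant in the category of $\Gamma$-diagrams of non-negatively graded dg commutative $\mathbb{Q}$-algebras. -/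

import Mathlib

namespace GraphComplex

open CategoryTheory Limits HomotopicalAlgebra

section Combinatorics

variable {X Y Z : Type}

/-- The vertices of a graph: external vertices `.inl x`, labelled by the elements `x` of a set `X`,
and internal vertices `.inr i`, numbered by natural numbers. -/
abbrev Vtx (X : Type) : Type := X ⊕ ℕ

/-- An edge with a direction, i.e. with an ordering of its two half-edges. -/
abbrev Edge (X : Type) : Type := Vtx X × Vtx X

/-- Replace the end points of all edges according to `f`. -/
abbrev relabel (f : Vtx X → Vtx Y) (l : List (Edge X)) : List (Edge Y) :=
  l.map (Prod.map f f)

/-- `1` if the vertex is the internal vertex `i`, and `0` otherwise. -/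
def hit (i : ℕ) : Vtx X → ℕ
  | .inl _ => 0
  | .inr j => if j = i then 1 else 0

/-- The valence of the internal vertex `i`: its number of half-edges (a tadpole counts twice). -/
def valence (i : ℕ) (l : List (Edge X)) : ℕ :=
  (l.map fun e => hit i e.1 + hit i e.2).sum

/-- Two vertices are joined if they lie in the same connected component. -/
def Joined (l : List (Edge X)) : Vtx X → Vtx X → Prop :=
  Relation.EqvGen fun v w => (v, w) ∈ l

/-- The internal vertices in range are `0, …, k - 1`. -/
def InRange (k : ℕ) : Vtx X → Prop
  | .inl _ => True
  | .inr j => j < k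

/-- Admissible graphs with internal vertices `0, …, k - 1` and list of edges `l`. The external vertices
are the elements of the pointed set `X` other than the base point `pt`: no edge is incident to `pt`.
Every internal vertex has valence at least three, and every connected component contains an external
vertex. Tadpoles and multiple edges are allowed. -/
structure Admissible (pt : X) (k : ℕ) (l : List (Edge X)) : Prop where
  inRange : ∀ e ∈ l, InRange k e.1 ∧ InRange k e.2
  base : ∀ e ∈ l, e.1 ≠ .inl pt ∧ e.2 ≠ .inl pt
  trivalent : ∀ i < k, 3 ≤ valence i l
  connected : ∀ i < k, ∃ x : X, Joined l (.inr i) (.inl x)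

/-- All internal end points of the edges are among `0, …, k - 1`. -/
def WF (k : ℕ) (l : List (Edge X)) : Prop := ∀ e ∈ l, InRange k e.1 ∧ InRange k e.2

/-- Exchange the internal vertices `i` and `i + 1`. -/
def vswap (i : ℕ) : Vtx X → Vtx X
  | .inl x => .inl x
  | .inr j => .inr (if j = i then i + 1 else if j = i + 1 then i else j)

/-- Renumber the internal vertices after the removal of the internal vertex `b`. -/
def drop (b : ℕ) : Vtx X → Vtx X
  | .inl x => .inl x
  | .inr c => .inr (if b < c then c - 1 else c)

/-- Merge the internal vertex `b` into the vertex `v` (different from `b`), and renumber the remaining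
internal vertices. -/
def merge (v : Vtx X) (b : ℕ) : Vtx X → Vtx X
  | .inl x => .inl x
  | .inr c => if c = b then drop b v else drop b (.inr c)

variable {M : Type*} [AddCommGroup M] [Module ℚ M]

/-- `pickSum s T [a₀, …, aₘ]` is `∑ p, s ^ p • T aₚ [a₀, …, âₚ, …, aₘ]`. -/
def pickSum {α : Type*} (s : ℚ) : (α → List α → M) → List α → M
  | _, [] => 0
  | T, a :: l => T a l + s • pickSum s (fun x r => T x (a :: r)) l

/-- The signed contraction of an edge `e` in a graph with internal vertices `0, …, k - 1` and remaining
edges `r`, where `Φ k l` is the value of the graph with `k` internal vertices and edges `l`. An edge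
`(v, b)` with `b` internal, `v ≠ b`, is contracted by merging `b` into `v`, with the sign `s ^ b` for
moving the vertex `b` to the front; an edge from an internal to an external vertex is reversed first,
which costs a sign `s`. Tadpoles and edges between external vertices are not contracted. -/
def contract (s : ℚ) (Φ : ℕ → List (Edge X) → M) (k : ℕ) : Edge X → List (Edge X) → M
  | (.inl _, .inl _), _ => 0
  | (.inl x, .inr b), r => s ^ b • Φ (k - 1) (relabel (merge (.inl x) b) r)
  | (.inr a, .inl y), r => s ^ (a + 1) • Φ (k - 1) (relabel (merge (.inl y) a) r)
  | (.inr a, .inr b), r =>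
      if a = b then 0 else s ^ b • Φ (k - 1) (relabel (merge (.inr a) b) r)

/-! ### Sums over the elements of a list -/

theorem pickSum_append {α : Type*} (s : ℚ) (T : α → List α → M) (A B : List α) :
    pickSum s T (A ++ B) = pickSum s (fun x r => T x (r ++ B)) A
      + s ^ A.length • pickSum s (fun x r => T x (A ++ r)) B := by
  induction A generalizing T with
  | nil => simp [pickSum]
  | cons a A ih =>
    simp only [List.cons_append, pickSum, ih, List.length_cons, smul_add, smul_smul, pow_succ',
      add_assoc]

theorem pickSum_map {α β : Type*} (s : ℚ) (f : α → β) (T : β → List β → M) (l : List α) :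
    pickSum s T (l.map f) = pickSum s (fun x r => T (f x) (r.map f)) l := by
  induction l generalizing T with
  | nil => simp [pickSum]
  | cons a A ih => simp [pickSum, ih]

theorem pickSum_congr {α : Type*} (s c : ℚ) (T T' : α → List α → M) (l : List α)
    (h : ∀ x r, (x :: r).Perm l → T x r = c • T' x r) :
    pickSum s T l = c • pickSum s T' l := by
  induction l generalizing T T' with
  | nil => simp [pickSum]
  | cons a l ih =>
    simp only [pickSum]
    rw [h a l (List.Perm.refl _), ih _ (fun x r => T' x (a :: r)), smul_add, smul_comm]
    intro x r hr
    exact h x (a :: r) ((List.Perm.swap _ _ _).trans (hr.cons a))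

theorem pickSum_zero {α : Type*} (s : ℚ) (T : α → List α → M) (l : List α)
    (h : ∀ x r, (x :: r).Perm l → T x r = 0) : pickSum s T l = 0 := by
  have := pickSum_congr s 0 T T l (by simpa using h)
  simpa using this

theorem map_pickSum {α N : Type*} [AddCommGroup N] [Module ℚ N] (s : ℚ) (T : α → List α → M)
    (l : List α) (φ : M →ₗ[ℚ] N) : φ (pickSum s T l) = pickSum s (fun x r => φ (T x r)) l := by
  induction l generalizing T with
  | nil => simp [pickSum]
  | cons a l ih => simp [pickSum, ih]

theorem pickSum_swap {α : Type*} {s : ℚ} (hs : s * s = 1) (T : α → List α → M)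
    (A B : List α) (a b : α)
    (h : ∀ x A' a' b' B', (x :: (A' ++ a' :: b' :: B')).Perm (A ++ a :: b :: B) →
      T x (A' ++ a' :: b' :: B') = s • T x (A' ++ b' :: a' :: B')) :
    pickSum s T (A ++ a :: b :: B) = s • pickSum s T (A ++ b :: a :: B) := by
  induction A generalizing T with
  | nil =>
    simp only [List.nil_append, pickSum, smul_add, smul_smul, hs, one_smul]
    rw [pickSum_congr s s (fun x r => T x (a :: b :: r)) (fun x r => T x (b :: a :: r)) B]
    · abel
    · intro x r hr
      refine h x [] a b r ?_
      refine List.Perm.trans ?_ ((hr.cons b).cons a)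
      exact (List.Perm.swap _ _ _).trans ((List.Perm.swap _ _ _).cons _)
  | cons c A ih =>
    simp only [List.cons_append, pickSum, smul_add]
    rw [h c A a b B (by simp), ih]
    intro x A' a' b' B' hp
    refine h x (c :: A') a' b' B' ?_
    simp only [List.cons_append]
    exact (List.Perm.swap _ _ _).trans (hp.cons c)

theorem pickSum_pickSum {α : Type*} {s t : ℚ} (hs : s * t = -1) (hss : s * s = 1)
    (T : α → α → List α → M)
    (l : List α) (h : ∀ x y r, (x :: y :: r).Perm l → T x y r = t • T y x r) :
    pickSum s (fun x r => pickSum s (T x) r) l = 0 := by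
  induction l generalizing T with
  | nil => simp [pickSum]
  | cons a l ih =>
    have key : ∀ (U : α → List α → M) (V : α → List α → M) (l : List α),
        pickSum s (fun x r => U x r + V x r) l = pickSum s U l + pickSum s V l := by
      intro U V l
      induction l generalizing U V with
      | nil => simp [pickSum]
      | cons a l ih => simp only [pickSum, ih, smul_add]; abel
    have key2 : ∀ (U : α → List α → M) (l : List α),
        pickSum s (fun x r => s • U x r) l = s • pickSum s U l := by
      intro U l
      exact pickSum_congr s s _ _ l (by simp)
    simp only [pickSum, key, key2, smul_add, smul_smul, hss, one_smul]
    rw [ih (fun x y r => T x y (a :: r)),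
      pickSum_congr s t (fun x r => T x a r) (fun x r => T a x r) l, smul_smul, hs]
    · simp
    · intro x r hr
      exact h x a r ((List.Perm.swap _ _ _).trans (hr.cons a))
    · intro x y r hr
      refine h x y (a :: r) ?_
      refine List.Perm.trans ?_ (hr.cons a)
      exact (List.Perm.cons x (List.Perm.swap a y r)).trans (List.Perm.swap _ _ _)

/-! ### Contractions -/

theorem merge_vswap (v : Vtx X) (b i : ℕ) (hv : v ≠ .inr b) (h : b ≠ i) (h' : b ≠ i + 1) (w : Vtx X) :
    merge (vswap i v) b (vswap i w) = vswap (if b < i then i - 1 else i) (merge v b w) := by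
  rcases v with v | v <;> rcases w with w | w <;> simp [merge, vswap, drop] at * <;> grind [drop, vswap]

theorem merge_vswap_left (v : Vtx X) (i : ℕ) (hv : v ≠ .inr i) (w : Vtx X) :
    merge (vswap i v) (i + 1) (vswap i w) = merge v i w := by
  rcases v with v | v <;> rcases w with w | w <;> simp [merge, vswap, drop] at * <;> grind [drop, vswap]

theorem merge_vswap_right (v : Vtx X) (i : ℕ) (hv : v ≠ .inr (i + 1)) (w : Vtx X) :
    merge (vswap i v) i (vswap i w) = merge v (i + 1) w := by
  rcases v with v | v <;> rcases w with w | w <;> simp [merge, vswap, drop] at * <;> grind [drop, vswap]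

theorem merge_adj (a : ℕ) (w : Vtx X) :
    merge (.inr a) (a + 1) w = merge (.inr (a + 1)) a w := by
  rcases w with w | w
  · rfl
  · simp only [merge, drop]; grind

theorem merge_merge (v w : Vtx X) (b c : ℕ) (hv : v ≠ .inr b) (hw : w ≠ .inr c) (hbc : b ≠ c)
    (h : ¬ (v = .inr c ∧ w = .inr b)) (u : Vtx X) :
    merge (merge v b w) (if b < c then c - 1 else c) (merge v b u)
      = merge (merge w c v) (if c < b then b - 1 else b) (merge w c u) := by
  have hm : ∀ (v : Vtx X) (b c : ℕ), c ≠ b → merge v b (.inr c) = .inr (if b < c then c - 1 else c) := by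
    intro v b c h; simp [merge, drop, h]
  have hm' : ∀ (v : Vtx X) (b : ℕ), merge v b (.inr b) = drop b v := by
    intro v b; simp [merge]
  have hm'' : ∀ (v : Vtx X) (b : ℕ) (x : X), merge v b (.inl x) = .inl x := by
    intro v b x; simp [merge]
  have hd : ∀ (b : ℕ) (x : X), drop b (.inl x) = (.inl x : Vtx X) := by
    intro b x; simp [drop]
  have hd' : ∀ (b c : ℕ), drop b (.inr c) = (.inr (if b < c then c - 1 else c) : Vtx X) := by
    intro b x; simp [drop]
  have hmd : ∀ (v w : Vtx X) (b : ℕ), w ≠ .inr b → merge v b w = drop b w := by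
    intro v w b h
    rcases w with w | w
    · rfl
    · simp at h; simp [merge, h]
  have hdd : ∀ u : Vtx X, u ≠ .inr b → u ≠ .inr c → drop (if b < c then c - 1 else c) (drop b u)
      = drop (if c < b then b - 1 else b) (drop c u) := by
    intro u h1 h2
    rcases u with u | u
    · rfl
    · simp only [drop, Sum.inr.injEq]
      simp at h1 h2
      split_ifs <;> omega
  have hne : ∀ (b c : ℕ) (u : Vtx X), b ≠ c → u ≠ .inr b → u ≠ .inr c →
      drop b u ≠ .inr (if b < c then c - 1 else c) := by
    intro b c u hbc h1 h2
    rcases u with u | u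
    · simp [drop]
    · simp only [drop, ne_eq, Sum.inr.injEq]
      simp at h1 h2
      split_ifs <;> omega
  by_cases hub : u = .inr b
  · subst hub
    rw [hm', hm _ _ _ hbc, hm']
    by_cases hvc : v = .inr c
    · subst hvc
      have hwb : w ≠ .inr b := fun h' => h ⟨rfl, h'⟩
      rw [hd', hm', hmd _ _ _ hwb, hm', hdd w hwb hw]
    · rw [hmd _ _ _ (hne _ _ _ hbc hv hvc), hmd _ _ _ hvc, hdd v hv hvc]
  · by_cases huc : u = .inr c
    · subst huc
      rw [hm _ _ _ hbc.symm, hm', hm']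
      by_cases hwb : w = .inr b
      · subst hwb
        have hvc : v ≠ .inr c := fun h' => h ⟨h', rfl⟩
        rw [hd', hm', hmd _ _ _ hvc, hm', hdd v hv hvc]
      · rw [hmd _ _ _ hwb, hmd _ _ _ (hne _ _ _ hbc.symm hw hwb), hdd w hwb hw]
    · rw [hmd _ _ _ hub, hmd _ _ _ huc, hmd _ _ _ (hne _ _ _ hbc hub huc),
        hmd _ _ _ (hne _ _ _ hbc.symm huc hub), hdd u hub huc]

theorem contract_inr (s : ℚ) (Φ : ℕ → List (Edge X) → M) (k : ℕ) (v : Vtx X) (b : ℕ)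
    (h : v ≠ .inr b) (r : List (Edge X)) :
    contract s Φ k (v, .inr b) r = s ^ b • Φ (k - 1) (relabel (merge v b) r) := by
  rcases v with v | v
  · rfl
  · have : v ≠ b := by simpa using h
    simp [contract, this]

theorem contract_self (s : ℚ) (Φ : ℕ → List (Edge X) → M) (k : ℕ) (v : Vtx X)
    (r : List (Edge X)) : contract s Φ k (v, v) r = 0 := by
  rcases v with v | v <;> simp [contract]

theorem relabel_relabel (f : Vtx Y → Vtx Z) (g : Vtx X → Vtx Y) (l : List (Edge X)) :
    relabel f (relabel g l) = relabel (fun v => f (g v)) l := by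
  simp [relabel, Function.comp_def]

theorem merge_inRange {v : Vtx X} {b k : ℕ} (hv : InRange k v) (hvb : v ≠ .inr b) (hb : b < k)
    {w : Vtx X} (hw : InRange k w) : InRange (k - 1) (merge v b w) := by
  have hd : ∀ w : Vtx X, w ≠ .inr b → InRange k w → InRange (k - 1) (drop b w) := by
    intro w h hw
    rcases w with w | w
    · trivial
    · simp only [ne_eq, Sum.inr.injEq, InRange] at h hw
      simp only [drop, InRange]
      split_ifs <;> omega
  rcases w with w | w
  · trivial
  · simp only [merge]
    split_ifs with h
    · exact hd v hvb hv
    · exact hd _ (by simpa using h) hw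

theorem wf_relabel {f : Vtx X → Vtx Y} {k k' : ℕ} (hf : ∀ v, InRange k v → InRange k' (f v))
    {l : List (Edge X)} (hl : WF k l) : WF k' (relabel f l) := by
  intro e he
  simp only [relabel, List.mem_map] at he
  obtain ⟨e', he', rfl⟩ := he
  exact ⟨hf _ (hl e' he').1, hf _ (hl e' he').2⟩

/-- Exchanging two consecutive internal vertices multiplies `Φ` by `s`. -/
def Equivariant (s : ℚ) (Φ : ℕ → List (Edge X) → M) : Prop :=
  ∀ k i l, i + 1 < k → WF k l → Φ k (relabel (vswap i) l) = s • Φ k l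

theorem pow_shift {s : ℚ} (hs : s * s = 1) (i : ℕ) : s ^ i = s * s ^ (i + 1) := by
  rw [pow_succ', ← mul_assoc, hs, one_mul]

theorem contract_vswap {s : ℚ} (hs : s * s = 1) {Φ : ℕ → List (Edge X) → M}
    (hΦ : Equivariant s Φ) {k i : ℕ} {e : Edge X} {r : List (Edge X)} (hi : i + 1 < k)
    (wf : WF k (e :: r)) :
    contract s Φ k (Prod.map (vswap i) (vswap i) e) (relabel (vswap i) r)
      = s • contract s Φ k e r := by
  have core : ∀ (v : Vtx X) (b : ℕ), v ≠ .inr b → InRange k v → b < k →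
      contract s Φ k (vswap i v, vswap i (.inr b)) (relabel (vswap i) r)
        = s • contract s Φ k (v, .inr b) r := by
    intro v b hvb hv hb
    have hr : WF k r := fun e he => wf e (List.mem_cons_of_mem _ he)
    have hr' : WF (k - 1) (relabel (merge v b) r) :=
      wf_relabel (fun w hw => merge_inRange hv hvb hb hw) hr
    have inj : ∀ b' : ℕ, vswap i (.inr b : Vtx X) = .inr b' → vswap i v ≠ .inr b' := by
      intro b' h1 h2
      apply hvb
      rw [← h2] at h1
      rcases v with v | v
      · simp [vswap] at h1
      · simp only [vswap, Sum.inr.injEq] at h1 ⊢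
        split_ifs at h1 <;> omega
    rw [contract_inr _ _ _ _ _ hvb]
    by_cases h1 : b = i
    · subst h1
      have e1 : vswap b (.inr b : Vtx X) = .inr (b + 1) := by simp [vswap]
      rw [e1, contract_inr _ _ _ _ _ (inj _ e1), relabel_relabel]
      simp only [merge_vswap_left v b hvb]
      rw [smul_smul, pow_succ']
    · by_cases h2 : b = i + 1
      · subst h2
        have e1 : vswap i (.inr (i + 1) : Vtx X) = .inr i := by simp [vswap]
        rw [e1, contract_inr _ _ _ _ _ (inj _ e1), relabel_relabel]
        simp only [merge_vswap_right v i hvb]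
        rw [smul_smul, ← pow_shift hs]
      · have e1 : vswap i (.inr b : Vtx X) = .inr b := by simp [vswap, h1, h2]
        rw [e1, contract_inr _ _ _ _ _ (inj _ e1), relabel_relabel]
        simp only [merge_vswap v b i hvb h1 h2]
        rw [← relabel_relabel, hΦ _ _ _ _ hr', smul_comm]
        split_ifs <;> omega
  obtain ⟨v, w⟩ := e
  have hvw := wf (v, w) (by simp)
  rcases w with y | b
  · rcases v with x | a
    · simp [contract, vswap]
    · have h3 : ∀ (r : List (Edge X)) (c : ℕ), contract s Φ k (.inr c, .inl y) r
          = s • contract s Φ k (.inl y, .inr c) r := by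
        intro r c
        simp [contract, pow_succ', smul_smul]
      have := core (.inl y) a (by simp) trivial hvw.1
      simp only [Prod.map, vswap] at this ⊢
      rw [h3, h3, this]
  · by_cases h : v = .inr b
    · subst h
      simp [contract_self]
    · exact core v b h hvw.1 hvw.2

theorem contract_flip {s : ℚ} (hs : s * s = 1) {Φ : ℕ → List (Edge X) → M}
    (hΦ : Equivariant s Φ) {k : ℕ} {v w : Vtx X} {r : List (Edge X)}
    (wf : WF k ((v, w) :: r)) :
    contract s Φ k (v, w) r = s • contract s Φ k (w, v) r := by
  have hvw := wf (v, w) (by simp)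
  have wfr : WF k r := fun e he => wf e (List.mem_cons_of_mem _ he)
  have key : ∀ (m a : ℕ) (r : List (Edge X)), a + 1 + m < k → WF k r →
      contract s Φ k (.inr a, .inr (a + 1 + m)) r
        = s • contract s Φ k (.inr (a + 1 + m), .inr a) r := by
    intro m
    induction m with
    | zero =>
      intro a r h hr
      rw [contract_inr _ _ _ _ _ (by simp), contract_inr _ _ _ _ _ (by simp)]
      have h1 : merge (.inr a : Vtx X) (a + 1) = merge (.inr (a + 1)) a := funext (merge_adj a)
      simp only [add_zero, h1]
      rw [pow_succ', smul_smul]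
    | succ m ih =>
      intro a r h hr
      have hr' : WF k (relabel (vswap (a + 1 + m)) r) := by
        refine wf_relabel ?_ hr
        rintro (v | v) hv
        · trivial
        · simp only [InRange, vswap] at hv ⊢
          split_ifs <;> omega
      have h1 := contract_vswap hs hΦ (k := k) (i := a + 1 + m)
        (e := (.inr a, .inr (a + 1 + (m + 1)))) (r := r) (by omega) (by
          intro e he
          rcases List.mem_cons.1 he with rfl | he
          · constructor <;> simp only [InRange] <;> omega
          · exact hr e he)
      have h2 := contract_vswap hs hΦ (k := k) (i := a + 1 + m)
        (e := (.inr (a + 1 + (m + 1)), .inr a)) (r := r) (by omega) (by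
          intro e he
          rcases List.mem_cons.1 he with rfl | he
          · constructor <;> simp only [InRange] <;> omega
          · exact hr e he)
      have e1 : vswap (a + 1 + m) (.inr a : Vtx X) = .inr a := by
        simp only [vswap]; split_ifs <;> first | omega | rfl
      have e2 : vswap (a + 1 + m) (.inr (a + 1 + (m + 1)) : Vtx X) = .inr (a + 1 + m) := by
        simp only [vswap, Sum.inr.injEq]; split_ifs <;> omega
      simp only [Prod.map, e1, e2] at h1 h2
      have h3 := ih a _ (by omega) hr'
      rw [h1, h2] at h3
      have := congrArg (s • ·) h3
      simpa only [smul_smul, ← mul_assoc, hs, one_mul, one_smul] using this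
  have sym : ∀ (a b : ℕ), a < b → b < k →
      contract s Φ k (.inr a, .inr b) r = s • contract s Φ k (.inr b, .inr a) r := by
    intro a b hab hb
    obtain ⟨m, rfl⟩ := Nat.exists_eq_add_of_le (Nat.succ_le_of_lt hab)
    exact key m a r hb wfr
  rcases v with x | a <;> rcases w with y | b
  · simp [contract]
  · simp only [contract, smul_smul]; rw [← pow_shift hs]
  · simp only [contract, smul_smul]; rw [pow_succ']
  · rcases lt_trichotomy a b with h | h | h
    · exact sym a b h hvw.2
    · subst h; simp [contract_self]
    · rw [sym b a h hvw.1, smul_smul, hs, one_smul]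

/-- Contraction of the first edge of a list. -/
def contract₂ (s : ℚ) (Φ : ℕ → List (Edge X) → M) (k : ℕ) : List (Edge X) → M
  | [] => 0
  | f :: r => contract s Φ k f r

theorem contract₂_equivariant {s : ℚ} (hs : s * s = 1) {Φ : ℕ → List (Edge X) → M}
    (hΦ : Equivariant s Φ) : Equivariant s (contract₂ s Φ) := by
  intro k i l hi wf
  rcases l with _ | ⟨f, r⟩
  · simp [contract₂]
  · exact contract_vswap hs hΦ hi wf

theorem contract₂_flip {s : ℚ} (hs : s * s = 1) {Φ : ℕ → List (Edge X) → M}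
    (hΦ : Equivariant s Φ) {k : ℕ} {e : Edge X} {v w : Vtx X} {r : List (Edge X)}
    (wf : WF k (e :: (v, w) :: r)) :
    contract s (contract₂ s Φ) k e ((v, w) :: r)
      = s • contract s (contract₂ s Φ) k e ((w, v) :: r) := by
  have core : ∀ (u : Vtx X) (b : ℕ), u ≠ .inr b → InRange k u → b < k →
      contract₂ s Φ (k - 1) (relabel (merge u b) ((v, w) :: r))
        = s • contract₂ s Φ (k - 1) (relabel (merge u b) ((w, v) :: r)) := by
    intro u b hub hu hb
    have := wf_relabel (fun w hw => merge_inRange hu hub hb hw)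
      (fun e' he => wf e' (List.mem_cons_of_mem _ he) : WF k ((v, w) :: r))
    exact contract_flip hs hΦ this
  obtain ⟨x, y⟩ := e
  have hxy := wf (x, y) (by simp)
  rcases x with x | a <;> rcases y with y | b
  · simp [contract]
  · simp only [contract]; rw [core (.inl x) b (by simp) trivial hxy.2, smul_comm]
  · simp only [contract]; rw [core (.inl y) a (by simp) trivial hxy.1, smul_comm]
  · by_cases h : a = b
    · simp [contract, h]
    · simp only [contract, h, if_false]; rw [core _ _ (by simpa using h) hxy.1 hxy.2, smul_comm]

theorem contract₂_swap {s : ℚ} (hs : s * s = 1) {Φ : ℕ → List (Edge X) → M}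
    (hΦ : Equivariant s Φ) {k : ℕ} {e f : Edge X} {r : List (Edge X)}
    (wf : WF k (e :: f :: r)) :
    contract s (contract₂ s Φ) k e (f :: r) = s • contract s (contract₂ s Φ) k f (e :: r) := by
  have flip1 : ∀ {v w : Vtx X} {f : Edge X}, WF k ((v, w) :: f :: r) →
      contract s (contract₂ s Φ) k (v, w) (f :: r)
        = s • contract s (contract₂ s Φ) k (w, v) (f :: r) :=
    fun wf => contract_flip hs (contract₂_equivariant hs hΦ) wf
  have mem : ∀ {e f : Edge X}, WF k (e :: f :: r) ↔
      (InRange k e.1 ∧ InRange k e.2) ∧ (InRange k f.1 ∧ InRange k f.2) ∧ WF k r := by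
    intro e f
    simp [WF]
  -- distinct internal targets
  have main : ∀ (v w : Vtx X) (b c : ℕ), b ≠ c →
      contract s (contract₂ s Φ) k (v, .inr b) ((w, .inr c) :: r)
        = s • contract s (contract₂ s Φ) k (w, .inr c) ((v, .inr b) :: r) := by
    intro v w b c hbc
    have hmc : ∀ (v : Vtx X) (b c : ℕ), c ≠ b →
        merge v b (.inr c) = (.inr (if b < c then c - 1 else c)) := by
      intro v b c h; simp [merge, drop, h]
    by_cases hv : v = .inr b
    · subst hv
      rw [contract_self]
      by_cases hw : w = .inr c
      · subst hw; rw [contract_self, smul_zero]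
      · rw [contract_inr _ _ _ _ _ hw]
        simp [contract₂, contract_self]
    by_cases hw : w = .inr c
    · subst hw
      rw [contract_self, contract_inr _ _ _ _ _ hv]
      simp [contract₂, contract_self]
    rw [contract_inr _ _ _ _ _ hv, contract_inr _ _ _ _ _ hw]
    simp only [List.map_cons, Prod.map, contract₂]
    by_cases h : v = .inr c ∧ w = .inr b
    · obtain ⟨rfl, rfl⟩ := h
      have h1 : merge (.inr c : Vtx X) b (.inr b) = merge (.inr c) b (.inr c) := by
        simp [merge]
      have h2 : merge (.inr b : Vtx X) c (.inr c) = merge (.inr b) c (.inr b) := by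
        simp [merge]
      rw [h1, h2, contract_self, contract_self]
      simp
    · have hne : ∀ (v w : Vtx X) (b c : ℕ), b ≠ c → v ≠ .inr b → w ≠ .inr c →
          ¬ (v = .inr c ∧ w = .inr b) → merge v b w ≠ .inr (if b < c then c - 1 else c) := by
        intro v w b c hbc hv hw h
        have hd : ∀ u : Vtx X, u ≠ .inr b → u ≠ .inr c →
            drop b u ≠ .inr (if b < c then c - 1 else c) := by
          intro u h1 h2
          rcases u with u | u
          · simp [drop]
          · simp only [drop, ne_eq, Sum.inr.injEq]
            simp at h1 h2
            split_ifs <;> omega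
        by_cases hwb : w = .inr b
        · subst hwb
          have : merge v b (.inr b) = drop b v := by simp [merge]
          rw [this]
          exact hd v hv (fun h' => h ⟨h', rfl⟩)
        · have : merge v b w = drop b w := by
            rcases w with w | w
            · rfl
            · simp at hwb; simp [merge, hwb]
          rw [this]
          exact hd w hwb hw
      rw [hmc v b c hbc.symm, hmc w c b hbc,
        contract_inr _ _ _ _ _ (hne v w b c hbc hv hw h),
        contract_inr _ _ _ _ _ (hne w v c b hbc.symm hw hv (fun h' => h ⟨h'.2, h'.1⟩)),
        relabel_relabel, relabel_relabel]
      simp only [merge_merge v w b c hv hw hbc h]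
      simp only [smul_smul]
      congr 1
      rcases lt_or_gt_of_ne hbc with hlt | hlt
      · obtain ⟨c, rfl⟩ : ∃ c', c = c' + 1 := ⟨c - 1, by omega⟩
        have : ¬ (c + 1 < b) := by omega
        simp only [hlt, this, if_true, if_false]
        rw [pow_succ' s c]
        simp only [Nat.add_sub_cancel]
        linear_combination (-(s ^ b * s ^ c)) * hs
      · obtain ⟨b, rfl⟩ : ∃ b', b = b' + 1 := ⟨b - 1, by omega⟩
        have : ¬ (b + 1 < c) := by omega
        simp only [hlt, this, if_true, if_false]
        rw [pow_succ' s b]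
        simp only [Nat.add_sub_cancel]
        ring
  -- the first target is internal
  have step1 : ∀ (v : Vtx X) (b : ℕ) (f : Edge X), WF k ((v, .inr b) :: f :: r) →
      contract s (contract₂ s Φ) k (v, .inr b) (f :: r)
        = s • contract s (contract₂ s Φ) k f ((v, .inr b) :: r) := by
    intro v b f wf
    obtain ⟨w, z⟩ := f
    -- the other edge has an internal end different from `b`
    have viaz : ∀ (w : Vtx X) (c : ℕ), WF k ((v, .inr b) :: (w, .inr c) :: r) → c ≠ b →
      contract s (contract₂ s Φ) k (v, .inr b) ((.inr c, w) :: r)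
        = s • contract s (contract₂ s Φ) k (.inr c, w) ((v, .inr b) :: r) := by
      intro w c wf hc
      have wf1 := mem.1 wf
      rw [contract₂_flip hs hΦ (mem.2 ⟨wf1.1, ⟨wf1.2.1.2, wf1.2.1.1⟩, wf1.2.2⟩), main _ _ _ _ hc.symm,
        ← flip1 (mem.2 ⟨⟨wf1.2.1.2, wf1.2.1.1⟩, wf1.1, wf1.2.2⟩)]
    have wf1 := mem.1 wf
    rcases z with y | c
    · rcases w with x | c
      · -- the second edge joins external vertices
        by_cases hv : v = .inr b
        · subst hv; simp [contract]
        · rw [contract_inr _ _ _ _ _ hv]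
          simp [contract, contract₂, merge]
      · by_cases hc : c = b
        · subst hc
          rcases v with x | a
          · simp [contract, contract₂, merge, drop]
          · by_cases ha : a = c
            · subst ha
              simp [contract, contract₂, merge, drop]
            · rw [flip1 wf, flip1 (mem.2 ⟨wf1.2.1, wf1.1, wf1.2.2⟩),
                contract₂_flip hs hΦ (v := .inr c) (w := .inl y)
                  (mem.2 ⟨⟨wf1.1.2, wf1.1.1⟩, wf1.2.1, wf1.2.2⟩), main _ _ _ _ ha,
                contract₂_flip hs hΦ (v := .inr a) (w := .inr c)
                  (mem.2 ⟨⟨wf1.2.1.2, wf1.2.1.1⟩, wf1.1, wf1.2.2⟩)]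
        · exact viaz _ _ (mem.2 ⟨wf1.1, ⟨wf1.2.1.2, wf1.2.1.1⟩, wf1.2.2⟩) hc
    · by_cases hc : c = b
      · subst hc
        rcases v with x | a
        · rcases w with y | d
          · simp [contract, contract₂, merge, drop]
          · by_cases hd : d = c
            · subst hd
              simp [contract, contract₂, merge, drop]
            · have := viaz (.inr c) d (mem.2 ⟨wf1.1, ⟨wf1.2.1.2, wf1.2.1.1⟩, wf1.2.2⟩) hd
              exact this
        · by_cases ha : a = c
          · subst ha
            rw [contract_self]
            by_cases hw : w = .inr a
            · subst hw; simp [contract_self]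
            · rw [contract_inr _ _ _ _ _ hw]; simp [contract₂, contract_self]
          · rw [flip1 wf, main _ _ _ _ ha,
              contract₂_flip hs hΦ (v := .inr a) (w := .inr c)
                  (mem.2 ⟨wf1.2.1, wf1.1, wf1.2.2⟩)]
      · exact main _ _ _ _ (fun h => hc h.symm)
  obtain ⟨v, w⟩ := e
  have wf1 := mem.1 wf
  rcases w with y | b
  · rcases v with x | a
    · -- the first edge joins external vertices
      obtain ⟨w, z⟩ := f
      rcases w with w | c <;> rcases z with z | d
      · simp [contract]
      · simp [contract, contract₂, merge]
      · simp [contract, contract₂, merge]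
      · by_cases h : c = d
        · simp [contract, h]
        · simp [contract, contract₂, merge, h]
    · rw [flip1 wf, step1 _ _ _ (mem.2 ⟨⟨wf1.1.2, wf1.1.1⟩, wf1.2⟩),
        contract₂_flip hs hΦ (mem.2 ⟨wf1.2.1, wf1.1, wf1.2.2⟩)]
  · exact step1 _ _ _ wf

end Combinatorics

section Admissibility

variable {X Y : Type}

theorem Admissible.wf {pt : X} {k : ℕ} {l : List (Edge X)} (h : Admissible pt k l) : WF k l :=
  h.inRange

theorem joined_map {l : List (Edge X)} {l' : List (Edge Y)} {f : Vtx X → Vtx Y}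
    (hf : ∀ e ∈ l, Joined l' (f e.1) (f e.2)) {v w : Vtx X} (h : Joined l v w) :
    Joined l' (f v) (f w) := by
  induction h with
  | rel v w h => exact hf _ h
  | refl v => exact .refl _
  | symm v w _ ih => exact .symm _ _ ih
  | trans u v w _ _ ih1 ih2 => exact .trans _ _ _ ih1 ih2

theorem joined_relabel {l : List (Edge X)} {f : Vtx X → Vtx Y} {v w : Vtx X} (h : Joined l v w) :
    Joined (relabel f l) (f v) (f w) :=
  joined_map (fun e he => .rel _ _ (List.mem_map.2 ⟨e, he, rfl⟩)) h

theorem joined_mono {l l' : List (Edge X)} (hl : ∀ e ∈ l, e ∈ l') {v w : Vtx X}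
    (h : Joined l v w) : Joined l' v w :=
  joined_map (f := id) (fun e he => .rel _ _ (hl e he)) h

theorem valence_append (i : ℕ) (A B : List (Edge X)) :
    valence i (A ++ B) = valence i A + valence i B := by
  simp [valence]

theorem valence_cons (i : ℕ) (e : Edge X) (B : List (Edge X)) :
    valence i (e :: B) = hit i e.1 + hit i e.2 + valence i B := by
  simp [valence]

theorem valence_relabel {i j k : ℕ} {f : Vtx X → Vtx Y} {l : List (Edge X)}
    (hf : ∀ v, InRange k v → hit i (f v) = hit j v) (hl : WF k l) :
    valence i (relabel f l) = valence j l := by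
  simp only [valence, relabel, List.map_map]
  congr 1
  apply List.map_congr_left
  intro e he
  simp [hf _ (hl e he).1, hf _ (hl e he).2]

theorem valence_relabel_zero {i k : ℕ} {f : Vtx X → Vtx Y} {l : List (Edge X)}
    (hf : ∀ v, InRange k v → hit i (f v) = 0) (hl : WF k l) :
    valence i (relabel f l) = 0 := by
  simp only [valence, relabel, List.map_map]
  apply List.sum_eq_zero
  intro x hx
  obtain ⟨e, he, rfl⟩ := List.mem_map.1 hx
  simp [hf _ (hl e he).1, hf _ (hl e he).2]

theorem admissible_perm {pt : X} {k : ℕ} {l l' : List (Edge X)} (hp : l.Perm l')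
    (h : Admissible pt k l) : Admissible pt k l' where
  inRange e he := h.inRange e (hp.mem_iff.2 he)
  base e he := h.base e (hp.mem_iff.2 he)
  trivalent i hi := by
    have : valence i l' = valence i l := (hp.map _).sum_eq.symm
    rw [this]; exact h.trivalent i hi
  connected i hi := by
    obtain ⟨x, hx⟩ := h.connected i hi
    exact ⟨x, joined_mono (fun e he => hp.mem_iff.1 he) hx⟩

theorem admissible_flip {pt : X} {k : ℕ} {v w : Vtx X} {r : List (Edge X)}
    (h : Admissible pt k ((v, w) :: r)) : Admissible pt k ((w, v) :: r) where
  inRange e he := by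
    rcases List.mem_cons.1 he with rfl | he
    · exact (h.inRange _ (List.mem_cons_self)).symm
    · exact h.inRange e (List.mem_cons_of_mem _ he)
  base e he := by
    rcases List.mem_cons.1 he with rfl | he
    · exact (h.base _ (List.mem_cons_self)).symm
    · exact h.base e (List.mem_cons_of_mem _ he)
  trivalent i hi := by
    have := h.trivalent i hi
    simp only [valence_cons] at this ⊢
    omega
  connected i hi := by
    obtain ⟨x, hx⟩ := h.connected i hi
    refine ⟨x, joined_map (f := id) ?_ hx⟩
    intro e he
    rcases List.mem_cons.1 he with rfl | he
    · exact .symm _ _ (.rel _ _ List.mem_cons_self)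
    · exact .rel _ _ (List.mem_cons_of_mem _ he)

theorem vswap_vswap (i : ℕ) (v : Vtx X) : vswap i (vswap i v) = v := by
  rcases v with v | v
  · rfl
  · simp only [vswap, Sum.inr.injEq]
    split_ifs <;> omega

theorem vswap_inRange {i k : ℕ} (hi : i + 1 < k) (v : Vtx X) (hv : InRange k v) :
    InRange k (vswap i v) := by
  rcases v with v | v
  · trivial
  · simp only [InRange, vswap] at hv ⊢
    split_ifs <;> omega

theorem admissible_vswap {pt : X} {k i : ℕ} {l : List (Edge X)} (hi : i + 1 < k)
    (h : Admissible pt k l) : Admissible pt k (relabel (vswap i) l) where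
  inRange := wf_relabel (vswap_inRange hi) h.wf
  base e he := by
    obtain ⟨e, he', rfl⟩ := List.mem_map.1 he
    have hb : ∀ v : Vtx X, v ≠ .inl pt → vswap i v ≠ .inl pt := by
      rintro (v | v) hv
      · exact hv
      · simp [vswap]
    exact ⟨hb _ (h.base e he').1, hb _ (h.base e he').2⟩
  trivalent j hj := by
    rw [valence_relabel (k := k) (j := if j = i then i + 1 else if j = i + 1 then i else j) ?_ h.wf]
    · refine h.trivalent _ ?_
      split_ifs <;> omega
    · rintro (v | v) -
      · rfl
      · simp only [hit, vswap]
        split_ifs <;> omega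
  connected j hj := by
    obtain ⟨x, hx⟩ := h.connected (if j = i then i + 1 else if j = i + 1 then i else j)
      (by split_ifs <;> omega)
    refine ⟨x, ?_⟩
    have := joined_relabel (f := vswap i) hx
    have e1 : vswap i (.inr (if j = i then i + 1 else if j = i + 1 then i else j) : Vtx X)
      = .inr j := vswap_vswap i (.inr j)
    rwa [e1] at this

theorem admissible_merge {pt : X} {k b : ℕ} {v : Vtx X} {r : List (Edge X)}
    (hv : v ≠ .inr b) (h : Admissible pt k ((v, .inr b) :: r)) :
    Admissible pt (k - 1) (relabel (merge v b) r) := by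
  have hvb := h.inRange _ List.mem_cons_self
  have hr : WF k r := fun e he => h.inRange e (List.mem_cons_of_mem _ he)
  have hb : b < k := hvb.2
  refine ⟨wf_relabel (fun w hw => merge_inRange hvb.1 hv hb hw) hr, ?_, ?_, ?_⟩
  · intro e he
    obtain ⟨e, he', rfl⟩ := List.mem_map.1 he
    have hd : ∀ w : Vtx X, w ≠ .inl pt → drop b w ≠ .inl pt := by
      rintro (w | w) hw
      · exact hw
      · simp [drop]
    have hm : ∀ w : Vtx X, w ≠ .inl pt → merge v b w ≠ .inl pt := by
      rintro (w | w) hw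
      · exact hw
      · simp only [merge]
        split_ifs
        · exact hd _ (h.base _ List.mem_cons_self).1
        · exact hd _ (by simp)
    have := h.base e (List.mem_cons_of_mem _ he')
    exact ⟨hm _ this.1, hm _ this.2⟩
  · intro i hi
    -- the label of the vertex `i` before the contraction
    let c := if i < b then i else i + 1
    have hc : c < k := by simp only [c]; split_ifs <;> omega
    have hcb : c ≠ b := by simp only [c]; split_ifs <;> omega
    have hdrop : ∀ w : Vtx X, w ≠ .inr b → hit i (drop b w) = hit c w := by
      rintro (w | w) hw
      · rfl
      · have : w ≠ b := by simpa using hw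
        simp only [drop, hit, c]
        split_ifs <;> omega
    have hsum : valence i (relabel (merge v b) r) = valence c r + hit c v * valence b r := by
      have : ∀ w : Vtx X, hit i (merge v b w) = hit c w + hit c v * hit b w := by
        rintro (w | w)
        · simp [merge, hit]
        · by_cases hw : w = b
          · subst hw
            have h1 : merge v w (.inr w) = drop w v := by simp [merge]
            rw [h1, hdrop v hv]
            simp [hit, hcb.symm]
          · have h1 : merge v b (.inr w) = drop b (.inr w) := by simp [merge, hw]
            rw [h1, hdrop _ (by simpa using hw)]
            simp [hit, hw]
      clear hr h
      induction r with
      | nil => simp [valence]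
      | cons e r ih =>
        simp only [List.map_cons, valence_cons, Prod.map, this] at ih ⊢
        rw [ih]; ring
    have h1 := h.trivalent c hc
    have h2 := h.trivalent b hb
    rw [valence_cons] at h1 h2
    have h3 : hit c (.inr b : Vtx X) = 0 := by simp [hit, hcb.symm]
    have h4 : hit b (.inr b : Vtx X) = 1 := by simp [hit]
    have h5 : hit b v = 0 := by
      rcases v with v | v
      · rfl
      · simp at hv; simp [hit, hv]
    have h6 : hit c v = 0 ∨ hit c v = 1 := by
      rcases v with v | v
      · left; rfl
      · simp only [hit]; split_ifs <;> simp
    simp only [h3, h4, h5] at h1 h2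
    rw [hsum]
    rcases h6 with h6 | h6 <;> rw [h6] at h1 ⊢ <;> omega
  · intro i hi
    let c := if i < b then i else i + 1
    have hc : c < k := by simp only [c]; split_ifs <;> omega
    have hcb : c ≠ b := by simp only [c]; split_ifs <;> omega
    obtain ⟨x, hx⟩ := h.connected c hc
    refine ⟨x, ?_⟩
    have hmc : merge v b (.inr c) = .inr i := by
      simp only [merge, hcb, if_false, drop, Sum.inr.injEq, c]
      split_ifs <;> omega
    have := joined_map (l' := relabel (merge v b) r) (f := merge v b) ?_ hx
    · rwa [hmc] at this
    · intro e he
      rcases List.mem_cons.1 he with rfl | he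
      · have : merge v b v = merge v b (.inr b) := by
          rcases v with v | v
          · simp [merge, drop]
          · simp at hv; simp [merge, hv]
        simp only [this]
        exact .refl _
      · exact .rel _ _ (List.mem_map.2 ⟨e, he, rfl⟩)

/-- Add `k` to the numbers of the internal vertices. -/
def shift (k : ℕ) : Vtx X → Vtx X
  | .inl x => .inl x
  | .inr j => .inr (k + j)

theorem shift_inRange {k k' : ℕ} (v : Vtx X) (hv : InRange k' v) : InRange (k + k') (shift k v) := by
  rcases v with v | v
  · trivial
  · simp only [InRange, shift] at hv ⊢; omega

theorem inRange_mono {k k' : ℕ} (hk : k ≤ k') (v : Vtx X) (hv : InRange k v) : InRange k' v := by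
  rcases v with v | v
  · trivial
  · simp only [InRange] at hv ⊢; omega

theorem admissible_mul {pt : X} {k k' : ℕ} {l l' : List (Edge X)} (h : Admissible pt k l)
    (h' : Admissible pt k' l') : Admissible pt (k + k') (l ++ relabel (shift k) l') where
  inRange e he := by
    rcases List.mem_append.1 he with he | he
    · have := h.inRange e he
      exact ⟨inRange_mono (by omega) _ this.1, inRange_mono (by omega) _ this.2⟩
    · exact wf_relabel shift_inRange h'.wf e he
  base e he := by
    rcases List.mem_append.1 he with he | he
    · exact h.base e he
    · obtain ⟨e, he', rfl⟩ := List.mem_map.1 he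
      have hb : ∀ v : Vtx X, v ≠ .inl pt → shift k v ≠ .inl pt := by
        rintro (v | v) hv
        · exact hv
        · simp [shift]
      exact ⟨hb _ (h'.base e he').1, hb _ (h'.base e he').2⟩
  trivalent i hi := by
    rw [valence_append]
    by_cases hik : i < k
    · have := h.trivalent i hik; omega
    · have := h'.trivalent (i - k) (by omega)
      rw [valence_relabel (k := k') (j := i - k) ?_ h'.wf]
      · omega
      · rintro (v | v) -
        · rfl
        · simp only [shift, hit]; split_ifs <;> omega
  connected i hi := by
    by_cases hik : i < k
    · obtain ⟨x, hx⟩ := h.connected i hik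
      exact ⟨x, joined_mono (fun e he => List.mem_append_left _ he) hx⟩
    · obtain ⟨x, hx⟩ := h'.connected (i - k) (by omega)
      refine ⟨x, joined_mono (fun e he => List.mem_append_right _ he) ?_⟩
      have := joined_relabel (f := shift k) hx
      have e1 : shift k (.inr (i - k) : Vtx X) = .inr i := by simp only [shift, Sum.inr.injEq]; omega
      rwa [e1] at this

end Admissibility

/-- A graph with internal vertices `0, …, numInt - 1` and external vertices in `X`, together with
an ordering of the internal vertices (by their numbers), an ordering of the edges, and a direction of
each edge. These data determine an `n`-orientation for every `n`. -/
@[ext]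
structure LGraph (X : Type) where
  numInt : ℕ
  edges : List (Edge X)

/-- The product glues two graphs along their external vertices; the edges and the internal vertices of
the second graph come after those of the first. -/
instance (X : Type) : Monoid (LGraph X) where
  one := ⟨0, []⟩
  mul g h := ⟨g.numInt + h.numInt, g.edges ++ relabel (shift g.numInt) h.edges⟩
  one_mul g := by
    apply LGraph.ext
    · exact Nat.zero_add _
    · change [] ++ relabel (shift 0) g.edges = g.edges
      have : (shift 0 : Vtx X → Vtx X) = id := by
        funext v; rcases v with v | v <;> simp [shift]
      simp [relabel, this]
  mul_one g := by
    apply LGraph.ext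
    · exact Nat.add_zero _
    · change g.edges ++ relabel _ [] = g.edges
      simp [relabel]
  mul_assoc a b c := by
    apply LGraph.ext
    · exact Nat.add_assoc _ _ _
    · change (a.edges ++ relabel _ b.edges) ++ relabel (shift (a.numInt + b.numInt)) c.edges
        = a.edges ++ relabel _ (b.edges ++ relabel _ c.edges)
      have : ∀ v : Vtx X, shift (a.numInt + b.numInt) v = shift a.numInt (shift b.numInt v) := by
        rintro (v | v) <;> simp [shift, add_assoc]
      simp [relabel, Function.comp_def, this, Prod.map]

theorem LGraph.mul_def {X : Type} (g h : LGraph X) :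
    g * h = ⟨g.numInt + h.numInt, g.edges ++ relabel (shift g.numInt) h.edges⟩ := rfl

/-- The admissible graphs whose external vertices are the elements of the pointed set `X` other than
the base point. -/
def AdmGraph (X : Pointed.{0}) : Submonoid (LGraph X) where
  carrier := {g | Admissible X.point g.numInt g.edges}
  one_mem' := by
    change Admissible X.point 0 []
    exact ⟨by simp, by simp, by simp, by simp⟩
  mul_mem' h h' := admissible_mul h h'

/-- The sign of a transposition of two edges, which have degree `n - 1`. -/
abbrev sgnE (n : ℕ) : ℚ := (-1) ^ (n + 1)
/-- The sign of a transposition of two internal vertices, which have degree `-n`, and of the reversal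
of an edge. -/
abbrev sgnV (n : ℕ) : ℚ := (-1) ^ n

/-- `Step n g c g'`: the graphs `g` and `g'` differ only in their numbering and directions, by an
elementary change that multiplies the `n`-orientation by the sign `c`. For `n` even an
`n`-orientation is an ordering of the edges, for `n` odd it is an ordering of the half-edges and the
internal vertices, up to even permutations: exchanging two consecutive edges gives the sign
`(-1) ^ (n - 1)`, reversing an edge or exchanging two consecutive internal vertices gives `(-1) ^ n`.
These changes generate all isomorphisms and changes of orientation. -/
inductive Step (n : ℕ) {X : Type} : LGraph X → ℚ → LGraph X → Prop
  | swapEdges (k : ℕ) (A B : List (Edge X)) (e f : Edge X) :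
      Step n ⟨k, A ++ e :: f :: B⟩ (sgnE n) ⟨k, A ++ f :: e :: B⟩
  | flipEdge (k : ℕ) (A B : List (Edge X)) (v w : Vtx X) :
      Step n ⟨k, A ++ (v, w) :: B⟩ (sgnV n) ⟨k, A ++ (w, v) :: B⟩
  | swapVertices (k i : ℕ) (hi : i + 1 < k) (l : List (Edge X)) :
      Step n ⟨k, l⟩ (sgnV n) ⟨k, relabel (vswap i) l⟩

theorem Step.admissible {n : ℕ} {X : Pointed.{0}} {g g' : LGraph X} {c : ℚ} (h : Step n g c g')
    (hg : g ∈ AdmGraph X) : g' ∈ AdmGraph X := by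
  cases h with
  | swapEdges k A B e f =>
    exact admissible_perm (List.Perm.append_left A (List.Perm.swap _ _ _)) hg
  | flipEdge k A B v w =>
    exact admissible_perm List.perm_middle.symm
      (admissible_flip (admissible_perm List.perm_middle hg))
  | swapVertices k i hi l => exact admissible_vswap hi hg

theorem relabel_append {X Y : Type} (f : Vtx X → Vtx Y) (A B : List (Edge X)) :
    relabel f (A ++ B) = relabel f A ++ relabel f B := List.map_append

theorem relabel_congr {X Y : Type} {f g : Vtx X → Vtx Y} {k : ℕ} (h : ∀ v, InRange k v → f v = g v)
    {l : List (Edge X)} (hl : WF k l) : relabel f l = relabel g l := by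
  apply List.map_congr_left
  intro e he
  simp [Prod.map, h _ (hl e he).1, h _ (hl e he).2]

theorem relabel_eq_self {X : Type} {f : Vtx X → Vtx X} {k : ℕ} (h : ∀ v, InRange k v → f v = v)
    {l : List (Edge X)} (hl : WF k l) : relabel f l = l := by
  rw [relabel_congr (g := id) h hl]; simp [relabel]

theorem Step.mul_left {n : ℕ} {X : Type} {g g' : LGraph X} {c : ℚ} (m : LGraph X)
    (hm : WF m.numInt m.edges) (h : Step n g c g') : Step n (m * g) c (m * g') := by
  cases h with
  | swapEdges k A B e f =>
    simp only [LGraph.mul_def, relabel, List.map_append, List.map_cons, ← List.append_assoc]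
    exact .swapEdges _ _ _ _ _
  | flipEdge k A B v w =>
    simp only [LGraph.mul_def, relabel, List.map_append, List.map_cons, ← List.append_assoc,
      Prod.map]
    exact .flipEdge _ _ _ _ _
  | swapVertices k i hi l =>
    have := Step.swapVertices (n := n) (m.numInt + k) (m.numInt + i) (by omega)
      (m.edges ++ relabel (shift m.numInt) l)
    convert this using 1
    · rfl
    refine LGraph.ext rfl ?_
    change m.edges ++ relabel (shift m.numInt) (relabel (vswap i) l) = _
    rw [relabel_append, relabel_eq_self (k := m.numInt) _ hm, relabel_relabel, relabel_relabel]
    · congr 2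
      funext v
      rcases v with v | v
      · rfl
      · simp only [shift, vswap, Sum.inr.injEq]
        split_ifs <;> omega
    · rintro (v | v) hv
      · rfl
      · simp only [InRange, vswap, Sum.inr.injEq] at hv ⊢
        split_ifs <;> omega

theorem Step.mul_right {n : ℕ} {X : Type} {g g' : LGraph X} {c : ℚ} (m : LGraph X)
    (h : Step n g c g') : Step n (g * m) c (g' * m) := by
  cases h with
  | swapEdges k A B e f =>
    simp only [LGraph.mul_def, List.append_assoc, List.cons_append]
    exact .swapEdges _ _ _ _ _
  | flipEdge k A B v w =>
    simp only [LGraph.mul_def, List.append_assoc, List.cons_append]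
    exact .flipEdge _ _ _ _ _
  | swapVertices k i hi l =>
    have := Step.swapVertices (n := n) (k + m.numInt) i (by omega)
      (l ++ relabel (shift k) m.edges)
    convert this using 1
    · rfl
    refine LGraph.ext rfl ?_
    change relabel (vswap i) l ++ relabel (shift k) m.edges = _
    rw [relabel_append]
    congr 1
    rw [relabel_relabel]
    congr 2
    funext v
    rcases v with v | v
    · rfl
    · simp only [shift, vswap, Sum.inr.injEq]
      split_ifs <;> omega

/-- The relations `g = c • g'` for `Step n g c g'`. -/
def relSet (n : ℕ) (X : Pointed.{0}) : Set (MonoidAlgebra ℚ (AdmGraph X)) :=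
  {a | ∃ (g g' : AdmGraph X) (c : ℚ), Step n g.1 c g'.1 ∧
    a = MonoidAlgebra.single g 1 - MonoidAlgebra.single g' c}

/-- The ideal of relations; it is the linear span of the relations, see `mem_relIdeal`. -/
noncomputable def relIdeal (n : ℕ) (X : Pointed.{0}) : Ideal (MonoidAlgebra ℚ (AdmGraph X)) :=
  Ideal.span (relSet n X)

theorem mul_left_mem_span {n : ℕ} {X : Pointed.{0}} (a b : MonoidAlgebra ℚ (AdmGraph X))
    (hb : b ∈ Submodule.span ℚ (relSet n X)) : a * b ∈ Submodule.span ℚ (relSet n X) := by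
  induction hb using Submodule.span_induction with
  | zero => simp
  | add x y _ _ hx hy => rw [mul_add]; exact add_mem hx hy
  | smul c x _ hx => rw [mul_smul_comm]; exact Submodule.smul_mem _ _ hx
  | mem b hb =>
    obtain ⟨g, g', c, h, rfl⟩ := hb
    induction a using MonoidAlgebra.induction_linear with
    | zero => simp
    | add x y hx hy => rw [add_mul]; exact add_mem hx hy
    | single m t =>
      have : MonoidAlgebra.single m t * (MonoidAlgebra.single g 1 - MonoidAlgebra.single g' c)
          = t • (MonoidAlgebra.single (m * g) (1 : ℚ) - MonoidAlgebra.single (m * g') c) := by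
        simp [mul_sub, MonoidAlgebra.single_mul_single, smul_sub]
      rw [this]
      exact Submodule.smul_mem _ _ (Submodule.subset_span
        ⟨m * g, m * g', c, h.mul_left _ (Admissible.wf m.2), rfl⟩)

theorem mul_right_mem_span {n : ℕ} {X : Pointed.{0}} (a b : MonoidAlgebra ℚ (AdmGraph X))
    (hb : b ∈ Submodule.span ℚ (relSet n X)) : b * a ∈ Submodule.span ℚ (relSet n X) := by
  induction hb using Submodule.span_induction with
  | zero => simp
  | add x y _ _ hx hy => rw [add_mul]; exact add_mem hx hy
  | smul c x _ hx => rw [smul_mul_assoc]; exact Submodule.smul_mem _ _ hx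
  | mem b hb =>
    obtain ⟨g, g', c, h, rfl⟩ := hb
    induction a using MonoidAlgebra.induction_linear with
    | zero => simp
    | add x y hx hy => rw [mul_add]; exact add_mem hx hy
    | single m t =>
      have : (MonoidAlgebra.single g 1 - MonoidAlgebra.single g' c) * MonoidAlgebra.single m t
          = t • (MonoidAlgebra.single (g * m) (1 : ℚ) - MonoidAlgebra.single (g' * m) c) := by
        simp [sub_mul, MonoidAlgebra.single_mul_single, smul_sub, mul_comm]
      rw [this]
      exact Submodule.smul_mem _ _ (Submodule.subset_span
        ⟨g * m, g' * m, c, h.mul_right _, rfl⟩)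

theorem mem_relIdeal {n : ℕ} {X : Pointed.{0}} {a : MonoidAlgebra ℚ (AdmGraph X)} :
    a ∈ relIdeal n X ↔ a ∈ Submodule.span ℚ (relSet n X) := by
  constructor
  · intro h
    induction h using Submodule.span_induction with
    | zero => simp
    | add x y _ _ hx hy => exact add_mem hx hy
    | smul c x _ hx => exact mul_left_mem_span c x hx
    | mem b hb => exact Submodule.subset_span hb
  · intro h
    induction h using Submodule.span_induction with
    | zero => simp
    | add x y _ _ hx hy => exact add_mem hx hy
    | smul c x _ hx =>
      rw [← one_mul x, ← smul_mul_assoc]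
      exact Ideal.mul_mem_left _ _ hx
    | mem b hb => exact Ideal.subset_span hb

instance (n : ℕ) (X : Pointed.{0}) : (relIdeal n X).IsTwoSided where
  mul_mem_of_left _ h := mem_relIdeal.2 (mul_right_mem_span _ _ (mem_relIdeal.1 h))

/-- The space spanned by the isomorphism classes of `n`-oriented admissible graphs, where a graph with
the opposite orientation is identified with minus the graph, as an algebra under gluing. -/
abbrev GraphAlg (n : ℕ) (X : Pointed.{0}) : Type :=
  MonoidAlgebra ℚ (AdmGraph X) ⧸ relIdeal n X

noncomputable section

variable {n : ℕ} {X : Pointed.{0}}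

open Classical in
/-- The class of an admissible graph; it is zero by convention if the graph is not admissible. -/
def cls (n : ℕ) (X : Pointed.{0}) (g : LGraph X) : GraphAlg n X :=
  if h : g ∈ AdmGraph X then Ideal.Quotient.mk _ (MonoidAlgebra.single ⟨g, h⟩ 1) else 0

theorem cls_of_mem {g : LGraph X} (h : g ∈ AdmGraph X) :
    cls n X g = Ideal.Quotient.mk _ (MonoidAlgebra.single ⟨g, h⟩ 1) := dif_pos h

theorem cls_of_notMem {g : LGraph X} (h : g ∉ AdmGraph X) : cls n X g = 0 := dif_neg h

theorem cls_mul {g h : LGraph X} (hg : g ∈ AdmGraph X) (hh : h ∈ AdmGraph X) :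
    cls n X (g * h) = cls n X g * cls n X h := by
  rw [cls_of_mem hg, cls_of_mem hh, cls_of_mem (mul_mem hg hh), ← map_mul,
    MonoidAlgebra.single_mul_single, one_mul]
  rfl

theorem cls_one : cls n X 1 = 1 := by
  rw [cls_of_mem (one_mem _)]
  rfl

theorem mk_smul (c : ℚ) (a : MonoidAlgebra ℚ (AdmGraph X)) :
    (Ideal.Quotient.mk (relIdeal n X) (c • a)) = c • Ideal.Quotient.mk (relIdeal n X) a := rfl

theorem sgnV_mul (n : ℕ) : sgnV n * sgnV n = 1 := by
  rw [sgnV, ← mul_pow]; simp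
theorem sgnE_mul (n : ℕ) : sgnE n * sgnE n = 1 := by
  rw [sgnE, ← mul_pow]; simp
theorem sgnE_mul_sgnV (n : ℕ) : sgnE n * sgnV n = -1 := by
  have := sgnV_mul n
  simp only [sgnE, pow_succ'] at *
  linear_combination -this

theorem Step.sq {g g' : LGraph X} {c : ℚ} (h : Step n g c g') : c * c = 1 := by
  cases h
  · exact sgnE_mul n
  · exact sgnV_mul n
  · exact sgnV_mul n

theorem Step.symm {g g' : LGraph X} {c : ℚ} (h : Step n g c g') : Step n g' c g := by
  cases h with
  | swapEdges => exact .swapEdges _ _ _ _ _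
  | flipEdge => exact .flipEdge _ _ _ _ _
  | swapVertices k i hi l =>
    have := Step.swapVertices (n := n) k i hi (relabel (vswap i) l)
    rw [relabel_relabel] at this
    simpa only [vswap_vswap, relabel, Prod.map_id', List.map_id'] using this

theorem cls_step {g g' : LGraph X} {c : ℚ} (h : Step n g c g') :
    cls n X g = c • cls n X g' := by
  by_cases hg : g ∈ AdmGraph X
  · have hg' := h.admissible hg
    rw [cls_of_mem hg, cls_of_mem hg', ← mk_smul, Ideal.Quotient.eq]
    apply Ideal.subset_span
    refine ⟨⟨g, hg⟩, ⟨g', hg'⟩, c, h, ?_⟩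
    simp
  · have hg' : g' ∉ AdmGraph X := fun h' => hg (h.symm.admissible h')
    rw [cls_of_notMem hg, cls_of_notMem hg', smul_zero]

theorem cls_induction {p : GraphAlg n X → Prop} (h0 : p 0) (hadd : ∀ a b, p a → p b → p (a + b))
    (hcls : ∀ g ∈ AdmGraph X, ∀ c : ℚ, p (c • cls n X g)) (a : GraphAlg n X) : p a := by
  obtain ⟨a, rfl⟩ := Ideal.Quotient.mk_surjective a
  induction a using MonoidAlgebra.induction_linear with
  | zero => simpa using h0
  | add x y hx hy => rw [map_add]; exact hadd _ _ hx hy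
  | single m t =>
    have := hcls m.1 m.2 t
    rw [cls_of_mem m.2, ← mk_smul] at this
    simpa using this

/-- A linear map on the graph algebra defined by its values on graphs. -/
def liftLin {N : Type*} [AddCommGroup N] [Module ℚ N] (φ : LGraph X → N)
    (hφ : ∀ g ∈ AdmGraph X, ∀ g' c, Step n g c g' → φ g = c • φ g') : GraphAlg n X →ₗ[ℚ] N :=
  ((relIdeal n X).restrictScalars ℚ).liftQ
    ((Finsupp.linearCombination ℚ fun g : AdmGraph X => φ g.1) ∘ₗ
      (MonoidAlgebra.coeffLinearEquiv ℚ).toLinearMap) (by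
    intro a ha
    replace ha := mem_relIdeal.1 ha
    induction ha using Submodule.span_induction with
    | zero => simp
    | add x y _ _ hx hy => exact add_mem hx hy
    | smul c x _ hx => exact Submodule.smul_mem _ _ hx
    | mem b hb =>
      obtain ⟨g, g', c, h, rfl⟩ := hb
      simp [hφ g.1 g.2 g'.1 c h])

theorem liftLin_cls {N : Type*} [AddCommGroup N] [Module ℚ N] (φ : LGraph X → N)
    (hφ : ∀ g ∈ AdmGraph X, ∀ g' c, Step n g c g' → φ g = c • φ g') {g : LGraph X}
    (hg : g ∈ AdmGraph X) : liftLin φ hφ (cls n X g) = φ g := by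
  rw [cls_of_mem hg]
  change (Finsupp.linearCombination ℚ fun g : AdmGraph X => φ g.1)
    ((MonoidAlgebra.coeffLinearEquiv ℚ) (MonoidAlgebra.single ⟨g, hg⟩ 1)) = _
  simp

end

noncomputable section

variable {n : ℕ} {X : Pointed.{0}}

/-- The differential of a graph: the signed sum of the contractions of its edges, with the sign for
moving the contracted edge and the removed internal vertex to the front. -/
def dGraph (n : ℕ) (X : Pointed.{0}) (g : LGraph X) : GraphAlg n X :=
  pickSum (sgnE n) (contract (sgnV n) (fun k l => cls n X ⟨k, l⟩) g.numInt) g.edges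

theorem cls_equivariant : Equivariant (sgnV n) (fun k l => cls n X ⟨k, l⟩) := by
  intro k i l hi _
  exact cls_step (Step.swapVertices k i hi l).symm

theorem contract_congr {X : Type} {M : Type*} [AddCommGroup M] [Module ℚ M] {s c : ℚ}
    {Φ : ℕ → List (Edge X) → M} {r r' : List (Edge X)}
    (h : ∀ k f, Φ k (relabel f r) = c • Φ k (relabel f r')) (k : ℕ) (e : Edge X) :
    contract s Φ k e r = c • contract s Φ k e r' := by
  obtain ⟨v | a, w | b⟩ := e
  · simp [contract]
  · simp only [contract]; rw [h, smul_comm]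
  · simp only [contract]; rw [h, smul_comm]
  · by_cases hab : a = b
    · simp [contract, hab]
    · simp only [contract, hab, if_false]; rw [h, smul_comm]

theorem wf_perm {X : Type} {k : ℕ} {l l' : List (Edge X)} (h : l.Perm l') (hl : WF k l') : WF k l :=
  fun e he => hl e (h.mem_iff.1 he)

theorem dGraph_step {g g' : LGraph X} {c : ℚ} (hg : g ∈ AdmGraph X) (h : Step n g c g') :
    dGraph n X g = c • dGraph n X g' := by
  cases h with
  | swapEdges k A B e f =>
    refine pickSum_swap (sgnE_mul n) _ _ _ _ _ ?_
    intro x A' a' b' B' _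
    refine contract_congr ?_ _ _
    intro k f
    simp only [List.map_append, List.map_cons]
    exact cls_step (.swapEdges _ _ _ _ _)
  | flipEdge k A B v w =>
    have wf : WF k ((v, w) :: B) := fun e he =>
      Admissible.wf hg e (List.mem_append_right _ he)
    simp only [dGraph, pickSum_append, pickSum, smul_add]
    have wfA : WF k ((v, w) :: (A ++ B)) :=
      wf_perm List.perm_middle.symm (Admissible.wf hg)
    rw [contract_flip (sgnV_mul n) cls_equivariant wfA]
    rw [pickSum_congr (sgnE n) (sgnV n)
        (fun x r => contract (sgnV n) (fun k l => cls n X ⟨k, l⟩) k x (r ++ (v, w) :: B))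
        (fun x r => contract (sgnV n) (fun k l => cls n X ⟨k, l⟩) k x (r ++ (w, v) :: B)),
      pickSum_congr (sgnE n) (sgnV n)
        (fun x r => contract (sgnV n) (fun k l => cls n X ⟨k, l⟩) k x (A ++ (v, w) :: r))
        (fun x r => contract (sgnV n) (fun k l => cls n X ⟨k, l⟩) k x (A ++ (w, v) :: r))]
    · simp only [smul_smul, mul_comm, mul_assoc]
    · intro x r _
      refine contract_congr ?_ _ _
      intro k f
      simp only [List.map_append, List.map_cons, Prod.map]
      exact cls_step (.flipEdge _ _ _ _ _)
    · intro x r _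
      refine contract_congr ?_ _ _
      intro k f
      simp only [List.map_append, List.map_cons, Prod.map]
      exact cls_step (.flipEdge _ _ _ _ _)
  | swapVertices k i hi l =>
    simp only [dGraph]
    rw [pickSum_map]
    apply pickSum_congr
    intro x r hp
    rw [contract_vswap (sgnV_mul n) cls_equivariant hi (wf_perm hp (Admissible.wf hg)),
      smul_smul, sgnV_mul, one_smul]

/-- The differential of the graph algebra. -/
def differential (n : ℕ) (X : Pointed.{0}) : GraphAlg n X →ₗ[ℚ] GraphAlg n X :=
  liftLin (dGraph n X) fun _ hg _ _ h => dGraph_step hg h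

theorem differential_cls {g : LGraph X} (hg : g ∈ AdmGraph X) :
    differential n X (cls n X g) = dGraph n X g := liftLin_cls _ _ hg

/-- An elimination principle for properties of the contractions of an edge. -/
theorem contract_rec {k : ℕ} {e : Edge X} {r : List (Edge X)}
    (h : (⟨k, e :: r⟩ : LGraph X) ∈ AdmGraph X)
    {p : (GraphAlg n X) → Prop} (h0 : p 0)
    (h1 : ∀ (c : ℚ) (v : Vtx X) (b : ℕ), b < k →
      (⟨k - 1, relabel (merge v b) r⟩ : LGraph X) ∈ AdmGraph X →
      p (c • cls n X ⟨k - 1, relabel (merge v b) r⟩)) :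
    p (contract (sgnV n) (fun k l => cls n X ⟨k, l⟩) k e r) := by
  obtain ⟨v | a, w | b⟩ := e
  · exact h0
  · exact h1 _ _ _ (Admissible.wf h _ List.mem_cons_self).2 (admissible_merge (by simp) h)
  · exact h1 _ _ _ (Admissible.wf h _ List.mem_cons_self).1
      (admissible_merge (by simp) (admissible_flip h))
  · by_cases hab : a = b
    · simpa [contract, hab] using h0
    · simp only [contract, hab, if_false]
      exact h1 _ _ _ (Admissible.wf h _ List.mem_cons_self).2
        (admissible_merge (by simpa using hab) h)

theorem pickSum_smul {α M : Type*} [AddCommGroup M] [Module ℚ M] (s c : ℚ) (T : α → List α → M)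
    (l : List α) : c • pickSum s T l = pickSum s (fun x r => c • T x r) l :=
  (pickSum_congr s c _ _ l fun _ _ _ => rfl).symm

theorem pickSum_mem {α M : Type*} [AddCommGroup M] [Module ℚ M] (N : Submodule ℚ M) (s : ℚ)
    (T : α → List α → M) (l : List α) (h : ∀ x r, (x :: r).Perm l → T x r ∈ N) :
    pickSum s T l ∈ N := by
  induction l generalizing T with
  | nil => exact N.zero_mem
  | cons a l ih =>
    refine N.add_mem (h _ _ (List.Perm.refl _)) (N.smul_mem _ (ih _ ?_))
    intro x r hr
    exact h x (a :: r) ((List.Perm.swap _ _ _).trans (hr.cons a))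

theorem pickSum_congr' {α M : Type*} [AddCommGroup M] [Module ℚ M] (s : ℚ) (T T' : α → List α → M)
    (l : List α) (h : ∀ x r, (x :: r).Perm l → T x r = T' x r) :
    pickSum s T l = pickSum s T' l := by
  have := pickSum_congr s 1 T T' l (by simpa using h)
  simpa using this

theorem differential_differential (a : GraphAlg n X) :
    differential n X (differential n X a) = 0 := by
  induction a using cls_induction with
  | h0 => simp
  | hadd a b ha hb => simp [ha, hb]
  | hcls g hg c =>
    simp only [map_smul]
    rw [differential_cls hg, dGraph, map_pickSum]
    have : ∀ x r, (x :: r).Perm g.edges →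
        differential n X (contract (sgnV n) (fun k l => cls n X ⟨k, l⟩) g.numInt x r)
          = pickSum (sgnE n) (fun y r => contract (sgnV n)
              (contract₂ (sgnV n) (fun k l => cls n X ⟨k, l⟩)) g.numInt x (y :: r)) r := by
      intro x r hp
      have hg' : Admissible X.point g.numInt (x :: r) := admissible_perm hp.symm hg
      obtain ⟨v | a, w | b⟩ := x
      · simp only [contract, map_zero]
        exact (pickSum_zero _ _ _ fun _ _ _ => rfl).symm
      · simp only [contract, map_smul]
        rw [differential_cls (admissible_merge (by simp) hg'), dGraph, pickSum_map, pickSum_smul]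
        rfl
      · simp only [contract, map_smul]
        rw [differential_cls (admissible_merge (by simp) (admissible_flip hg')), dGraph,
          pickSum_map, pickSum_smul]
        rfl
      · by_cases hab : a = b
        · simp only [contract, hab, if_true, map_zero]
          exact (pickSum_zero _ _ _ fun _ _ _ => rfl).symm
        · simp only [contract, hab, if_false, map_smul]
          rw [differential_cls (admissible_merge (by simpa using hab) hg'), dGraph, pickSum_map,
            pickSum_smul]
          rfl
    rw [pickSum_congr' _ _ _ _ this, pickSum_pickSum (sgnE_mul_sgnV n) (sgnE_mul n), smul_zero]
    intro x y r hp
    exact contract₂_swap (sgnV_mul n) cls_equivariant (wf_perm hp (Admissible.wf hg))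

/-! ### The Leibniz rule -/

theorem merge_shift_of_lt {v w : Vtx X} {b k : ℕ} (hb : b < k) :
    merge v b (shift k w) = shift (k - 1) w := by
  rcases w with w | w
  · rfl
  · have : k + w ≠ b := by omega
    simp only [shift, merge, this, if_false, drop, Sum.inr.injEq]
    split_ifs <;> omega

theorem merge_shift (v w : Vtx X) (b k : ℕ) :
    merge (shift k v) (k + b) (shift k w) = shift k (merge v b w) := by
  have hd : ∀ u : Vtx X, drop (k + b) (shift k u) = shift k (drop b u) := by
    rintro (u | u)
    · rfl
    · simp only [shift, drop, Sum.inr.injEq]; split_ifs <;> omega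
  rcases w with w | w
  · rfl
  · by_cases hw : w = b
    · subst hw
      have h1 : merge v w (.inr w) = drop w v := by simp [merge]
      have h2 : merge (shift k v) (k + w) (shift k (.inr w)) = drop (k + w) (shift k v) := by
        simp [merge, shift]
      rw [h1, h2, hd]
    · have h1 : merge v b (.inr w) = drop b (.inr w) := by simp [merge, hw]
      have h2 : merge (shift k v) (k + b) (shift k (.inr w)) = drop (k + b) (shift k (.inr w)) := by
        simp [merge, shift, hw]
      rw [h1, h2, hd]

theorem merge_of_inRange {v w : Vtx X} {b k : ℕ} (hk : k ≤ b) (hw : InRange k w) :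
    merge v b w = w := by
  rcases w with w | w
  · rfl
  · simp only [InRange] at hw
    have : w ≠ b := by omega
    simp only [merge, this, if_false, drop, Sum.inr.injEq]
    split_ifs <;> omega

theorem dGraph_mul {g h : LGraph X} (hg : g ∈ AdmGraph X) (hh : h ∈ AdmGraph X) :
    dGraph n X (g * h) = dGraph n X g * cls n X h
      + (sgnE n ^ g.edges.length * sgnV n ^ g.numInt) • (cls n X g * dGraph n X h) := by
  rw [dGraph, LGraph.mul_def]
  simp only
  rw [pickSum_append, pickSum_map, mul_smul]
  congr 1
  · have h1 : ∀ x r, (x :: r).Perm g.edges →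
        contract (sgnV n) (fun k l => cls n X ⟨k, l⟩) (g.numInt + h.numInt) x
          (r ++ relabel (shift g.numInt) h.edges)
        = LinearMap.mulRight ℚ (cls n X h)
          (contract (sgnV n) (fun k l => cls n X ⟨k, l⟩) g.numInt x r) := by
      intro x r hp
      have hg' : Admissible X.point g.numInt (x :: r) := admissible_perm hp.symm hg
      have key : ∀ (v : Vtx X) (b : ℕ), b < g.numInt →
          (⟨g.numInt - 1, relabel (merge v b) r⟩ : LGraph X) ∈ AdmGraph X →
          cls n X ⟨g.numInt + h.numInt - 1,
            relabel (merge v b) (r ++ relabel (shift g.numInt) h.edges)⟩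
          = cls n X ⟨g.numInt - 1, relabel (merge v b) r⟩ * cls n X h := by
        intro v b hb hm
        rw [← cls_mul hm hh, LGraph.mul_def]
        congr 2
        · simp only; omega
        · rw [relabel_append, relabel_relabel]
          simp only [merge_shift_of_lt hb]
      have hx := hg'.inRange _ List.mem_cons_self
      obtain ⟨v | a, w | b⟩ := x
      · simp [contract]
      · simp only [contract, map_smul, LinearMap.mulRight_apply]
        rw [key _ _ hx.2 (admissible_merge (by simp) hg')]
      · simp only [contract, map_smul, LinearMap.mulRight_apply]
        rw [key _ _ hx.1 (admissible_merge (by simp) (admissible_flip hg'))]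
      · by_cases hab : a = b
        · simp [contract, hab]
        · simp only [contract, hab, if_false, map_smul, LinearMap.mulRight_apply]
          rw [key _ _ hx.2 (admissible_merge (by simpa using hab) hg')]
    rw [pickSum_congr' _ _ _ _ h1, ← map_pickSum]
    rfl
  · congr 1
    have h1 : ∀ x r, (x :: r).Perm h.edges →
        contract (sgnV n) (fun k l => cls n X ⟨k, l⟩) (g.numInt + h.numInt)
          (Prod.map (shift g.numInt) (shift g.numInt) x)
          (g.edges ++ relabel (shift g.numInt) r)
        = sgnV n ^ g.numInt • LinearMap.mulLeft ℚ (cls n X g)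
          (contract (sgnV n) (fun k l => cls n X ⟨k, l⟩) h.numInt x r) := by
      intro x r hp
      have hh' : Admissible X.point h.numInt (x :: r) := admissible_perm hp.symm hh
      have key : ∀ (v : Vtx X) (b : ℕ), b < h.numInt →
          (⟨h.numInt - 1, relabel (merge v b) r⟩ : LGraph X) ∈ AdmGraph X →
          cls n X ⟨g.numInt + h.numInt - 1,
            relabel (merge (shift g.numInt v) (g.numInt + b))
              (g.edges ++ relabel (shift g.numInt) r)⟩
          = cls n X g * cls n X ⟨h.numInt - 1, relabel (merge v b) r⟩ := by
        intro v b hb hm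
        rw [← cls_mul hg hm, LGraph.mul_def]
        congr 2
        · simp only; omega
        · rw [relabel_append, relabel_relabel, relabel_relabel]
          simp only [merge_shift]
          rw [relabel_eq_self (k := g.numInt) _ (Admissible.wf hg)]
          intro v hv
          exact merge_of_inRange (by omega) hv
      have hx := hh'.inRange _ List.mem_cons_self
      obtain ⟨v | a, w | b⟩ := x
      · simp [contract, shift]
      · have := key (.inl v) b hx.2 (admissible_merge (by simp) hh')
        simp only [shift] at this
        simp only [contract, map_smul, LinearMap.mulLeft_apply, Prod.map, shift, this, pow_add,
          mul_smul]
      · have := key (.inl w) a hx.1 (admissible_merge (by simp) (admissible_flip hh'))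
        simp only [shift] at this
        simp only [contract, map_smul, LinearMap.mulLeft_apply, Prod.map, shift, this, pow_add,
          mul_smul]
      · by_cases hab : a = b
        · simp [contract, hab, shift]
        · have hab' : ¬ (g.numInt + a = g.numInt + b) := by omega
          have := key (.inr a) b hx.2 (admissible_merge (by simpa using hab) hh')
          simp only [shift] at this
          simp only [contract, map_smul, LinearMap.mulLeft_apply, Prod.map, shift, this, pow_add,
            mul_smul, hab, hab', if_false]
    rw [pickSum_congr' _ _ _ _ h1, ← pickSum_smul, ← map_pickSum]
    rfl

/-! ### The grading -/

/-- The degree of a graph. -/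
def degree {X : Type} (n : ℕ) (g : LGraph X) : ℤ := ((n : ℤ) - 1) * g.edges.length - n * g.numInt

theorem degree_mul {X : Type} (g h : LGraph X) : degree n (g * h) = degree n g + degree n h := by
  simp only [degree, LGraph.mul_def, List.length_append, List.length_map]
  push_cast
  ring

theorem Step.degree_eq {X : Type} {g g' : LGraph X} {c : ℚ} (h : Step n g c g') :
    degree n g = degree n g' := by
  cases h <;> simp [degree]

/-- The elements of degree `i`. -/
def gr (n : ℕ) (X : Pointed.{0}) (i : ℤ) : Submodule ℚ (GraphAlg n X) :=
  Submodule.span ℚ {a | ∃ g ∈ AdmGraph X, degree n g = i ∧ a = cls n X g}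

theorem cls_mem_gr (g : LGraph X) : cls n X g ∈ gr n X (degree n g) := by
  by_cases hg : g ∈ AdmGraph X
  · exact Submodule.subset_span ⟨g, hg, rfl, rfl⟩
  · rw [cls_of_notMem hg]; exact Submodule.zero_mem _

theorem gr_gradedMonoid : SetLike.GradedMonoid (gr n X) where
  one_mem := by
    have := cls_mem_gr (n := n) (1 : LGraph X)
    rw [cls_one] at this
    have h0 : degree n (1 : LGraph X) = 0 := by
      change ((n : ℤ) - 1) * (([] : List (Edge X)).length : ℤ) - n * ((0 : ℕ) : ℤ) = 0
      simp
    rwa [h0] at this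
  mul_mem i j a b ha hb := by
    induction ha using Submodule.span_induction with
    | zero => simp
    | add x y _ _ hx hy => rw [add_mul]; exact add_mem hx hy
    | smul c x _ hx => rw [smul_mul_assoc]; exact Submodule.smul_mem _ _ hx
    | mem a ha =>
      obtain ⟨g, hg, rfl, rfl⟩ := ha
      induction hb using Submodule.span_induction with
      | zero => simp
      | add x y _ _ hx hy => rw [mul_add]; exact add_mem hx hy
      | smul c x _ hx => rw [mul_smul_comm]; exact Submodule.smul_mem _ _ hx
      | mem b hb =>
        obtain ⟨h, hh, rfl, rfl⟩ := hb
        rw [← cls_mul hg hh, ← degree_mul]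
        exact cls_mem_gr _

/-- The decomposition of an element into its homogeneous components. -/
def decompose (n : ℕ) (X : Pointed.{0}) :
    GraphAlg n X →ₗ[ℚ] DirectSum ℤ fun i => gr n X i :=
  liftLin (fun g => DirectSum.lof ℚ ℤ (fun i => gr n X i) (degree n g) ⟨cls n X g, cls_mem_gr g⟩) (by
    intro g _ g' c h
    rw [← map_smul]
    have key : ∀ (i j : ℤ) (x y : GraphAlg n X) (hx : x ∈ gr n X i) (hy : y ∈ gr n X j), i = j →
        x = y → DirectSum.lof ℚ ℤ (fun i => gr n X i) i ⟨x, hx⟩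
          = DirectSum.lof ℚ ℤ (fun i => gr n X i) j ⟨y, hy⟩ := by
      rintro i j x y hx hy rfl rfl; rfl
    exact key _ _ _ _ _ (Submodule.smul_mem _ _ (cls_mem_gr g')) h.degree_eq (cls_step h))

theorem gr_isInternal : DirectSum.IsInternal (gr n X) := by
  have left : ∀ a, DirectSum.coeLinearMap (gr n X) (decompose n X a) = a := by
    intro a
    induction a using cls_induction with
    | h0 => simp
    | hadd a b ha hb => simp [ha, hb]
    | hcls g hg c =>
      rw [map_smul, map_smul, decompose, liftLin_cls _ _ hg]
      simp
  have right : ∀ a, decompose n X (DirectSum.coeLinearMap (gr n X) a) = a := by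
    intro a
    induction a using DirectSum.induction_on with
    | zero => simp
    | add a b ha hb => simp [ha, hb]
    | of i x =>
      obtain ⟨x, hx⟩ := x
      change decompose n X (DirectSum.coeLinearMap (gr n X)
        (DirectSum.lof ℚ ℤ (fun i => gr n X i) i ⟨x, hx⟩))
        = DirectSum.lof ℚ ℤ (fun i => gr n X i) i ⟨x, hx⟩
      rw [DirectSum.coeLinearMap_lof]
      simp only
      induction hx using Submodule.span_induction with
      | zero => rw [map_zero]; exact (map_zero _).symm
      | add x y hx hy h1 h2 => rw [map_add, h1, h2, ← map_add]; rfl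
      | smul c x hx h1 => rw [map_smul, h1, ← map_smul]; rfl
      | mem x hx =>
        obtain ⟨g, hg, rfl, rfl⟩ := hx
        rw [decompose, liftLin_cls _ _ hg]
  exact ⟨Function.LeftInverse.injective right, Function.RightInverse.surjective left⟩

theorem differential_mem {i : ℤ} {a : GraphAlg n X} (ha : a ∈ gr n X i) :
    differential n X a ∈ gr n X (i + 1) := by
  induction ha using Submodule.span_induction with
  | zero => simp
  | add x y _ _ hx hy => rw [map_add]; exact add_mem hx hy
  | smul c x _ hx => rw [map_smul]; exact Submodule.smul_mem _ _ hx
  | mem a ha =>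
    obtain ⟨g, hg, rfl, rfl⟩ := ha
    rw [differential_cls hg]
    apply pickSum_mem
    intro x r hp
    refine contract_rec (n := n) (admissible_perm hp.symm hg) (Submodule.zero_mem _) ?_
    intro c v b hb _
    apply Submodule.smul_mem
    have := cls_mem_gr (n := n) (⟨g.numInt - 1, relabel (merge v b) r⟩ : LGraph X)
    convert this using 2
    have hl := hp.length_eq
    simp only [degree, ← hl, List.length_cons, List.length_map]
    have h0 : b < g.numInt := hb
    rw [Nat.cast_sub (show 1 ≤ g.numInt by omega)]
    push_cast
    ring

theorem neg_one_zpow_eq {z : ℤ} {m : ℕ} (t : ℤ) (h : z = m + 2 * t) :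
    (-1 : ℚ) ^ z = (-1) ^ m := by
  rw [h, zpow_add₀ (by norm_num), zpow_natCast, zpow_mul]
  norm_num

theorem differential_leibniz {i : ℤ} {a b : GraphAlg n X} (ha : a ∈ gr n X i) :
    differential n X (a * b) = differential n X a * b + (-1 : ℚ) ^ i • (a * differential n X b) := by
  induction ha using Submodule.span_induction with
  | zero => simp
  | add x y _ _ hx hy => rw [add_mul, map_add, hx, hy, map_add, add_mul, add_mul, smul_add]; abel
  | smul c x _ hx =>
    rw [smul_mul_assoc, map_smul, hx, map_smul, smul_add, smul_mul_assoc, smul_mul_assoc, smul_comm c]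
  | mem a ha =>
    obtain ⟨g, hg, rfl, rfl⟩ := ha
    induction b using cls_induction with
    | h0 => simp
    | hadd x y hx hy => rw [mul_add, map_add, hx, hy, map_add, mul_add, mul_add, smul_add]; abel
    | hcls h hh c =>
      rw [mul_smul_comm, map_smul, ← cls_mul hg hh, differential_cls (mul_mem hg hh),
        differential_cls hg, map_smul, differential_cls hh, dGraph_mul hg hh, smul_add,
        mul_smul_comm, mul_smul_comm, smul_comm c]
      congr 2
      rw [neg_one_zpow_eq (m := (n + 1) * g.edges.length + n * g.numInt)
        (-(g.edges.length + n * g.numInt)), sgnE, sgnV, ← pow_mul, ← pow_mul, ← pow_add]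
      simp only [degree]
      push_cast
      ring

/-! ### Graded commutativity -/

theorem cls_move (k : ℕ) (P B Q : List (Edge X)) (a : Edge X) :
    cls n X ⟨k, P ++ a :: (B ++ Q)⟩ = sgnE n ^ B.length • cls n X ⟨k, P ++ (B ++ a :: Q)⟩ := by
  induction B generalizing P with
  | nil => simp
  | cons b B ih =>
    have h1 := cls_step (n := n) (Step.swapEdges (n := n) k P (B ++ Q) a b)
    have h2 := ih (P ++ [b])
    simp only [List.append_assoc, List.cons_append, List.nil_append] at h2 ⊢
    rw [h1, h2, smul_smul, List.length_cons, pow_succ']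

theorem cls_append_comm (k : ℕ) (A B : List (Edge X)) :
    cls n X ⟨k, A ++ B⟩ = sgnE n ^ (A.length * B.length) • cls n X ⟨k, B ++ A⟩ := by
  have : ∀ (A B C : List (Edge X)), cls n X ⟨k, A ++ (B ++ C)⟩
      = sgnE n ^ (A.length * B.length) • cls n X ⟨k, B ++ (A ++ C)⟩ := by
    intro A
    induction A with
    | nil => simp
    | cons a A ih =>
      intro B C
      have h1 := cls_move (n := n) k [] A (B ++ C) a
      have h2 := ih B (a :: C)
      have h3 := cls_move (n := n) k B A C a
      have h4 := cls_move (n := n) k A B C a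
      simp only [List.nil_append] at h1
      -- move `a` to the right of `A`, exchange, and move back
      rw [List.cons_append, h1, h4, h2, List.cons_append, h3, List.length_cons, add_mul, one_mul, pow_add]
      simp only [smul_smul]
      congr 1
      ring
  simpa using this A B []

/-- Move the internal vertex `p` behind the following `m` internal vertices. -/
def cyc {X : Type} (p m : ℕ) : Vtx X → Vtx X
  | .inl x => .inl x
  | .inr j => .inr (if j = p then p + m else if p < j ∧ j ≤ p + m then j - 1 else j)

/-- Exchange the block of the first `k` internal vertices with the following block of `k'`. -/
def blk {X : Type} (k k' : ℕ) : Vtx X → Vtx X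
  | .inl x => .inl x
  | .inr j => .inr (if j < k then k' + j else if j < k + k' then j - k else j)

theorem cls_cyc (k p m : ℕ) (h : p + m < k) (l : List (Edge X)) :
    cls n X ⟨k, relabel (cyc p m) l⟩ = sgnV n ^ m • cls n X ⟨k, l⟩ := by
  induction m with
  | zero =>
    have : (cyc p 0 : Vtx X → Vtx X) = id := by
      funext v
      rcases v with v | v
      · rfl
      · simp only [cyc, id, Sum.inr.injEq]; split_ifs <;> omega
    simp [relabel, this]
  | succ m ih =>
    have h1 := cls_step (n := n) (Step.swapVertices (n := n) k (p + m) (by omega)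
      (relabel (cyc p m) l)).symm
    rw [ih (by omega), relabel_relabel] at h1
    have h2 : ∀ v : Vtx X, vswap (p + m) (cyc p m v) = cyc p (m + 1) v := by
      rintro (v | v)
      · rfl
      · simp only [vswap, cyc, Sum.inr.injEq]; split_ifs <;> omega
    simp only [h2] at h1
    rw [pow_succ', mul_smul]
    exact h1

theorem cls_blk (N k k' : ℕ) (h : k + k' ≤ N) (l : List (Edge X)) :
    cls n X ⟨N, relabel (blk k k') l⟩ = sgnV n ^ (k * k') • cls n X ⟨N, l⟩ := by
  induction k generalizing l with
  | zero =>
    have : (blk 0 k' : Vtx X → Vtx X) = id := by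
      funext v
      rcases v with v | v
      · rfl
      · simp only [blk, id, Sum.inr.injEq]; split_ifs <;> omega
    simp [relabel, this]
  | succ k ih =>
    have h1 := ih (by omega) (relabel (cyc k k') l)
    rw [cls_cyc _ _ _ (by omega), relabel_relabel] at h1
    have h2 : ∀ v : Vtx X, blk k k' (cyc k k' v) = blk (k + 1) k' v := by
      rintro (v | v)
      · rfl
      · simp only [blk, cyc, Sum.inr.injEq]; split_ifs <;> omega
    simp only [h2] at h1
    rw [h1, smul_smul, add_mul, one_mul, pow_add]

theorem cls_mul_comm {g h : LGraph X} (hg : g ∈ AdmGraph X) (hh : h ∈ AdmGraph X) :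
    cls n X g * cls n X h = (sgnE n ^ (g.edges.length * h.edges.length) *
      sgnV n ^ (g.numInt * h.numInt)) • (cls n X h * cls n X g) := by
  rw [← cls_mul hg hh, ← cls_mul hh hg, LGraph.mul_def, LGraph.mul_def, cls_append_comm,
    List.length_map, mul_smul]
  congr 1
  have h1 := cls_blk (n := n) (g.numInt + h.numInt) g.numInt h.numInt le_rfl
    (relabel (shift g.numInt) h.edges ++ g.edges)
  rw [relabel_append, relabel_relabel] at h1
  have h2 : ∀ v : Vtx X, InRange h.numInt v → blk g.numInt h.numInt (shift g.numInt v) = v := by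
    rintro (v | v) hv
    · rfl
    · simp only [InRange, shift, blk, Sum.inr.injEq] at hv ⊢; split_ifs <;> omega
  have h3 : ∀ v : Vtx X, InRange g.numInt v → blk g.numInt h.numInt v = shift h.numInt v := by
    rintro (v | v) hv
    · rfl
    · simp only [InRange, shift, blk, Sum.inr.injEq] at hv ⊢; split_ifs <;> omega
  rw [relabel_eq_self h2 (Admissible.wf hh), relabel_congr h3 (Admissible.wf hg)] at h1
  rw [add_comm h.numInt, h1, smul_smul, ← mul_pow, sgnV_mul, one_pow, one_smul]

theorem graded_comm {i j : ℤ} {a b : GraphAlg n X} (ha : a ∈ gr n X i) (hb : b ∈ gr n X j) :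
    a * b = (-1 : ℚ) ^ (i * j) • (b * a) := by
  induction ha using Submodule.span_induction with
  | zero => simp
  | add x y _ _ hx hy => rw [add_mul, hx, hy, mul_add, smul_add]
  | smul c x _ hx => rw [smul_mul_assoc, hx, mul_smul_comm, smul_comm]
  | mem a ha =>
    obtain ⟨g, hg, rfl, rfl⟩ := ha
    induction hb using Submodule.span_induction with
    | zero => simp
    | add x y _ _ hx hy => rw [mul_add, hx, hy, add_mul, smul_add]
    | smul c x _ hx => rw [mul_smul_comm, hx, smul_mul_assoc, smul_comm]
    | mem b hb =>
      obtain ⟨h, hh, rfl, rfl⟩ := hb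
      rw [cls_mul_comm hg hh]
      congr 1
      obtain ⟨u, hu⟩ := Int.even_mul_pred_self (n : ℤ)
      rw [neg_one_zpow_eq (m := (n + 1) * (g.edges.length * h.edges.length)
        + n * (g.numInt * h.numInt)) ((u - n) * (g.edges.length * h.edges.length)
          + u * (g.numInt * h.numInt) - u * (g.edges.length * h.numInt + g.numInt * h.edges.length)),
        sgnE, sgnV, ← pow_mul, ← pow_mul, ← pow_add]
      simp only [degree]
      push_cast
      linear_combination (g.edges.length * h.edges.length
          + g.numInt * h.numInt - (g.edges.length * h.numInt + g.numInt * h.edges.length) : ℤ) * hu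

end

/-- Differential graded commutative (unital, associative) algebras over `ℚ`, with a cohomological
`ℤ`-grading. -/
structure DGCAlg where
  carrier : Type
  [ring : Ring carrier]
  [algebra : Algebra ℚ carrier]
  gr : ℤ → Submodule ℚ carrier
  gradedMonoid : SetLike.GradedMonoid gr
  isInternal : DirectSum.IsInternal gr
  d : carrier →ₗ[ℚ] carrier
  d_mem : ∀ {i : ℤ} {a : carrier}, a ∈ gr i → d a ∈ gr (i + 1)
  d_d : ∀ a, d (d a) = 0
  leibniz : ∀ {i : ℤ} {a b : carrier}, a ∈ gr i →
    d (a * b) = d a * b + (-1 : ℚ) ^ i • (a * d b)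
  comm : ∀ {i j : ℤ} {a b : carrier}, a ∈ gr i → b ∈ gr j →
    a * b = (-1 : ℚ) ^ (i * j) • (b * a)

namespace DGCAlg

attribute [instance] DGCAlg.ring DGCAlg.algebra

instance : CoeSort DGCAlg Type := ⟨DGCAlg.carrier⟩

/-- Morphisms of dg commutative algebras. -/
@[ext]
structure Hom (A B : DGCAlg) where
  toAlgHom : A →ₐ[ℚ] B
  map_gr : ∀ (i : ℤ) (a : A), a ∈ A.gr i → toAlgHom a ∈ B.gr i
  map_d : ∀ a, toAlgHom (A.d a) = B.d (toAlgHom a)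

instance : Category DGCAlg where
  Hom := Hom
  id A := ⟨AlgHom.id ℚ A, fun _ _ h => h, fun _ => rfl⟩
  comp f g := ⟨g.toAlgHom.comp f.toAlgHom, fun i a h => g.map_gr i _ (f.map_gr i a h),
    fun a => by simp [f.map_d, g.map_d]⟩

theorem hom_ext {A B : DGCAlg} {f g : A ⟶ B} (h : ∀ a, f.toAlgHom a = g.toAlgHom a) : f = g :=
  Hom.ext (AlgHom.ext h)

/-- The cocycles of degree `i`. -/
def cocycles (A : DGCAlg) (i : ℤ) : Submodule ℚ A := A.gr i ⊓ LinearMap.ker A.d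

/-- The coboundaries of degree `i`. -/
def coboundaries (A : DGCAlg) (i : ℤ) : Submodule ℚ A := (A.gr (i - 1)).map A.d

/-- The cohomology in degree `i`. -/
abbrev Cohomology (A : DGCAlg) (i : ℤ) : Type :=
  A.cocycles i ⧸ (A.coboundaries i).submoduleOf (A.cocycles i)

/-- The map induced on cocycles. -/
def cocyclesMap {A B : DGCAlg} (f : A ⟶ B) (i : ℤ) : A.cocycles i →ₗ[ℚ] B.cocycles i :=
  f.toAlgHom.toLinearMap.restrict fun a ha => ⟨f.map_gr i a ha.1, by
    have h : A.d a = 0 := ha.2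
    change B.d (f.toAlgHom a) = 0
    rw [← f.map_d, h, map_zero]⟩

/-- The map induced on cohomology. -/
def cohomologyMap {A B : DGCAlg} (f : A ⟶ B) (i : ℤ) : A.Cohomology i →ₗ[ℚ] B.Cohomology i :=
  Submodule.mapQ _ _ (cocyclesMap f i) (by
    rintro ⟨a, ha⟩ ⟨b, hb, h⟩
    exact ⟨f.toAlgHom b, f.map_gr _ _ hb, by rw [← f.map_d, h]; rfl⟩)

/-- The fibrations are the morphisms that are surjective in all degrees. -/
instance : CategoryWithFibrations DGCAlg where
  fibrations A B f := ∀ i, ∀ b ∈ B.gr i, ∃ a ∈ A.gr i, f.toAlgHom a = b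

/-- The weak equivalences are the quasi-isomorphisms. -/
instance : CategoryWithWeakEquivalences DGCAlg where
  weakEquivalences _ _ f := ∀ i, Function.Bijective (cohomologyMap f i)

/-- The base field, in degree zero. -/
def baseField : DGCAlg where
  carrier := ℚ
  gr i := if i = 0 then ⊤ else ⊥
  gradedMonoid :=
    { one_mem := by simp
      mul_mem := by
        intro i j a b ha hb
        split_ifs at * with h1 h2 h3 <;> simp_all }
  isInternal := by
    rw [DirectSum.isInternal_submodule_iff_iSupIndep_and_iSup_eq_top]
    constructor
    · intro i
      by_cases hi : i = 0
      · have : (⨆ (j : ℤ) (_ : j ≠ i), (if j = 0 then ⊤ else ⊥ : Submodule ℚ ℚ)) = ⊥ := by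
          simp only [iSup_eq_bot]
          intro j hj
          rw [if_neg (by rw [← hi]; exact hj)]
        rw [this]; exact disjoint_bot_right
      · simp only [if_neg hi]; exact disjoint_bot_left
    · refine top_unique ((le_of_eq ?_).trans (le_iSup _ 0))
      simp
  d := 0
  d_mem := by simp
  d_d := by simp
  leibniz := by simp
  comm := by
    intro i j a b ha hb
    by_cases hi : i = 0
    · simp [hi, mul_comm]
    · rw [if_neg hi] at ha
      have : a = 0 := by simpa using ha
      simp [this]

theorem one_mem_gr (A : DGCAlg) : (1 : A) ∈ A.gr 0 :=
  A.gradedMonoid.one_mem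

theorem d_one (A : DGCAlg) : A.d 1 = 0 := by
  have := A.leibniz (b := 1) A.one_mem_gr
  simpa using this

theorem algebraMap_mem_gr (A : DGCAlg) (q : ℚ) : algebraMap ℚ A q ∈ A.gr 0 := by
  rw [Algebra.algebraMap_eq_smul_one]
  exact Submodule.smul_mem _ _ A.one_mem_gr

theorem d_algebraMap (A : DGCAlg) (q : ℚ) : A.d (algebraMap ℚ A q) = 0 := by
  rw [Algebra.algebraMap_eq_smul_one, map_smul, d_one, smul_zero]

/-- The unique morphism from the base field. -/
def fromBaseField (A : DGCAlg) : baseField ⟶ A where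
  toAlgHom := Algebra.ofId ℚ A
  map_gr i a ha := by
    by_cases hi : i = 0
    · subst hi
      exact A.algebraMap_mem_gr a
    · have h0 : ∀ q : ℚ, q ∈ (if i = 0 then ⊤ else ⊥ : Submodule ℚ ℚ) →
          algebraMap ℚ A q ∈ A.gr i := by
        intro q hq
        rw [if_neg hi] at hq
        rw [(Submodule.mem_bot ℚ).1 hq, map_zero]
        exact Submodule.zero_mem _
      exact h0 a ha
  map_d a := (map_zero (Algebra.ofId ℚ A)).trans (A.d_algebraMap a).symm

theorem fromBaseField_unique {A : DGCAlg} (f : baseField ⟶ A) : f = fromBaseField A :=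
  Hom.ext (AlgHom.ext fun q => (f.toAlgHom.commutes q).trans
    ((fromBaseField A).toAlgHom.commutes q).symm)

instance : HasInitial DGCAlg :=
  (IsInitial.ofUniqueHom (X := baseField) fromBaseField fun _ f => fromBaseField_unique f).hasInitial

end DGCAlg

/-- The category of non-negatively graded dg commutative algebras. Its weak equivalences are the
quasi-isomorphisms (through the instance for full subcategories). -/
abbrev DgCom : Type 1 :=
  ObjectProperty.FullSubcategory fun A : DGCAlg => ∀ i < 0, A.gr i = ⊥

/-- The fibrations are the morphisms that are surjective in all degrees. -/
instance : CategoryWithFibrations DgCom where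
  fibrations := (fibrations DGCAlg).inverseImage (ObjectProperty.ι _)

instance : HasInitial DgCom := by
  have h : ∀ i < 0, DGCAlg.baseField.gr i = ⊥ := fun i hi => if_neg hi.ne
  exact (IsInitial.ofUniqueHom (X := (⟨DGCAlg.baseField, h⟩ : DgCom))
    (fun A => ObjectProperty.homMk A.obj.fromBaseField)
    fun A f => ObjectProperty.hom_ext _ (DGCAlg.fromBaseField_unique f.hom)).hasInitial

/-- The category of finite pointed sets. -/
abbrev Gamma : Type 1 := ObjectProperty.FullSubcategory fun X : Pointed.{0} => Finite X

/-! ### The projective model structure on diagrams indexed by finite pointed sets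

Fibrations and weak equivalences are objectwise; the cofibrations are the morphisms that have the left
lifting property with respect to the fibrations that are weak equivalences. -/

section Projective

variable (C : Type*) [Category C]

instance [CategoryWithFibrations C] : CategoryWithFibrations (Gamma ⥤ C) where
  fibrations _ _ φ := ∀ S, fibrations C (φ.app S)

instance [CategoryWithWeakEquivalences C] : CategoryWithWeakEquivalences (Gamma ⥤ C) where
  weakEquivalences _ _ φ := ∀ S, weakEquivalences C (φ.app S)

instance [CategoryWithFibrations C] [CategoryWithWeakEquivalences C] :
    CategoryWithCofibrations (Gamma ⥤ C) where
  cofibrations := (trivialFibrations (Gamma ⥤ C)).llp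

end Projective

noncomputable section

variable {n : ℕ} {X Y Z : Pointed.{0}}

/-- The dg commutative algebra of graphs with external vertices the elements of `X` other than the
base point. -/
def graphsObj (n : ℕ) (X : Pointed.{0}) : DGCAlg where
  carrier := GraphAlg n X
  gr := gr n X
  gradedMonoid := gr_gradedMonoid
  isInternal := gr_isInternal
  d := differential n X
  d_mem := differential_mem
  d_d := differential_differential
  leibniz := differential_leibniz
  comm := graded_comm

/-- Apply `f` to the external vertices. -/
def extMap {X Y : Type} (f : X → Y) : Vtx X → Vtx Y
  | .inl x => .inl (f x)
  | .inr j => .inr j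

/-- Relabel the external vertices of a graph according to `f`; external vertices with the same image are
merged. -/
def pushGraph {X Y : Type} (f : X → Y) (g : LGraph X) : LGraph Y :=
  ⟨g.numInt, relabel (extMap f) g.edges⟩

/-- No edge is incident to an external vertex that `f` sends to the base point. -/
def NoBase (pt : Y.X) (f : X.X → Y.X) (l : List (Edge X)) : Prop :=
  ∀ e ∈ l, extMap f e.1 ≠ .inl pt ∧ extMap f e.2 ≠ .inl pt

theorem extMap_inRange {X Y : Type} (f : X → Y) {k : ℕ} (v : Vtx X) (hv : InRange k v) :
    InRange k (extMap f v) := by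
  rcases v with v | v
  · trivial
  · exact hv

theorem pushGraph_mem_iff (f : X.X → Y.X) {g : LGraph X} (hg : g ∈ AdmGraph X) :
    pushGraph f g ∈ AdmGraph Y ↔ NoBase (X := X) Y.point f g.edges := by
  constructor
  · intro h e he
    exact h.base _ (List.mem_map.2 ⟨e, he, rfl⟩)
  · intro h
    refine ⟨wf_relabel (extMap_inRange f) (Admissible.wf hg), ?_, ?_, ?_⟩
    · intro e he
      obtain ⟨e, he', rfl⟩ := List.mem_map.1 he
      exact h e he'
    · intro i hi
      change 3 ≤ valence i (relabel (extMap f) g.edges)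
      rw [valence_relabel (k := g.numInt) (j := i) _ (Admissible.wf hg)]
      · exact hg.trivalent i hi
      · rintro (v | v) _ <;> rfl
    · intro i hi
      obtain ⟨x, hx⟩ := hg.connected i hi
      exact ⟨f x, joined_relabel (f := extMap f) hx⟩

theorem vswap_extMap {X Y : Type} (f : X → Y) (i : ℕ) (v : Vtx X) :
    extMap f (vswap i v) = vswap i (extMap f v) := by
  rcases v with v | v <;> rfl

theorem shift_extMap {X Y : Type} (f : X → Y) (i : ℕ) (v : Vtx X) :
    extMap f (shift i v) = shift i (extMap f v) := by
  rcases v with v | v <;> rfl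

theorem merge_extMap {X Y : Type} (f : X → Y) (u : Vtx X) (b : ℕ) (v : Vtx X) :
    extMap f (merge u b v) = merge (extMap f u) b (extMap f v) := by
  rcases v with v | v
  · rfl
  · simp only [merge, extMap]
    split_ifs
    · rcases u with u | u <;> rfl
    · rfl

theorem Step.push {X Y : Type} (f : X → Y) {g g' : LGraph X} {c : ℚ} (h : Step n g c g') :
    Step n (pushGraph f g) c (pushGraph f g') := by
  cases h with
  | swapEdges k A B e f' =>
    simp only [pushGraph, relabel, List.map_append, List.map_cons]
    exact .swapEdges _ _ _ _ _
  | flipEdge k A B v w =>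
    simp only [pushGraph, relabel, List.map_append, List.map_cons, Prod.map]
    exact .flipEdge _ _ _ _ _
  | swapVertices k i hi l =>
    simp only [pushGraph]
    rw [relabel_relabel]
    simp only [vswap_extMap]
    rw [← relabel_relabel (vswap i) (extMap f)]
    exact .swapVertices _ _ hi _

/-- The map of graph algebras induced by a pointed map `f`. It sends the class of a graph to the class
of the relabelled graph. The latter graph is admissible unless some edge is incident to an external
vertex that `f` sends to the base point (see `pushGraph_mem_iff`), and then the image is zero. -/
def pushLin (n : ℕ) (f : X ⟶ Y) : GraphAlg n X →ₗ[ℚ] GraphAlg n Y :=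
  liftLin (fun g => cls n Y (pushGraph f.toFun g)) fun _ _ _ _ h => cls_step (h.push _)

theorem pushLin_cls (f : X ⟶ Y) {g : LGraph X} (hg : g ∈ AdmGraph X) :
    pushLin n f (cls n X g) = cls n Y (pushGraph f.toFun g) := liftLin_cls _ _ hg

theorem pushGraph_mul {X Y : Type} (f : X → Y) (g h : LGraph X) :
    pushGraph f (g * h) = pushGraph f g * pushGraph f h := by
  simp only [pushGraph, LGraph.mul_def]
  rw [relabel_append, relabel_relabel, relabel_relabel]
  simp only [shift_extMap]

theorem cls_pushGraph_mul (f : X.X → Y.X) {g h : LGraph X} (hg : g ∈ AdmGraph X)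
    (hh : h ∈ AdmGraph X) :
    cls n Y (pushGraph f (g * h)) = cls n Y (pushGraph f g) * cls n Y (pushGraph f h) := by
  have hiff : NoBase (X := X) Y.point f (g * h).edges ↔
      NoBase (X := X) Y.point f g.edges ∧ NoBase (X := X) Y.point f h.edges := by
    have hs : ∀ v : Vtx X.X, extMap f (shift g.numInt v) ≠ .inl Y.point ↔
        extMap f v ≠ .inl Y.point := by
      rintro (v | v)
      · rfl
      · simp [extMap, shift]
    simp only [NoBase, LGraph.mul_def, List.mem_append, List.mem_map]
    constructor
    · intro H
      refine ⟨fun e he => H e (.inl he), fun e he => ?_⟩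
      have := H _ (.inr ⟨e, he, rfl⟩)
      exact ⟨(hs _).1 this.1, (hs _).1 this.2⟩
    · rintro ⟨H1, H2⟩ e (he | ⟨e, he, rfl⟩)
      · exact H1 e he
      · exact ⟨(hs _).2 (H2 e he).1, (hs _).2 (H2 e he).2⟩
  by_cases h1 : pushGraph f g ∈ AdmGraph Y
  · by_cases h2 : pushGraph f h ∈ AdmGraph Y
    · rw [pushGraph_mul, cls_mul h1 h2]
    · rw [cls_of_notMem h2, mul_zero, cls_of_notMem]
      rw [pushGraph_mem_iff f (mul_mem hg hh), hiff]
      exact fun H => h2 ((pushGraph_mem_iff f hh).2 H.2)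
  · rw [cls_of_notMem h1, zero_mul, cls_of_notMem]
    rw [pushGraph_mem_iff f (mul_mem hg hh), hiff]
    exact fun H => h1 ((pushGraph_mem_iff f hg).2 H.1)

theorem pushLin_mul (f : X ⟶ Y) (a b : GraphAlg n X) :
    pushLin n f (a * b) = pushLin n f a * pushLin n f b := by
  induction a using cls_induction with
  | h0 => simp
  | hadd x y hx hy => rw [add_mul, map_add, hx, hy, map_add, add_mul]
  | hcls g hg c =>
    induction b using cls_induction with
    | h0 => simp
    | hadd x y hx hy => rw [mul_add, map_add, hx, hy, map_add, mul_add]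
    | hcls h hh c' =>
      rw [smul_mul_assoc, mul_smul_comm, ← cls_mul hg hh]
      simp only [map_smul]
      rw [pushLin_cls f (mul_mem hg hh), pushLin_cls f hg, pushLin_cls f hh,
        cls_pushGraph_mul _ hg hh, smul_mul_assoc, mul_smul_comm]

theorem pushLin_one (f : X ⟶ Y) : pushLin n f 1 = 1 := by
  rw [← cls_one, pushLin_cls f (one_mem _), ← cls_one]
  rfl

theorem pushLin_contract (f : X ⟶ Y) {k : ℕ} {e : Edge X} {r : List (Edge X)}
    (h : (⟨k, e :: r⟩ : LGraph X) ∈ AdmGraph X) :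
    pushLin n f (contract (sgnV n) (fun k l => cls n X ⟨k, l⟩) k e r)
      = contract (sgnV n) (fun k l => cls n Y ⟨k, l⟩) k
          (Prod.map (extMap f.toFun) (extMap f.toFun) e) (relabel (extMap f.toFun) r) := by
  have key : ∀ (v : Vtx X) (b : ℕ), (⟨k - 1, relabel (merge v b) r⟩ : LGraph X) ∈ AdmGraph X →
      pushLin n f (cls n X ⟨k - 1, relabel (merge v b) r⟩)
        = cls n Y ⟨k - 1, relabel (merge (extMap f.toFun v) b) (relabel (extMap f.toFun) r)⟩ := by
    intro v b hm
    rw [pushLin_cls f hm, pushGraph]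
    rw [relabel_relabel, relabel_relabel]
    simp only [merge_extMap]
  obtain ⟨v | a, w | b⟩ := e
  · simp [contract, extMap]
  · simp only [contract, map_smul, Prod.map, extMap]
    rw [key _ _ (admissible_merge (by simp) h)]; rfl
  · simp only [contract, map_smul, Prod.map, extMap]
    rw [key _ _ (admissible_merge (by simp) (admissible_flip h))]; rfl
  · by_cases hab : a = b
    · simp [contract, hab, extMap]
    · simp only [contract, map_smul, Prod.map, extMap, hab, if_false]
      rw [key _ _ (admissible_merge (by simpa using hab) h)]; rfl

theorem noBase_merge {f : X ⟶ Y} {k b : ℕ} {v : Vtx X} {r : List (Edge X)} (hv : v ≠ .inr b)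
    (h : Admissible X.point k ((v, .inr b) :: r))
    (hn : NoBase (X := X) Y.point f.toFun (relabel (merge v b) r)) :
    NoBase (X := X) Y.point f.toFun ((v, .inr b) :: r) := by
  have hm : ∀ w : Vtx X, extMap f.toFun (merge v b w) ≠ .inl Y.point →
      extMap f.toFun w ≠ .inl Y.point := by
    rintro (w | w) hw
    · exact hw
    · simp [extMap]
  have hr : NoBase (X := X) Y.point f.toFun r := by
    intro e he
    have := hn _ (List.mem_map.2 ⟨e, he, rfl⟩)
    exact ⟨hm _ this.1, hm _ this.2⟩
  intro e he
  rcases List.mem_cons.1 he with rfl | he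
  · refine ⟨?_, by simp [extMap]⟩
    rcases v with x | a
    · -- the vertex `b` lies on some other edge, which after the contraction is incident to `x`
      intro hx
      have h3 := h.trivalent b (h.inRange _ List.mem_cons_self).2
      rw [valence_cons] at h3
      have h4 : valence b r = 0 := by
        apply List.sum_eq_zero
        intro m hm'
        obtain ⟨e, he, rfl⟩ := List.mem_map.1 hm'
        have h5 := hn _ (List.mem_map.2 ⟨e, he, rfl⟩)
        have h6 : ∀ w : Vtx X, extMap f.toFun (merge (.inl x) b w) ≠ .inl Y.point →
            hit b w = 0 := by
          rintro (w | w) hw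
          · rfl
          · simp only [hit]
            split_ifs with hwb
            · subst hwb
              exact absurd hx (by simpa [merge, drop] using hw)
            · rfl
        rw [h6 _ h5.1, h6 _ h5.2, add_zero]
      have h7 : hit b (.inl x : Vtx X) = 0 := rfl
      have h8 : hit b (.inr b : Vtx X) = 1 := by simp [hit]
      simp only [h4, h7, h8] at h3
      omega
    · simp [extMap]
  · exact hr e he

theorem pushLin_differential (f : X ⟶ Y) (a : GraphAlg n X) :
    pushLin n f (differential n X a) = differential n Y (pushLin n f a) := by
  induction a using cls_induction with
  | h0 => simp
  | hadd x y hx hy => simp only [map_add, hx, hy]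
  | hcls g hg c =>
    simp only [map_smul]
    congr 1
    rw [differential_cls hg, pushLin_cls f hg, dGraph, map_pickSum]
    by_cases hp : pushGraph f.toFun g ∈ AdmGraph Y
    · rw [differential_cls hp, dGraph]
      simp only [pushGraph]
      rw [pickSum_map]
      apply pickSum_congr'
      intro x r hperm
      exact pushLin_contract f (admissible_perm hperm.symm hg)
    · rw [cls_of_notMem hp, map_zero]
      apply pickSum_zero
      intro x r hperm
      have hg' : Admissible X.point g.numInt (x :: r) := admissible_perm hperm.symm hg
      have hno : ¬ NoBase (X := X) Y.point f.toFun (x :: r) := by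
        rw [pushGraph_mem_iff _ hg] at hp
        exact fun H => hp fun e he => H e (hperm.mem_iff.2 he)
      have key : ∀ (v : Vtx X) (b : ℕ), v ≠ .inr b →
          Admissible X.point g.numInt ((v, .inr b) :: r) →
          ¬ NoBase (X := X) Y.point f.toFun ((v, .inr b) :: r) →
          pushLin n f (cls n X ⟨g.numInt - 1, relabel (merge v b) r⟩) = 0 := by
        intro v b hv hadm hn
        have hm := admissible_merge hv hadm
        rw [pushLin_cls f (g := ⟨_, _⟩) hm, cls_of_notMem]
        rw [pushGraph_mem_iff _ (g := ⟨_, _⟩) hm]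
        exact fun H => hn (noBase_merge hv hadm H)
      obtain ⟨v | a, w | b⟩ := x
      · simp [contract]
      · simp only [contract, map_smul]
        rw [key _ _ (by simp) hg' hno, smul_zero]
      · simp only [contract, map_smul]
        rw [key _ _ (by simp) (admissible_flip hg'), smul_zero]
        intro H
        apply hno
        intro e he
        rcases List.mem_cons.1 he with rfl | he
        · exact (H _ List.mem_cons_self).symm
        · exact H e (List.mem_cons_of_mem _ he)
      · by_cases hab : a = b
        · simp [contract, hab]
        · simp only [contract, hab, if_false, map_smul]
          rw [key _ _ (by simpa using hab) hg' hno, smul_zero]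

theorem pushLin_mem (f : X ⟶ Y) {i : ℤ} {a : GraphAlg n X} (ha : a ∈ gr n X i) :
    pushLin n f a ∈ gr n Y i := by
  induction ha using Submodule.span_induction with
  | zero => simp
  | add x y _ _ hx hy => rw [map_add]; exact add_mem hx hy
  | smul c x _ hx => rw [map_smul]; exact Submodule.smul_mem _ _ hx
  | mem a ha =>
    obtain ⟨g, hg, rfl, rfl⟩ := ha
    rw [pushLin_cls f hg]
    have := cls_mem_gr (n := n) (pushGraph f.toFun g)
    have hd : degree n (pushGraph f.toFun g) = degree n g := by simp [degree, pushGraph]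
    rwa [hd] at this

/-- The morphism of dg commutative algebras induced by a pointed map. -/
def graphsMap (n : ℕ) (f : X ⟶ Y) : graphsObj n X ⟶ graphsObj n Y where
  toAlgHom := AlgHom.ofLinearMap (pushLin n f) (pushLin_one f) (pushLin_mul f)
  map_gr _ _ h := pushLin_mem f h
  map_d a := pushLin_differential f a

/-- The left Hopf `Γ`-module of graphs, in the category of `ℤ`-graded dg commutative algebras. -/
def graphs (n : ℕ) : Gamma ⥤ DGCAlg where
  obj S := graphsObj n S.obj
  map f := graphsMap n f.hom
  map_id S := by
    apply DGCAlg.hom_ext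
    intro a
    change pushLin n (𝟙 S.obj) a = a
    induction a using cls_induction with
    | h0 => simp
    | hadd x y hx hy => rw [map_add, hx, hy]
    | hcls g hg c =>
      rw [map_smul, pushLin_cls _ hg]
      congr 2
      refine LGraph.ext rfl ?_
      have : (extMap (Pointed.Hom.toFun (𝟙 S.obj)) : Vtx S.obj → Vtx S.obj) = id := by
        funext v; rcases v with v | v <;> rfl
      change relabel (extMap (Pointed.Hom.toFun (𝟙 S.obj))) g.edges = g.edges
      rw [this]
      simp [relabel]
  map_comp {S T U} f f' := by
    apply DGCAlg.hom_ext
    intro a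
    change pushLin n (f.hom ≫ f'.hom) a = pushLin n f'.hom (pushLin n f.hom a)
    induction a using cls_induction with
    | h0 => simp
    | hadd x y hx hy => simp only [map_add, hx, hy]
    | hcls g hg c =>
      simp only [map_smul]
      congr 1
      rw [pushLin_cls _ hg, pushLin_cls _ hg]
      have hc : pushGraph (Pointed.Hom.toFun (f.hom ≫ f'.hom)) g
          = pushGraph f'.hom.toFun (pushGraph f.hom.toFun g) := by
        refine LGraph.ext rfl ?_
        simp only [pushGraph]
        rw [relabel_relabel]
        congr 2
        funext v; rcases v with v | v <;> rfl
      rw [hc]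
      by_cases hp : pushGraph f.hom.toFun g ∈ AdmGraph T.obj
      · rw [pushLin_cls _ hp]
      · rw [cls_of_notMem hp, map_zero, cls_of_notMem]
        rw [← hc, pushGraph_mem_iff _ hg]
        intro H
        apply hp
        rw [pushGraph_mem_iff _ hg]
        have hpt : f'.hom.toFun T.obj.point = U.obj.point := f'.hom.map_point
        have hv : ∀ v : Vtx S.obj, extMap (Pointed.Hom.toFun (f.hom ≫ f'.hom)) v ≠ .inl U.obj.point →
            extMap f.hom.toFun v ≠ .inl T.obj.point := by
          rintro (v | v) hv h
          · apply hv
            simp only [extMap, Sum.inl.injEq] at h ⊢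
            change f'.hom.toFun (f.hom.toFun v) = _
            rw [h, hpt]
          · simp [extMap] at h
        exact fun e he => ⟨hv _ (H e he).1, hv _ (H e he).2⟩

theorem sum_hit_le {X : Type} (k : ℕ) (v : Vtx X) : ∑ i ∈ Finset.range k, hit i v ≤ 1 := by
  rcases v with v | v
  · simp [hit]
  · simp only [hit, Finset.sum_ite_eq]
    split_ifs <;> simp

theorem sum_valence_le {X : Type} (k : ℕ) (l : List (Edge X)) :
    ∑ i ∈ Finset.range k, valence i l ≤ 2 * l.length := by
  induction l with
  | nil => simp [valence]
  | cons e l ih =>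
    simp only [valence_cons, Finset.sum_add_distrib, List.length_cons]
    have h1 := sum_hit_le k e.1
    have h2 := sum_hit_le k e.2
    omega

theorem degree_nonneg (hn : 3 ≤ n) {g : LGraph X} (hg : g ∈ AdmGraph X) : 0 ≤ degree n g := by
  have h1 : g.numInt * 3 ≤ ∑ i ∈ Finset.range g.numInt, valence i g.edges := by
    have := Finset.card_nsmul_le_sum (Finset.range g.numInt) (fun i => valence i g.edges) 3
      (fun i hi => hg.trivalent i (Finset.mem_range.1 hi))
    simpa using this
  have h2 := h1.trans (sum_valence_le _ _)
  simp only [degree]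
  zify at h2 hn
  nlinarith

theorem gr_eq_bot (hn : 3 ≤ n) {i : ℤ} (hi : i < 0) : gr n X i = ⊥ := by
  rw [gr, Submodule.span_eq_bot]
  rintro a ⟨g, hg, hd, rfl⟩
  have := degree_nonneg hn hg
  omega

/-- The left Hopf `Γ`-module of graphs, in the category of non-negatively graded dg commutative algebras.
The graphs have non-negative degree for `n ≥ 3`. -/
def graphsNonneg (n : ℕ) (hn : 3 ≤ n) : Gamma ⥤ DgCom :=
  ObjectProperty.lift _ (graphs n) fun _ _ hi => gr_eq_bot hn hi

end

end GraphComplex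

/-! Call a graph internally connected if it is a single edge between external vertices, or if it
stays connected after its external vertices are cut apart. Gluing along external vertices presents
every graph, uniquely up to order and sign, as a product of internally connected ones. So `Graphs_n`
is free as a graded commutative algebra on a `Γ`-diagram of graded vector spaces. The differential
lowers the number of internal vertices, so the algebra is built by attaching generators in the order
of that number. In characteristic zero the diagram of generators is projective, and hence the
attachments are cofibrations.

Projectivity comes from cutting. Separating all half-edges at the external vertices gives an
exploded graph with one external vertex per such half-edge, and the original graph is its image
under the incidence map. A natural map is therefore determined by values on exploded graphs, which
can be chosen freely up to two constraints. It must vanish as soon as a half-edge goes to the base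
point, which is enforced by the commuting projections `1 - A.map (killHom h)` (`exists_reduced`). It
must respect orientations, which is enforced by a signed average over all orderings and directions
(`symmetrize`). The outcome is `exists_linFamily`: a natural linear relation that is total on graphs
contains a natural linear map.

Freeness is used without choosing generators. A linear map `c` on all graphs has a multiplicative
extension `extLin`, which multiplies the values of `c` on the internally connected components.
Independence of the numbering (`multExt_swapEdges`, `multExt_swapVertices` and their companions) is
a comparison of unshuffle signs with Koszul signs. Algebra maps and derivations are then compared on
components only (`map_extLin`, `d_extLin`).

To lift `φ` along a trivial fibration `p`, suppose that a natural family `F` is compatible with `p`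
and the differentials below `k` internal vertices. For a graph `x` with `k` internal vertices the
new value `a` must satisfy `p a = φ x` and `d a = extLin F (d x)`, where the right side is already
known. Such an `a` exists because `p` is a surjective quasi-isomorphism (`DGCAlg.exists_lift`), and
`exists_linFamily` makes the choice natural and linear (`exists_extend`). The stages stabilize on
every graph, and the extension of the limit is the desired lift (`graphs_exists_lift`). The
non-negatively graded case follows because those algebras form a full subcategory with the same
trivial fibrations. -/

namespace GraphComplex

open CategoryTheory Limits HomotopicalAlgebra

/-! ### Signs of unshuffles -/

section Unshuffle

variable {α β : Type*}

/-- The sign of moving the elements of `l` that satisfy `p` to the front, where a transposition has the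
sign `s`. -/
def unsh (s : ℚ) (p : α → Bool) : List α → ℚ
  | [] => 1
  | a :: l => (if p a then 1 else s ^ (l.filter p).length) * unsh s p l

/-- Besides the unshuffles of the two pieces, every chosen element of `B` has to pass every unchosen
element of `A`. -/
theorem unsh_append (s : ℚ) (p : α → Bool) (A B : List α) :
    unsh s p (A ++ B)
      = s ^ ((A.filter fun x => !p x).length * (B.filter p).length) * unsh s p A * unsh s p B := by
  induction A with
  | nil => simp [unsh]
  | cons a A ih =>
    by_cases h : p a
    · simp [unsh, ih, h]
    · simp only [List.cons_append, unsh, ih, h, List.filter_append, List.length_append]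
      simp [h]
      ring

theorem unsh_map (s : ℚ) (p : β → Bool) (f : α → β) (l : List α) :
    unsh s p (l.map f) = unsh s (fun x => p (f x)) l := by
  induction l with
  | nil => rfl
  | cons a l ih => simp [unsh, ih, List.filter_map, Function.comp_def]

theorem unsh_congr (s : ℚ) {p q : α → Bool} {l : List α} (h : ∀ x ∈ l, p x = q x) :
    unsh s p l = unsh s q l := by
  induction l with
  | nil => rfl
  | cons a l ih =>
    have h' : ∀ x ∈ l, p x = q x := fun x hx => h x (List.mem_cons_of_mem _ hx)
    rw [unsh, unsh, ih h', h a List.mem_cons_self, List.filter_congr h']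

theorem unsh_of_forall (s : ℚ) {p : α → Bool} {l : List α} (h : ∀ x ∈ l, p x = true) :
    unsh s p l = 1 := by
  rw [unsh_congr s h]
  induction l with
  | nil => rfl
  | cons a l ih => simp [unsh, ih fun x hx => h x (List.mem_cons_of_mem _ hx)]

theorem unsh_of_forall_not (s : ℚ) {p : α → Bool} {l : List α} (h : ∀ x ∈ l, p x = false) :
    unsh s p l = 1 := by
  rw [unsh_congr s h]
  induction l with
  | nil => rfl
  | cons a l ih => simp [unsh, ih fun x hx => h x (List.mem_cons_of_mem _ hx)]

theorem unsh_swap_of_eq (s : ℚ) {p : α → Bool} (A B : List α) {a b : α} (h : p a = p b) :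
    unsh s p (A ++ a :: b :: B) = unsh s p (A ++ b :: a :: B) := by
  rw [unsh_append, unsh_append]
  cases hb : p b <;> simp [unsh, h, hb]

theorem unsh_swap_of_ne {s : ℚ} (hs : s * s = 1) {p : α → Bool} (A B : List α) {a b : α}
    (h : p a ≠ p b) : unsh s p (A ++ a :: b :: B) = s * unsh s p (A ++ b :: a :: B) := by
  rw [unsh_append, unsh_append]
  cases hb : p b
  · have ha : p a = true := by simpa [hb] using h
    simp only [unsh, ha, hb, List.filter_cons, if_true, if_false, Bool.false_eq_true,
      List.length_cons, pow_succ]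
    linear_combination (-(s ^ ((A.filter fun x => !p x).length * ((B.filter p).length + 1))
      * unsh s p A * s ^ (B.filter p).length * unsh s p B)) * hs
  · have ha : p a = false := by simpa [hb] using h
    simp only [unsh, ha, hb, List.filter_cons, if_true, if_false, Bool.false_eq_true,
      List.length_cons, pow_succ]
    ring

theorem pow_even_of_sq {s : ℚ} (hs : s * s = 1) (a : ℕ) : s ^ a * s ^ a = 1 := by
  rw [← mul_pow, hs, one_pow]

/-- For disjoint `p` and `q`, the left side is the sign of sorting `l` into the blocks `p`, `q`,
rest; the parenthesis on the right sorts into `q`, `p`, rest, and the power of `s` exchanges the two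
blocks. It lets two components be split off in either order. -/
theorem unsh_comm {s : ℚ} (hs : s * s = 1) {p q : α → Bool} (l : List α)
    (h : ∀ x ∈ l, p x = true → q x = false) :
    unsh s p l * unsh s q (l.filter fun x => !p x)
      = s ^ ((l.filter p).length * (l.filter q).length)
        * (unsh s q l * unsh s p (l.filter fun x => !q x)) := by
  induction l with
  | nil => simp [unsh]
  | cons a l ih =>
    have h' : ∀ x ∈ l, p x = true → q x = false := fun x hx => h x (List.mem_cons_of_mem _ hx)
    have ih := ih h'
    have e1 : (l.filter fun x => !p x).filter q = l.filter q := by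
      rw [List.filter_filter]
      apply List.filter_congr
      intro x hx
      have := h' x hx
      revert this
      cases p x <;> cases q x <;> simp
    have e2 : (l.filter fun x => !q x).filter p = l.filter p := by
      rw [List.filter_filter]
      apply List.filter_congr
      intro x hx
      have := h' x hx
      revert this
      cases p x <;> cases q x <;> simp
    have hq := pow_even_of_sq hs (l.filter q).length
    by_cases hp : p a = true
    · have hqa := h a List.mem_cons_self hp
      simp only [unsh, List.filter_cons, hp, hqa, Bool.not_true, Bool.not_false, if_true, if_false,
        Bool.false_eq_true, List.length_cons, e2, add_mul, one_mul, pow_add]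
      -- The element `a` lengthens the `p`-block by one and is itself passed by the `q`-block, so
      -- the same power of `s` occurs twice and cancels.
      linear_combination ih - s ^ ((l.filter p).length * (l.filter q).length)
        * (unsh s q l * unsh s p (l.filter fun x => !q x)) * hq
    · replace hp : p a = false := by simpa using hp
      by_cases hqa : q a = true
      · simp only [unsh, List.filter_cons, hp, hqa, Bool.not_true, Bool.not_false, if_true, if_false,
          Bool.false_eq_true, List.length_cons, e1, mul_add, mul_one, pow_add]
        linear_combination s ^ (l.filter p).length * ih
      · replace hqa : q a = false := by simpa using hqa
        simp only [unsh, List.filter_cons, hp, hqa, Bool.not_false, if_true, if_false,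
          Bool.false_eq_true, e1, e2]
        linear_combination s ^ (l.filter p).length * s ^ (l.filter q).length * ih

variable {M : Type*} [AddCommGroup M] [Module ℚ M]

/-- The swap rule is required only on rearrangements of the given list, because for lists of
internal vertices it is available only when the swapped entries are distinct. -/
theorem alternating_move {s : ℚ} {F : List α → M} (P L R : List α) (a : α)
    (hF : ∀ A x y B, (A ++ x :: y :: B).Perm (P ++ a :: (L ++ R)) →
      F (A ++ x :: y :: B) = s • F (A ++ y :: x :: B)) :
    F (P ++ a :: (L ++ R)) = s ^ L.length • F (P ++ (L ++ a :: R)) := by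
  induction L generalizing P with
  | nil => simp
  | cons b L ih =>
    have h1 := hF P a b (L ++ R) (by simp)
    have h2 := ih (P ++ [b]) (by
      intro A x y B hp
      apply hF
      refine hp.trans ?_
      simp only [List.append_assoc, List.cons_append, List.nil_append]
      exact List.Perm.append_left P (List.Perm.swap _ _ _))
    simp only [List.append_assoc, List.cons_append, List.nil_append] at h2 ⊢
    rw [h1, h2, smul_smul, List.length_cons, pow_succ']

/-- A function of lists that picks up the sign `s` under transpositions. -/
theorem alternating_unsh {s : ℚ} (p : α → Bool) (F : List α → M) (l : List α)
    (hF : ∀ A x y B, (A ++ x :: y :: B).Perm l →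
      F (A ++ x :: y :: B) = s • F (A ++ y :: x :: B)) :
    F l = unsh s p l • F (l.filter p ++ l.filter fun x => !p x) := by
  induction l generalizing F with
  | nil => simp [unsh]
  | cons a l ih =>
    -- Sort the tail behind the fixed head `a`; if `a` is not chosen, it must afterwards pass the
    -- block of chosen elements.
    have h1 := ih (fun r => F (a :: r)) (fun A x y B hp => hF (a :: A) x y B (hp.cons a))
    rw [h1]
    by_cases hp : p a = true
    · simp [unsh, hp]
    · replace hp : p a = false := by simpa using hp
      have h2 := alternating_move (s := s) (F := F) [] (l.filter p) (l.filter fun x => !p x) a (by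
        intro A x y B hq
        refine hF A x y B (hq.trans ?_)
        exact (List.filter_append_perm p l).cons a)
      simp only [List.nil_append] at h2
      rw [h2, smul_smul]
      simp [unsh, hp, mul_comm]

end Unshuffle

/-! ### Graphs with named internal vertices -/

section Named

variable {X Y : Type}

/-- The value of a predicate on internal vertices, extended by `false` to the external vertices. -/
def intern (S : ℕ → Bool) : Vtx X → Bool
  | .inl _ => false
  | .inr i => S i

/-- The edge has an internal end point in `S`. -/
def touch (S : ℕ → Bool) (e : Edge X) : Bool := intern S e.1 || intern S e.2

/-- Apply `ρ` to the internal vertices. -/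
def intMap (ρ : ℕ → ℕ) : Vtx X → Vtx X
  | .inl x => .inl x
  | .inr i => .inr (ρ i)

/-- The internal end points of all edges are in `vs`. -/
def Closed (vs : List ℕ) (es : List (Edge X)) : Prop :=
  ∀ e ∈ es, ∀ i, (e.1 = .inr i → i ∈ vs) ∧ (e.2 = .inr i → i ∈ vs)

/-- The end points of an edge between internal vertices are both in `S` or both outside of `S`. -/
def Saturated (S : ℕ → Bool) (es : List (Edge X)) : Prop :=
  ∀ i j, (.inr i, .inr j) ∈ es → S i = S j

/-- Two internal vertices are connected by a path of edges between internal vertices. -/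
def IntJoined (es : List (Edge X)) : ℕ → ℕ → Prop :=
  Relation.EqvGen fun i j => (.inr i, .inr j) ∈ es

open Classical in
/-- The set of internal vertices in the internally connected component of `v`. -/
noncomputable def comp (es : List (Edge X)) (v : ℕ) : ℕ → Bool := fun j => decide (IntJoined es v j)

theorem comp_eq_true {es : List (Edge X)} {v j : ℕ} : comp es v j = true ↔ IntJoined es v j := by
  simp [comp]

theorem comp_self (es : List (Edge X)) (v : ℕ) : comp es v v = true :=
  comp_eq_true.2 (.refl _)

theorem IntJoined.mono {es : List (Edge X)} {es' : List (Edge Y)}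
    (h : ∀ i j, (.inr i, .inr j) ∈ es → IntJoined es' i j) {i j : ℕ} (hij : IntJoined es i j) :
    IntJoined es' i j := by
  induction hij with
  | rel v w hvw => exact h _ _ hvw
  | refl v => exact .refl _
  | symm v w _ ih => exact .symm _ _ ih
  | trans u v w _ _ ih1 ih2 => exact .trans _ _ _ ih1 ih2

theorem comp_congr {es : List (Edge X)} {es' : List (Edge Y)}
    (h : ∀ i j, (.inr i, .inr j) ∈ es → IntJoined es' i j)
    (h' : ∀ i j, (.inr i, .inr j) ∈ es' → IntJoined es i j) (v : ℕ) : comp es v = comp es' v := by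
  funext j
  rw [Bool.eq_iff_iff, comp_eq_true, comp_eq_true]
  exact ⟨.mono h, .mono h'⟩

theorem comp_perm {es es' : List (Edge X)} (h : es.Perm es') (v : ℕ) : comp es v = comp es' v :=
  comp_congr (fun _ _ hij => .rel _ _ (h.mem_iff.1 hij)) (fun _ _ hij => .rel _ _ (h.mem_iff.2 hij)) v

theorem comp_flip (A B : List (Edge X)) (u w : Vtx X) (v : ℕ) :
    comp (A ++ (u, w) :: B) v = comp (A ++ (w, u) :: B) v := by
  have key : ∀ (u w : Vtx X) (i j : ℕ), (.inr i, .inr j) ∈ A ++ (u, w) :: B →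
      IntJoined (A ++ (w, u) :: B) i j := by
    intro u w i j hij
    simp only [List.mem_append, List.mem_cons, Prod.mk.injEq] at hij
    rcases hij with h | ⟨rfl, rfl⟩ | h
    · exact .rel _ _ (by simp [h])
    · exact .symm _ _ (.rel _ _ (by simp))
    · exact .rel _ _ (by simp [h])
  exact comp_congr (key u w) (key w u) v

theorem comp_eq_of_comp {es : List (Edge X)} {a b : ℕ} (h : comp es a b = true) :
    comp es a = comp es b := by
  rw [comp_eq_true] at h
  funext j
  rw [Bool.eq_iff_iff, comp_eq_true, comp_eq_true]
  exact ⟨fun h' => .trans _ _ _ (.symm _ _ h) h', fun h' => .trans _ _ _ h h'⟩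

theorem saturated_comp (es : List (Edge X)) (v : ℕ) : Saturated (comp es v) es := by
  intro i j hij
  rw [Bool.eq_iff_iff, comp_eq_true, comp_eq_true]
  exact ⟨fun h => .trans _ _ _ h (.rel _ _ hij), fun h => .trans _ _ _ h (.symm _ _ (.rel _ _ hij))⟩

theorem Saturated.intJoined {S : ℕ → Bool} {es : List (Edge X)} (h : Saturated S es) {i j : ℕ}
    (hij : IntJoined es i j) : S i = S j := by
  induction hij with
  | rel v w hvw => exact h _ _ hvw
  | refl v => rfl
  | symm v w _ ih => exact ih.symm
  | trans u v w _ _ ih1 ih2 => exact ih1.trans ih2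

/-- A path that starts outside of a saturated set never enters it, so none of the deleted edges is
used. Hence splitting off one component leaves the others intact. -/
theorem comp_filter_not {S : ℕ → Bool} {es : List (Edge X)} (hS : Saturated S es) {b : ℕ}
    (hb : S b = false) : comp (es.filter fun e => !touch S e) b = comp es b := by
  have key : ∀ i j, IntJoined es i j → S i = false →
      IntJoined (es.filter fun e => !touch S e) i j := by
    intro i j hij
    induction hij with
    | rel v w hvw =>
      intro hv
      have hw := hS _ _ hvw
      exact .rel _ _ (List.mem_filter.2 ⟨hvw, by simp [touch, intern, ← hw, hv]⟩)
    | refl v => exact fun _ => .refl _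
    | symm v w hvw ih => exact fun hw => .symm _ _ (ih ((hS.intJoined hvw).trans hw))
    | trans u v w huv _ ih1 ih2 =>
      exact fun hu => .trans _ _ _ (ih1 hu) (ih2 ((hS.intJoined huv).symm.trans hu))
  funext j
  rw [Bool.eq_iff_iff, comp_eq_true, comp_eq_true]
  exact ⟨.mono fun i j hij => .rel _ _ (List.mem_filter.1 hij).1, fun h => key _ _ h hb⟩

theorem Closed.comp_mem {vs : List ℕ} {es : List (Edge X)} (h : Closed vs es) {v j : ℕ} (hv : v ∈ vs)
    (hj : comp es v j = true) : j ∈ vs := by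
  have : Saturated (fun i => decide (i ∈ vs)) es := by
    intro i j hij
    have h1 := ((h _ hij) i).1 rfl
    have h2 := ((h _ hij) j).2 rfl
    simp [h1, h2]
  have := this.intJoined (comp_eq_true.1 hj)
  simpa [hv] using this.symm

theorem comp_append {vs ws : List ℕ} {es fs : List (Edge X)} (h : Closed vs es) (h' : Closed ws fs)
    (hd : ∀ i ∈ vs, i ∉ ws) {v : ℕ} (hv : v ∈ vs) : comp (es ++ fs) v = comp es v := by
  -- The equivalence of memberships is carried along because the `symm` and `trans` cases need it to
  -- restart the path at another vertex.
  have key : ∀ i j, IntJoined (es ++ fs) i j → (i ∈ vs ↔ j ∈ vs) ∧ (i ∈ vs → IntJoined es i j) := by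
    intro i j hij
    induction hij with
    | rel v w hvw =>
      rcases List.mem_append.1 hvw with hm | hm
      · have h1 := ((h _ hm) v).1 rfl
        have h2 := ((h _ hm) w).2 rfl
        exact ⟨by simp [h1, h2], fun _ => .rel _ _ hm⟩
      · have h1 := ((h' _ hm) v).1 rfl
        have h2 := ((h' _ hm) w).2 rfl
        have h3 : v ∉ vs := fun h => hd _ h h1
        have h4 : w ∉ vs := fun h => hd _ h h2
        simp [h3, h4]
    | refl v => exact ⟨Iff.rfl, fun _ => .refl _⟩
    | symm v w hvw ih => exact ⟨ih.1.symm, fun hw => .symm _ _ (ih.2 (ih.1.2 hw))⟩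
    | trans u v w huv _ ih1 ih2 =>
      exact ⟨ih1.1.trans ih2.1, fun hu => .trans _ _ _ (ih1.2 hu) (ih2.2 (ih1.1.1 hu))⟩
  funext j
  rw [Bool.eq_iff_iff, comp_eq_true, comp_eq_true]
  exact ⟨fun hj => (key _ _ hj).2 hv, .mono fun i j hij => .rel _ _ (List.mem_append_left _ hij)⟩

theorem comp_cons_inl (x y : X) (es : List (Edge X)) (v : ℕ) :
    comp ((.inl x, .inl y) :: es) v = comp es v :=
  comp_congr (fun i j h => .rel _ _ (by simpa using h)) (fun i j h => .rel _ _ (by simpa using h)) v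

theorem comp_extMap (f : X → Y) (es : List (Edge X)) (v : ℕ) :
    comp (relabel (extMap f) es) v = comp es v := by
  have : ∀ i j, (.inr i, .inr j) ∈ relabel (extMap f) es ↔ (.inr i, .inr j) ∈ es := by
    intro i j
    simp only [List.mem_map]
    constructor
    · rintro ⟨⟨u | u, w | w⟩, he, h⟩
      all_goals simp [extMap] at h
      obtain ⟨rfl, rfl⟩ := h
      exact he
    · exact fun h => ⟨_, h, rfl⟩
  exact comp_congr (fun i j h => .rel _ _ ((this i j).1 h)) (fun i j h => .rel _ _ ((this i j).2 h)) v

/-- Since `ρ` is injective only on `vs`, pulling back a path of the renamed graph requires knowing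
that its intermediate vertices lie in the image of `vs`; this is the first half of `key`. -/
theorem comp_intMap {vs : List ℕ} {es : List (Edge X)} (h : Closed vs es) {ρ : ℕ → ℕ}
    (hρ : ∀ i ∈ vs, ∀ j ∈ vs, ρ i = ρ j → i = j) {v j : ℕ} (hv : v ∈ vs) (hj : j ∈ vs) :
    comp (relabel (intMap ρ) es) (ρ v) (ρ j) = comp es v j := by
  have key : ∀ x y, IntJoined (relabel (intMap ρ) es) x y → (x ∈ vs.map ρ ↔ y ∈ vs.map ρ) ∧
      ∀ i ∈ vs, ∀ j ∈ vs, ρ i = x → ρ j = y → IntJoined es i j := by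
    intro x y hxy
    induction hxy with
    | rel x y hxy =>
      obtain ⟨⟨u | u, w | w⟩, he, h'⟩ := List.mem_map.1 hxy
      all_goals simp [intMap] at h'
      obtain ⟨rfl, rfl⟩ := h'
      have h1 := ((h _ he) u).1 rfl
      have h2 := ((h _ he) w).2 rfl
      refine ⟨by simp [List.mem_map_of_mem h1, List.mem_map_of_mem h2], ?_⟩
      intro i hi j hj hiu hjw
      rw [hρ i hi u h1 hiu, hρ j hj w h2 hjw]
      exact .rel _ _ he
    | refl x =>
      refine ⟨Iff.rfl, fun i hi j hj h1 h2 => ?_⟩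
      rw [hρ i hi j hj (h1.trans h2.symm)]
      exact .refl _
    | symm x y _ ih => exact ⟨ih.1.symm, fun i hi j hj h1 h2 => .symm _ _ (ih.2 j hj i hi h2 h1)⟩
    | trans x y z _ _ ih1 ih2 =>
      refine ⟨ih1.1.trans ih2.1, fun i hi j hj h1 h2 => ?_⟩
      obtain ⟨m, hm, rfl⟩ := List.mem_map.1 (ih1.1.1 (h1 ▸ List.mem_map_of_mem hi))
      exact .trans _ _ _ (ih1.2 i hi m hm h1 rfl) (ih2.2 m hm j hj rfl h2)
  rw [Bool.eq_iff_iff, comp_eq_true, comp_eq_true]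
  constructor
  · exact fun h' => (key _ _ h').2 v hv j hj rfl rfl
  · intro h'
    induction h' with
    | rel v w hvw => exact .rel _ _ (List.mem_map.2 ⟨_, hvw, rfl⟩)
    | refl v => exact .refl _
    | symm v w _ ih => exact .symm _ _ (ih hj hv)
    | trans u v w huv _ ih1 ih2 =>
      have hv' := h.comp_mem hv (comp_eq_true.2 huv)
      exact .trans _ _ _ (ih1 hv hv') (ih2 hv' hj)

theorem touch_not {S : ℕ → Bool} {es : List (Edge X)} (hS : Saturated S es) {e : Edge X} (he : e ∈ es)
    (h : touch S e = true) : touch (fun i => !S i) e = false := by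
  obtain ⟨u | u, w | w⟩ := e
  · simp [touch, intern]
  · simpa [touch, intern] using h
  · simpa [touch, intern] using h
  · have := hS _ _ he
    simpa [touch, intern, this] using h

theorem Closed.filter {vs : List ℕ} {es : List (Edge X)} (h : Closed vs es) {S : ℕ → Bool}
    (hS : Saturated S es) : Closed (vs.filter S) (es.filter (touch S)) := by
  intro e he i
  rw [List.mem_filter] at he
  obtain ⟨u, w⟩ := e
  have h1 := h _ he.1 i
  simp only [List.mem_filter]
  constructor
  · rintro rfl
    refine ⟨h1.1 rfl, ?_⟩
    rcases w with w | w
    · simpa [touch, intern] using he.2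
    · have := hS _ _ he.1
      simpa [touch, intern, this] using he.2
  · rintro rfl
    refine ⟨h1.2 rfl, ?_⟩
    rcases u with u | u
    · simpa [touch, intern] using he.2
    · have := hS _ _ he.1
      simpa [touch, intern, this] using he.2

theorem Closed.filter_not {vs : List ℕ} {es : List (Edge X)} (h : Closed vs es) (S : ℕ → Bool) :
    Closed (vs.filter fun i => !S i) (es.filter fun e => !touch S e) := by
  intro e he i
  rw [List.mem_filter] at he
  obtain ⟨u, w⟩ := e
  have h1 := h _ he.1 i
  simp only [List.mem_filter]
  constructor
  · rintro rfl
    refine ⟨h1.1 rfl, ?_⟩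
    simp [touch, intern] at he
    simp [he.2.1]
  · rintro rfl
    refine ⟨h1.2 rfl, ?_⟩
    simp [touch, intern] at he
    simp [he.2.2]

theorem Closed.perm_left {vs vs' : List ℕ} {es : List (Edge X)} (h : Closed vs es)
    (hp : vs.Perm vs') : Closed vs' es :=
  fun e he i => ⟨fun h' => hp.mem_iff.1 ((h e he i).1 h'), fun h' => hp.mem_iff.1 ((h e he i).2 h')⟩

theorem Closed.inl_inl {es : List (Edge X)} (h : Closed [] es) {e : Edge X} (he : e ∈ es) :
    ∃ x y, e = (.inl x, .inl y) := by
  obtain ⟨u | u, w | w⟩ := e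
  · exact ⟨_, _, rfl⟩
  · exact absurd ((h _ he w).2 rfl) (by simp)
  · exact absurd ((h _ he u).1 rfl) (by simp)
  · exact absurd ((h _ he u).1 rfl) (by simp)

theorem wf_iff_closed {k : ℕ} {es : List (Edge X)} : WF k es ↔ Closed (List.range k) es := by
  have : ∀ v : Vtx X, InRange k v ↔ ∀ i, v = .inr i → i ∈ List.range k := by
    rintro (v | v) <;> simp [InRange]
  simp only [WF, Closed, this, forall_and]

theorem touch_extMap (f : X → Y) (S : ℕ → Bool) (e : Edge X) :
    touch S (Prod.map (extMap f) (extMap f) e) = touch S e := by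
  obtain ⟨u | u, w | w⟩ := e <;> rfl

/-- The position of the internal vertices in the list `vs`. -/
abbrev idx (vs : List ℕ) : Vtx X → Vtx X := intMap vs.idxOf

/-- Admissible graphs with list of internal vertices `vs` and list of edges `es`. -/
structure AdmNamed (pt : X) (vs : List ℕ) (es : List (Edge X)) : Prop where
  nodup : vs.Nodup
  closed : Closed vs es
  base : ∀ e ∈ es, e.1 ≠ .inl pt ∧ e.2 ≠ .inl pt
  trivalent : ∀ i ∈ vs, 3 ≤ valence i es
  connected : ∀ i ∈ vs, ∃ x : X, Joined es (.inr i) (.inl x)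

theorem Admissible.named {pt : X} {k : ℕ} {l : List (Edge X)} (h : Admissible pt k l) :
    AdmNamed pt (List.range k) l where
  nodup := List.nodup_range
  closed := wf_iff_closed.1 h.wf
  base := h.base
  trivalent i hi := h.trivalent i (List.mem_range.1 hi)
  connected i hi := h.connected i (List.mem_range.1 hi)

theorem AdmNamed.admissible {pt : X} {vs : List ℕ} {es : List (Edge X)} (h : AdmNamed pt vs es) :
    Admissible pt vs.length (relabel (idx vs) es) where
  inRange e he := by
    obtain ⟨⟨u, w⟩, he', rfl⟩ := List.mem_map.1 he
    have := h.closed _ he'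
    constructor
    · rcases u with u | u
      · trivial
      · exact List.idxOf_lt_length_of_mem ((this u).1 rfl)
    · rcases w with w | w
      · trivial
      · exact List.idxOf_lt_length_of_mem ((this w).2 rfl)
  base e he := by
    obtain ⟨⟨u, w⟩, he', rfl⟩ := List.mem_map.1 he
    have := h.base _ he'
    rcases u with u | u <;> rcases w with w | w <;> simp_all [intMap]
  trivalent i hi := by
    have hit_eq : ∀ u : Vtx X, (∀ j, u = .inr j → j ∈ vs) → hit i (idx vs u) = hit vs[i] u := by
      rintro (u | u) hu
      · rfl
      · simp only [intMap, hit]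
        congr 1
        have h1 := hu u rfl
        rw [eq_iff_iff]
        constructor
        · rintro rfl; simp
        · rintro rfl; exact h.nodup.idxOf_getElem _ _
    have : valence i (relabel (idx vs) es) = valence vs[i] es := by
      simp only [valence, List.map_map]
      congr 1
      apply List.map_congr_left
      intro e he
      have := h.closed e he
      simp [hit_eq _ fun j => (this j).1, hit_eq _ fun j => (this j).2]
    rw [this]
    exact h.trivalent _ (List.getElem_mem _)
  connected i hi := by
    obtain ⟨x, hx⟩ := h.connected vs[i] (List.getElem_mem _)
    refine ⟨x, ?_⟩
    have := joined_relabel (f := idx vs) hx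
    simpa only [intMap, h.nodup.idxOf_getElem] using this

/-- All edges at a kept vertex are kept, so valences do not change; they lead only to kept or
external vertices, so a path to an external vertex can be followed until it first reaches one. -/
theorem AdmNamed.filter {pt : X} {vs : List ℕ} {es : List (Edge X)} (h : AdmNamed pt vs es)
    {S : ℕ → Bool} {p : Edge X → Bool} (hc : Closed (vs.filter S) (es.filter p))
    (hp : ∀ e ∈ es, ∀ i, S i = true → e.1 = .inr i ∨ e.2 = .inr i → p e = true) :
    AdmNamed pt (vs.filter S) (es.filter p) where
  nodup := h.nodup.filter _
  closed := hc
  base e he := h.base e (List.mem_filter.1 he).1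
  trivalent i hi := by
    rw [List.mem_filter] at hi
    have : ∀ es : List (Edge X), (∀ e ∈ es, e.1 = .inr i ∨ e.2 = .inr i → p e = true) →
        valence i (es.filter p) = valence i es := by
      intro es hes
      induction es with
      | nil => rfl
      | cons e es ih =>
        have ih := ih fun e he => hes e (List.mem_cons_of_mem _ he)
        rw [List.filter_cons]
        split_ifs with hpe
        · rw [valence_cons, valence_cons, ih]
        · have h1 := mt (hes e List.mem_cons_self) hpe
          have h2 : ∀ u : Vtx X, u ≠ .inr i → hit i u = 0 := by
            rintro (u | u) hu
            · rfl
            · simpa [hit] using hu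
          rw [valence_cons, ih, h2 _ fun h => h1 (.inl h), h2 _ fun h => h1 (.inr h), zero_add,
            zero_add]
    rw [this es fun e he => hp e he i hi.2]
    exact h.trivalent i hi.1
  connected i hi := by
    rw [List.mem_filter] at hi
    obtain ⟨x, hx⟩ := h.connected i hi.1
    -- This property is constant along paths and vacuous at external vertices; at a vertex of `S` it
    -- is the required connection by kept edges.
    let good : Vtx X → Prop := fun u =>
      ∀ j, u = .inr j → S j = true → ∃ y, Joined (es.filter p) u (.inl y)
    have edge : ∀ u w, (u, w) ∈ es → (good u ↔ good w) := by
      intro u w huw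
      have aux : ∀ u w : Vtx X, ((u, w) ∈ es ∨ (w, u) ∈ es) → good u → good w := by
        rintro u w huw hu j rfl hj
        have hj' : Joined (es.filter p) u (.inr j) := by
          rcases huw with huw | huw
          · exact .rel _ _ (List.mem_filter.2 ⟨huw, hp _ huw j hj (.inr rfl)⟩)
          · exact .symm _ _ (.rel _ _ (List.mem_filter.2 ⟨huw, hp _ huw j hj (.inl rfl)⟩))
        rcases u with y | m
        · exact ⟨y, .symm _ _ hj'⟩
        · have hm : S m = true := by
            rcases huw with huw | huw
            · exact (List.mem_filter.1 ((hc _ (List.mem_filter.2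
                ⟨huw, hp _ huw j hj (.inr rfl)⟩) m).1 rfl)).2
            · exact (List.mem_filter.1 ((hc _ (List.mem_filter.2
                ⟨huw, hp _ huw j hj (.inl rfl)⟩) m).2 rfl)).2
          obtain ⟨y, hy⟩ := hu m rfl hm
          exact ⟨y, .trans _ _ _ (.symm _ _ hj') hy⟩
      exact ⟨aux u w (.inl huw), aux w u (.inr huw)⟩
    have all : ∀ u w, Joined es u w → (good u ↔ good w) := by
      intro u w huw
      induction huw with
      | rel u w h => exact edge u w h
      | refl u => rfl
      | symm u w _ ih => exact ih.symm
      | trans u v w _ _ ih1 ih2 => exact ih1.trans ih2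
    exact (all _ _ hx).2 (fun j hj => by simp at hj) i rfl hi.2

theorem AdmNamed.filter_touch {pt : X} {vs : List ℕ} {es : List (Edge X)} (h : AdmNamed pt vs es)
    {S : ℕ → Bool} (hS : Saturated S es) : AdmNamed pt (vs.filter S) (es.filter (touch S)) :=
  h.filter (h.closed.filter hS) (by
    rintro ⟨u, w⟩ - i hi (rfl | rfl) <;> simp [touch, intern, hi])

theorem AdmNamed.filter_not_touch {pt : X} {vs : List ℕ} {es : List (Edge X)} (h : AdmNamed pt vs es)
    {S : ℕ → Bool} (hS : Saturated S es) :
    AdmNamed pt (vs.filter fun i => !S i) (es.filter fun e => !touch S e) :=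
  h.filter (h.closed.filter_not S) (by
    intro e he i hi hei
    by_contra hne
    have := touch_not hS he (by simpa using hne)
    rcases hei with hei | hei <;> simp [touch, hei, intern] at this <;> simp [this] at hi)

theorem AdmNamed.sublist_nil {pt : X} {es es' : List (Edge X)} (h : AdmNamed pt [] es)
    (hs : ∀ e ∈ es', e ∈ es) : AdmNamed pt [] es' where
  nodup := h.nodup
  closed e he := h.closed e (hs e he)
  base e he := h.base e (hs e he)
  trivalent := by simp
  connected := by simp

end Named

noncomputable section

variable {n : ℕ} {X Y : Pointed.{0}}

/-! ### Classes of graphs with named internal vertices -/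

/-- The class of the graph with internal vertices `vs` and edges `es`. -/
def clsNamed (n : ℕ) (X : Pointed.{0}) (vs : List ℕ) (es : List (Edge X)) : GraphAlg n X :=
  cls n X ⟨vs.length, relabel (idx vs) es⟩

theorem idx_range {k : ℕ} {es : List (Edge X)} (h : WF k es) :
    relabel (idx (List.range k)) es = es := by
  refine relabel_eq_self ?_ h
  rintro (v | v) hv
  · rfl
  · simp only [intMap, Sum.inr.injEq]
    have := List.nodup_range (n := k).idxOf_getElem v (by simpa [InRange] using hv)
    simpa using this

/-- Named graphs are introduced because splitting off a component leaves internal vertices that need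
not form an initial segment. Keeping their names avoids renumbering at every stage of the recursion.
-/
theorem clsNamed_range {k : ℕ} {es : List (Edge X)} (h : WF k es) :
    clsNamed n X (List.range k) es = cls n X ⟨k, es⟩ := by
  rw [clsNamed, idx_range h, List.length_range]

theorem clsNamed_swapEdges (vs : List ℕ) (A B : List (Edge X)) (e f : Edge X) :
    clsNamed n X vs (A ++ e :: f :: B) = sgnE n • clsNamed n X vs (A ++ f :: e :: B) := by
  simp only [clsNamed, relabel, List.map_append, List.map_cons]
  exact cls_step (.swapEdges _ _ _ _ _)

theorem clsNamed_flipEdge (vs : List ℕ) (A B : List (Edge X)) (u w : Vtx X) :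
    clsNamed n X vs (A ++ (u, w) :: B) = sgnV n • clsNamed n X vs (A ++ (w, u) :: B) := by
  simp only [clsNamed, relabel, List.map_append, List.map_cons, Prod.map]
  exact cls_step (.flipEdge _ _ _ _ _)

theorem clsNamed_swapVertices (A B : List ℕ) {a b : ℕ} (h : a ≠ b) (es : List (Edge X)) :
    clsNamed n X (A ++ a :: b :: B) es = sgnV n • clsNamed n X (A ++ b :: a :: B) es := by
  have h1 := cls_step (n := n) (Step.swapVertices (n := n) (A ++ a :: b :: B).length A.length
    (by simp) (relabel (idx (A ++ a :: b :: B)) es))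
  have h2 : ∀ v : Vtx X, vswap A.length (idx (A ++ a :: b :: B) v) = idx (A ++ b :: a :: B) v := by
    rintro (v | v)
    · rfl
    · simp only [intMap, vswap, Sum.inr.injEq, List.idxOf_append, List.idxOf_cons]
      by_cases hv : v ∈ A
      · have := List.idxOf_lt_length_of_mem hv
        simp only [hv, if_true]
        split_ifs <;> omega
      · simp only [hv, if_false]
        by_cases ha : a = v
        · subst ha
          simp [beq_false_of_ne h.symm, add_comm]
        · by_cases hb : b = v
          · subst hb
            simp [beq_false_of_ne h, add_comm]
          · simp only [beq_false_of_ne ha, beq_false_of_ne hb, cond_false]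
            split_ifs <;> omega
  rw [relabel_relabel] at h1
  simp only [h2] at h1
  rw [clsNamed, h1, clsNamed]
  congr 3
  simp

theorem idxOf_map_of_inj {vs : List ℕ} {ρ : ℕ → ℕ} {j : ℕ}
    (hρ : ∀ i ∈ vs, ρ i = ρ j → i = j) : (vs.map ρ).idxOf (ρ j) = vs.idxOf j := by
  induction vs with
  | nil => rfl
  | cons v vs ih =>
    rw [List.map_cons, List.idxOf_cons, List.idxOf_cons,
      ih fun i hi => hρ i (List.mem_cons_of_mem _ hi)]
    have := hρ v List.mem_cons_self
    by_cases h : v = j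
    · simp [h]
    · have h' : ρ v ≠ ρ j := fun h' => h (this h')
      simp [beq_false_of_ne h, beq_false_of_ne h']

theorem relabel_congr_closed {X Y : Type} {f g : Vtx X → Vtx Y} {vs : List ℕ} {es : List (Edge X)}
    (h : Closed vs es) (h1 : ∀ x, f (.inl x) = g (.inl x)) (h2 : ∀ i ∈ vs, f (.inr i) = g (.inr i)) :
    relabel f es = relabel g es := by
  apply List.map_congr_left
  rintro ⟨u, w⟩ he
  have h3 := h _ he
  have hu : f u = g u := by
    rcases u with u | u
    · exact h1 u
    · exact h2 u ((h3 u).1 rfl)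
  have hw : f w = g w := by
    rcases w with w | w
    · exact h1 w
    · exact h2 w ((h3 w).2 rfl)
  simp [hu, hw]

theorem clsNamed_rename {vs : List ℕ} {es : List (Edge X)} (h : Closed vs es) {ρ : ℕ → ℕ}
    (hρ : ∀ i ∈ vs, ∀ j ∈ vs, ρ i = ρ j → i = j) :
    clsNamed n X (vs.map ρ) (relabel (intMap ρ) es) = clsNamed n X vs es := by
  rw [clsNamed, clsNamed, List.length_map, relabel_relabel]
  rw [relabel_congr_closed h (g := idx vs)]
  · intro x; rfl
  · intro i hi
    simp only [intMap, Sum.inr.injEq]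
    exact idxOf_map_of_inj fun j hj => hρ j hj i hi

/-- In the concatenated list, the positions of the first factor are unchanged and those of the
second are shifted by `vs.length`, exactly as in the gluing product. -/
theorem clsNamed_append {vs ws : List ℕ} {es fs : List (Edge X)} (h : AdmNamed X.point vs es)
    (h' : AdmNamed X.point ws fs) (hd : ∀ i ∈ vs, i ∉ ws) :
    clsNamed n X (vs ++ ws) (es ++ fs) = clsNamed n X vs es * clsNamed n X ws fs := by
  rw [clsNamed, clsNamed, clsNamed, ← cls_mul h.admissible h'.admissible, LGraph.mul_def]
  congr 2
  · simp
  · rw [relabel_append, relabel_relabel]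
    congr 1
    · apply relabel_congr_closed h.closed
      · intro x; rfl
      · intro i hi
        simp [intMap, List.idxOf_append, hi]
    · apply relabel_congr_closed h'.closed
      · intro x; rfl
      · intro i hi
        have : i ∉ vs := fun hi' => hd i hi' hi
        simp only [intMap, shift, List.idxOf_append, this, if_false, Sum.inr.injEq]
        omega

/-- A graph is the product of the parts inside and outside of a saturated set of internal vertices. -/
theorem clsNamed_split {vs : List ℕ} {es : List (Edge X)} (h : AdmNamed X.point vs es)
    {S : ℕ → Bool} (hS : Saturated S es) :
    clsNamed n X vs es = (unsh (sgnV n) S vs * unsh (sgnE n) (touch S) es) •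
      (clsNamed n X (vs.filter S) (es.filter (touch S)) *
        clsNamed n X (vs.filter fun i => !S i) (es.filter fun e => !touch S e)) := by
  -- The product is the same graph with the part in `S` listed first; `alternating_unsh` gives the
  -- sign of this reordering, once for the edges and once for the vertices.
  rw [← clsNamed_append (h.filter_touch hS) (h.filter_not_touch hS), mul_smul,
    ← alternating_unsh (touch S) (fun es => clsNamed n X _ es) es,
    ← alternating_unsh S (fun vs => clsNamed n X vs es) vs]
  · intro A a b B hp
    refine clsNamed_swapVertices A B ?_ es
    have := hp.nodup_iff.2 h.nodup
    rw [List.nodup_append] at this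
    have := this.2.1
    simp at this
    tauto
  · intro A e f B _
    exact clsNamed_swapEdges _ A B e f
  · intro i hi hi'
    rw [List.mem_filter] at hi hi'
    simp [hi.2] at hi'

theorem clsNamed_nil_cons {e : Edge X} {es : List (Edge X)} (h : AdmNamed X.point [] (e :: es)) :
    clsNamed n X [] (e :: es) = clsNamed n X [] [e] * clsNamed n X [] es := by
  rw [← clsNamed_append (h.sublist_nil (by simp)) (h.sublist_nil (by simp_all)) (by simp)]
  rfl

theorem clsNamed_nil_nil : clsNamed n X [] [] = 1 := cls_one

/-- The degree of graphs with `m` edges and `k` internal vertices. -/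
def dg (n m k : ℕ) : ℤ := ((n : ℤ) - 1) * m - n * k

theorem dg_add (n m k m' k' : ℕ) : dg n (m + m') (k + k') = dg n m k + dg n m' k' := by
  simp only [dg]; push_cast; ring

theorem clsNamed_mem_gr (vs : List ℕ) (es : List (Edge X)) :
    clsNamed n X vs es ∈ gr n X (dg n es.length vs.length) := by
  have := cls_mem_gr (n := n) (⟨vs.length, relabel (idx vs) es⟩ : LGraph X)
  simpa [degree, dg, clsNamed] using this

/-- The mixed terms of the product of degrees carry the even factor `n (n - 1)`, so modulo two only
the edge-edge and vertex-vertex terms survive. -/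
theorem koszul_sign (n m k m' k' : ℕ) :
    (-1 : ℚ) ^ (dg n m k * dg n m' k') = sgnE n ^ (m * m') * sgnV n ^ (k * k') := by
  obtain ⟨u, hu⟩ := Int.even_mul_pred_self (n : ℤ)
  rw [neg_one_zpow_eq (m := (n + 1) * (m * m') + n * (k * k')) ((u - n) * (m * m')
      + u * (k * k') - u * (m * k' + k * m')), sgnE, sgnV, ← pow_mul, ← pow_mul, ← pow_add]
  simp only [dg]
  push_cast
  linear_combination (m * m' + k * k' - (m * k' + k * m') : ℤ) * hu

theorem clsNamed_of_base {vs : List ℕ} {es : List (Edge X)} {e : Edge X} (he : e ∈ es)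
    (h : e.1 = .inl X.point ∨ e.2 = .inl X.point) : clsNamed n X vs es = 0 := by
  apply cls_of_notMem
  intro hg
  have := hg.base _ (List.mem_map.2 ⟨e, he, rfl⟩)
  rcases h with h | h <;> simp [h, intMap] at this

theorem pushLin_clsNamed (f : X ⟶ Y) {vs : List ℕ} {es : List (Edge X)}
    (h : AdmNamed X.point vs es) :
    pushLin n f (clsNamed n X vs es) = clsNamed n Y vs (relabel (extMap f.toFun) es) := by
  rw [clsNamed, pushLin_cls f h.admissible, clsNamed, pushGraph]
  rw [relabel_relabel, relabel_relabel]
  congr 3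
  funext v
  rcases v with v | v <;> rfl

end

noncomputable section

variable {n : ℕ} {X Y : Pointed.{0}} {A : DGCAlg}

/-! ### Multiplicative extension of linear maps -/

/-- The product of the values of `c` on the internally connected components of a graph. -/
def multExt (c : GraphAlg n X →ₗ[ℚ] A) : List ℕ → List (Edge X) → A
  | [], es => (es.map fun e => c (clsNamed n X [] [e])).prod
  | v :: vs, es =>
    (unsh (sgnV n) (comp es v) (v :: vs) * unsh (sgnE n) (touch (comp es v)) es) •
      (c (clsNamed n X ((v :: vs).filter (comp es v)) (es.filter (touch (comp es v)))) *
        multExt c (vs.filter fun i => !comp es v i) (es.filter fun e => !touch (comp es v) e))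
  termination_by vs => vs.length
  decreasing_by simpa using (List.length_filter_le _ _).trans (by simp)

theorem multExt_nil (c : GraphAlg n X →ₗ[ℚ] A) (es : List (Edge X)) :
    multExt c [] es = (es.map fun e => c (clsNamed n X [] [e])).prod := by
  rw [multExt]

/-- The working form of the recursion: the component may be given in another form, and both parts
are filtered from the same list `v :: vs`, since `v` lies in its own component. -/
theorem multExt_cons (c : GraphAlg n X →ₗ[ℚ] A) {v : ℕ} {vs : List ℕ} {es : List (Edge X)}
    {S : ℕ → Bool} (hS : S = comp es v) :
    multExt c (v :: vs) es = (unsh (sgnV n) S (v :: vs) * unsh (sgnE n) (touch S) es) •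
      (c (clsNamed n X ((v :: vs).filter S) (es.filter (touch S))) *
        multExt c ((v :: vs).filter fun i => !S i) (es.filter fun e => !touch S e)) := by
  subst hS
  rw [multExt, List.filter_cons (p := fun i => !comp es v i), comp_self]
  rfl

theorem length_filter_lt {v : ℕ} {vs : List ℕ} {S : ℕ → Bool} (hS : S v = true) :
    ((v :: vs).filter fun i => !S i).length < (v :: vs).length := by
  rw [List.filter_cons]
  simpa [hS] using Nat.lt_succ_of_le (List.length_filter_le _ _)

theorem length_filter_add {α : Type*} (p : α → Bool) (l : List α) :
    (l.filter p).length + (l.filter fun x => !p x).length = l.length := by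
  rw [← List.length_append]
  exact (List.filter_append_perm p l).length_eq

theorem mul_clsNamed_comm {c : GraphAlg n X →ₗ[ℚ] A} (hc : ∀ i, ∀ x ∈ gr n X i, c x ∈ A.gr i)
    (vs ws : List ℕ) (es fs : List (Edge X)) :
    c (clsNamed n X vs es) * c (clsNamed n X ws fs)
      = (sgnE n ^ (es.length * fs.length) * sgnV n ^ (vs.length * ws.length)) •
        (c (clsNamed n X ws fs) * c (clsNamed n X vs es)) := by
  rw [A.comm (hc _ _ (clsNamed_mem_gr vs es)) (hc _ _ (clsNamed_mem_gr ws fs)), koszul_sign]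

theorem multExt_mem {c : GraphAlg n X →ₗ[ℚ] A} (hc : ∀ i, ∀ x ∈ gr n X i, c x ∈ A.gr i)
    (vs : List ℕ) (es : List (Edge X)) : multExt c vs es ∈ A.gr (dg n es.length vs.length) := by
  have := A.gradedMonoid
  induction hN : vs.length using Nat.strong_induction_on generalizing vs es with
  | _ N ih =>
    rcases vs with _ | ⟨v, vs⟩
    · subst hN
      rw [multExt_nil]
      clear ih
      induction es with
      | nil =>
        simpa [dg] using A.one_mem_gr
      | cons e es ih' =>
        rw [List.map_cons, List.prod_cons, List.length_cons, add_comm,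
          show ([] : List ℕ).length = 0 + 0 from rfl, dg_add]
        exact SetLike.mul_mem_graded (hc _ _ (clsNamed_mem_gr [] [e])) ih'
    · rw [multExt_cons c rfl]
      apply Submodule.smul_mem
      have h1 := ih _ (hN ▸ length_filter_lt (comp_self es v)) _
        (es.filter fun e => !touch (comp es v) e) rfl
      have h2 := SetLike.mul_mem_graded (hc _ _ (clsNamed_mem_gr (n := n)
        ((v :: vs).filter (comp es v)) (es.filter (touch (comp es v))))) h1
      rwa [← dg_add, length_filter_add, length_filter_add, hN] at h2

/-- The component of the head vertex does not depend on the order of the edges. Two edges inside it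
are swapped under `c`, two edges outside by induction, and a mixed pair changes only the unshuffle
sign. Without internal vertices this is graded commutativity in `A`. -/
theorem multExt_swapEdges {c : GraphAlg n X →ₗ[ℚ] A} (hc : ∀ i, ∀ x ∈ gr n X i, c x ∈ A.gr i)
    (vs : List ℕ) (P Q : List (Edge X)) (e f : Edge X) :
    multExt c vs (P ++ e :: f :: Q) = sgnE n • multExt c vs (P ++ f :: e :: Q) := by
  induction hN : vs.length using Nat.strong_induction_on generalizing vs P Q with
  | _ N ih =>
    rcases vs with _ | ⟨v, vs⟩
    · simp only [multExt_nil, List.map_append, List.map_cons, List.prod_append, List.prod_cons]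
      rw [← mul_assoc (c _) (c _) _, mul_clsNamed_comm hc]
      simp [mul_assoc]
    · have hS : comp (P ++ e :: f :: Q) v = comp (P ++ f :: e :: Q) v :=
        comp_perm (List.Perm.append_left P (List.Perm.swap _ _ _)) v
      rw [multExt_cons c hS.symm, multExt_cons c rfl]
      generalize hT : comp (P ++ f :: e :: Q) v = S
      have hv : S v = true := hT ▸ comp_self _ v
      cases he : touch S e <;> cases hf : touch S f
      · rw [unsh_swap_of_eq _ P Q (by rw [he, hf])]
        simp only [List.filter_append, List.filter_cons (x := e), List.filter_cons (x := f), he, hf,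
          Bool.not_false, if_true, if_false,
          Bool.false_eq_true]
        rw [ih _ (hN ▸ length_filter_lt hv) _ _ _ rfl, mul_smul_comm, smul_comm]
      · rw [unsh_swap_of_ne (sgnE_mul n) P Q (by rw [he, hf]; simp)]
        simp only [List.filter_append, List.filter_cons (x := e), List.filter_cons (x := f), he, hf,
          Bool.not_false, if_true, if_false,
          Bool.false_eq_true, Bool.not_true, smul_smul]
        congr 1
        ring
      · rw [unsh_swap_of_ne (sgnE_mul n) P Q (by rw [he, hf]; simp)]
        simp only [List.filter_append, List.filter_cons (x := e), List.filter_cons (x := f), he, hf,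
          Bool.not_false, if_true, if_false,
          Bool.false_eq_true, Bool.not_true, smul_smul]
        congr 1
        ring
      · rw [unsh_swap_of_eq _ P Q (by rw [he, hf])]
        simp only [List.filter_append, List.filter_cons (x := e), List.filter_cons (x := f), he, hf,
          Bool.not_true, if_true, if_false,
          Bool.false_eq_true]
        rw [clsNamed_swapEdges, map_smul, smul_mul_assoc, smul_comm]

theorem touch_swap (S : ℕ → Bool) (u w : Vtx X) : touch S (u, w) = touch S (w, u) :=
  Bool.or_comm _ _

/-- A reversal does not affect which sets an edge touches, so all unshuffle signs agree and the sign
comes from the one factor that contains the edge. -/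
theorem multExt_flipEdge (c : GraphAlg n X →ₗ[ℚ] A) (vs : List ℕ) (P Q : List (Edge X))
    (u w : Vtx X) :
    multExt c vs (P ++ (u, w) :: Q) = sgnV n • multExt c vs (P ++ (w, u) :: Q) := by
  induction hN : vs.length using Nat.strong_induction_on generalizing vs P Q with
  | _ N ih =>
    rcases vs with _ | ⟨v, vs⟩
    · simp only [multExt_nil, List.map_append, List.map_cons, List.prod_append, List.prod_cons]
      have := clsNamed_flipEdge (n := n) [] [] [] u w
      rw [List.nil_append, List.nil_append] at this
      rw [this, map_smul, smul_mul_assoc, mul_smul_comm]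
    · rw [multExt_cons c (comp_flip P Q w u v), multExt_cons c rfl]
      generalize hT : comp (P ++ (w, u) :: Q) v = S
      have hv : S v = true := hT ▸ comp_self _ v
      have hu : unsh (sgnE n) (touch S) (P ++ (u, w) :: Q)
          = unsh (sgnE n) (touch S) (P ++ (w, u) :: Q) := by
        rw [unsh_append, unsh_append]
        simp only [unsh, List.filter_cons, touch_swap S u w]
        split_ifs <;> simp
      rw [hu]
      cases he : touch S (w, u)
      · simp only [List.filter_append, List.filter_cons (x := (u, w)),
          List.filter_cons (x := (w, u)), touch_swap S u w, he, Bool.not_false,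
          if_true, if_false, Bool.false_eq_true]
        rw [ih _ (hN ▸ length_filter_lt hv) _ _ _ rfl, mul_smul_comm, smul_comm]
      · simp only [List.filter_append, List.filter_cons (x := (u, w)),
          List.filter_cons (x := (w, u)), touch_swap S u w, he, Bool.not_true,
          if_true, if_false, Bool.false_eq_true]
        rw [clsNamed_flipEdge, map_smul, smul_mul_assoc, smul_comm]

/-- The recursion sees the names only through the components and the order of the list, and both are
transported by a renaming that is injective on `vs`. -/
theorem multExt_rename (c : GraphAlg n X →ₗ[ℚ] A) {vs : List ℕ} {es : List (Edge X)}
    (h : Closed vs es) {ρ : ℕ → ℕ} (hρ : ∀ i ∈ vs, ∀ j ∈ vs, ρ i = ρ j → i = j) :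
    multExt c (vs.map ρ) (relabel (intMap ρ) es) = multExt c vs es := by
  induction hN : vs.length using Nat.strong_induction_on generalizing vs es with
  | _ N ih =>
    rcases vs with _ | ⟨v, vs⟩
    · rw [List.map_nil, multExt_nil, multExt_nil, List.map_map]
      congr 1
      apply List.map_congr_left
      intro e he
      obtain ⟨x, y, rfl⟩ := h.inl_inl he
      rfl
    · rw [List.map_cons, multExt_cons c rfl, multExt_cons c rfl, ← List.map_cons]
      set S := comp es v with hS
      set S' := comp (relabel (intMap ρ) es) (ρ v) with hS'
      have hv : S v = true := comp_self _ v
      have hSS : ∀ i ∈ v :: vs, S' (ρ i) = S i := fun i hi =>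
        comp_intMap h hρ List.mem_cons_self hi
      have hidx : ∀ u : Vtx X, (∀ i, u = .inr i → i ∈ v :: vs) →
          intern S' (intMap ρ u) = intern S u := by
        rintro (u | u) hu
        · rfl
        · exact hSS u (hu u rfl)
      have htouch : ∀ e ∈ es, touch S' (Prod.map (intMap ρ) (intMap ρ) e) = touch S e := by
        intro e he
        simp only [touch, Prod.map]
        rw [hidx _ fun i => (h e he i).1, hidx _ fun i => (h e he i).2]
      have f1 : ((v :: vs).map ρ).filter S' = ((v :: vs).filter S).map ρ := by
        rw [List.filter_map, List.filter_congr (p := S' ∘ ρ) (q := S) (fun i hi => hSS i hi)]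
      have f2 : (((v :: vs).map ρ).filter fun i => !S' i)
          = ((v :: vs).filter fun i => !S i).map ρ := by
        rw [List.filter_map, List.filter_congr (q := fun i => !S i)
          (fun i hi => by simp only [Function.comp_apply, hSS i hi])]
      have f3 : (relabel (intMap ρ) es).filter (touch S')
          = relabel (intMap ρ) (es.filter (touch S)) := by
        rw [relabel, List.filter_map,
          List.filter_congr (p := touch S' ∘ _) (q := touch S) (fun e he => htouch e he)]
      have f4 : ((relabel (intMap ρ) es).filter fun e => !touch S' e)
          = relabel (intMap ρ) (es.filter fun e => !touch S e) := by
        rw [relabel, List.filter_map, List.filter_congr (q := fun e => !touch S e)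
          (fun e he => by simp only [Function.comp_apply, htouch e he])]
      rw [f1, f2, f3, f4, unsh_map, unsh_map, unsh_congr _ hSS, unsh_congr _ htouch,
        clsNamed_rename (h.filter (saturated_comp es v)), ih _ (hN ▸ length_filter_lt hv)
          (h.filter_not S) _ rfl]
      · exact fun i hi j hj => hρ i (List.mem_filter.1 hi).1 j (List.mem_filter.1 hj).1
      · exact fun i hi j hj => hρ i (List.mem_filter.1 hi).1 j (List.mem_filter.1 hj).1

theorem filter_filter_of_disjoint {α : Type*} {p q : α → Bool} {l : List α}
    (h : ∀ x ∈ l, p x = true → q x = false) : ((l.filter fun x => !p x).filter q) = l.filter q := by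
  rw [List.filter_filter]
  apply List.filter_congr
  intro x hx
  have := h x hx
  revert this
  cases p x <;> cases q x <;> simp

theorem filter_not_comm {α : Type*} (p q : α → Bool) (l : List α) :
    ((l.filter fun x => !p x).filter fun x => !q x)
      = ((l.filter fun x => !q x).filter fun x => !p x) := by
  rw [List.filter_filter, List.filter_filter]
  simp only [Bool.and_comm]

/-- If `a` and `b` share a component, the swap takes place under `c`. Otherwise both sides unfold
twice into the same two components and the same remainder, in different orders; `unsh_comm` for
vertices and for edges is matched with the Koszul sign in `A`. -/
theorem multExt_swapHead {c : GraphAlg n X →ₗ[ℚ] A} (hc : ∀ i, ∀ x ∈ gr n X i, c x ∈ A.gr i)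
    {a b : ℕ} {vs : List ℕ} {es : List (Edge X)} (hab : a ≠ b) :
    multExt c (a :: b :: vs) es = sgnV n • multExt c (b :: a :: vs) es := by
  by_cases hb : comp es a b = true
  · rw [multExt_cons c rfl, multExt_cons c (comp_eq_of_comp hb)]
    have ha := comp_self es a
    generalize comp es a = S at *
    rw [show a :: b :: vs = [] ++ a :: b :: vs from rfl, unsh_swap_of_eq _ _ _ (ha.trans hb.symm)]
    simp only [List.nil_append, List.filter_cons, ha, hb, if_true, Bool.not_true, if_false,
      Bool.false_eq_true]
    have := clsNamed_swapVertices (n := n) [] (vs.filter S) hab (es.filter (touch S))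
    rw [List.nil_append, List.nil_append] at this
    rw [this, map_smul, smul_mul_assoc, smul_comm]
  · replace hb : comp es a b = false := by simpa using hb
    have ha : comp es b a = false := by
      by_contra h
      replace h : comp es b a = true := by simpa using h
      rw [← comp_eq_of_comp h, comp_self] at hb
      exact absurd hb (by simp)
    have haa := comp_self es a
    have hbb := comp_self es b
    have hsa := saturated_comp es a
    have hsb := saturated_comp es b
    rw [multExt_cons c rfl, multExt_cons c (v := b) rfl]
    have e1 := comp_filter_not hsa hb
    have e2 := comp_filter_not hsb ha
    have hdis : ∀ i, comp es a i = true → comp es b i = false := by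
      intro i hi
      by_contra h
      replace h : comp es b i = true := by simpa using h
      rw [comp_eq_of_comp h, ← comp_eq_of_comp hi] at ha
      exact absurd (haa.symm.trans ha) (by simp)
    generalize comp es a = S at *
    generalize comp es b = T at *
    have hdis' : ∀ e ∈ es, touch S e = true → touch T e = false := by
      intro e he h
      have h1 := touch_not hsa he h
      obtain ⟨u, w⟩ := e
      simp only [touch, Bool.or_eq_false_iff] at h1 ⊢
      have h2 : ∀ u : Vtx X, intern (fun i => !S i) u = false → intern T u = false := by
        rintro (u | u) hu
        · rfl
        · exact hdis u (by simpa [intern] using hu)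
      exact ⟨h2 _ h1.1, h2 _ h1.2⟩
    have hdis2 : ∀ e ∈ es, touch T e = true → touch S e = false := by
      intro e he h
      by_contra h'
      rw [hdis' e he (by simpa using h')] at h
      simp at h
    have hdis3 : ∀ i, T i = true → S i = false := by
      intro i h
      by_contra h'
      rw [hdis i (by simpa using h')] at h
      simp at h
    have f1 : ((a :: b :: vs).filter fun i => !S i) = b :: vs.filter fun i => !S i := by
      simp [haa, hb]
    have f2 : ((b :: a :: vs).filter fun i => !T i) = a :: vs.filter fun i => !T i := by
      simp [hbb, ha]
    -- Second unfolding: the head of the remainder is now `b`, respectively `a`, and by `e1` and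
    -- `e2` its component is the one in the whole graph.
    rw [f1, f2, multExt_cons c e1.symm, multExt_cons c e2.symm, ← f1, ← f2,
      filter_filter_of_disjoint (fun i _ => hdis i), filter_filter_of_disjoint (fun i _ => hdis3 i),
      filter_filter_of_disjoint hdis', filter_filter_of_disjoint hdis2, filter_not_comm S T,
      filter_not_comm (touch S) (touch T)]
    have p1 : (a :: b :: vs).filter T = (b :: a :: vs).filter T := by simp [ha, hbb]
    have p2 : (a :: b :: vs).filter S = (b :: a :: vs).filter S := by simp [haa, hb]
    have p3 : ((a :: b :: vs).filter fun i => !T i) = (b :: a :: vs).filter fun i => !T i := by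
      simp [ha, hbb]
    have hV := unsh_comm (sgnV_mul n) (a :: b :: vs) (fun i _ => hdis i)
    have hE := unsh_comm (sgnE_mul n) es hdis'
    -- Only `b` lies in `T`, so exchanging `a` and `b` changes the unshuffle sign of `T`; this
    -- produces the factor `sgnV n` of the claim.
    have hsw := unsh_swap_of_ne (sgnV_mul n) (p := T) [] vs (a := a) (b := b) (by simp [ha, hbb])
    rw [List.nil_append, List.nil_append] at hsw
    rw [hsw] at hV
    rw [p1, p2] at hV ⊢
    rw [p3] at hV ⊢
    simp only [mul_smul_comm, ← mul_assoc, smul_smul]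
    rw [mul_clsNamed_comm hc, smul_mul_assoc, smul_smul]
    congr 1
    set m := ((es.filter (touch S)).length * (es.filter (touch T)).length)
    set k := (((b :: a :: vs).filter S).length * ((b :: a :: vs).filter T).length)
    have hm := pow_even_of_sq (sgnE_mul n) m
    have hk := pow_even_of_sq (sgnV_mul n) k
    -- The comparison of signs in the abstract: `pm` and `pk` arise from commuting the two
    -- components in `A` and again from `unsh_comm`, so they cancel.
    have : ∀ v1 e1 v2 e2 v1' e1' v2' e2' pm pk s : ℚ, v1 * v2 = pk * (s * v1' * v2') →
        e1 * e2 = pm * (e1' * e2') → pm * pm = 1 → pk * pk = 1 →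
        v1 * e1 * v2 * e2 * pm * pk = s * v1' * e1' * v2' * e2' := by
      intro v1 e1 v2 e2 v1' e1' v2' e2' pm pk s h1 h2 h3 h4
      calc v1 * e1 * v2 * e2 * pm * pk = (v1 * v2) * (e1 * e2) * pm * pk := by ring
        _ = (pm * pm) * (pk * pk) * (s * v1' * e1' * v2' * e2') := by rw [h1, h2]; ring
        _ = _ := by rw [h3, h4]; ring
    have := this _ _ _ _ _ _ _ _ _ _ _ hV hE hm hk
    convert this using 1
    ring

/-- Splitting off the component of the first vertex shortens the prefix `P` of the remainder, so
induction leads to a swap at the head. As for edges, a pair with only one vertex in the component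
changes just the unshuffle sign. -/
theorem multExt_swapVertices {c : GraphAlg n X →ₗ[ℚ] A} (hc : ∀ i, ∀ x ∈ gr n X i, c x ∈ A.gr i)
    {a b : ℕ} (P Q : List ℕ) {es : List (Edge X)} (hab : a ≠ b) :
    multExt c (P ++ a :: b :: Q) es = sgnV n • multExt c (P ++ b :: a :: Q) es := by
  induction hN : P.length using Nat.strong_induction_on generalizing P Q es with
  | _ N ih =>
    rcases P with _ | ⟨v, P⟩
    · exact multExt_swapHead hc hab
    · rw [List.cons_append, List.cons_append, multExt_cons c rfl, multExt_cons c rfl,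
        ← List.cons_append, ← List.cons_append]
      have hv := comp_self es v
      generalize comp es v = S at *
      cases ha : S a <;> cases hb : S b
      · rw [unsh_swap_of_eq _ _ Q (by rw [ha, hb])]
        simp only [List.filter_append, List.filter_cons (x := a), List.filter_cons (x := b), ha, hb,
          Bool.not_false, if_true, if_false, Bool.false_eq_true]
        rw [ih _ (hN ▸ length_filter_lt hv) _ _ rfl, mul_smul_comm, smul_comm]
      · rw [unsh_swap_of_ne (sgnV_mul n) _ Q (by rw [ha, hb]; simp)]
        simp only [List.filter_append, List.filter_cons (x := a), List.filter_cons (x := b), ha, hb,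
          Bool.not_false, if_true, if_false, Bool.false_eq_true, Bool.not_true, smul_smul]
        congr 1
        ring
      · rw [unsh_swap_of_ne (sgnV_mul n) _ Q (by rw [ha, hb]; simp)]
        simp only [List.filter_append, List.filter_cons (x := a), List.filter_cons (x := b), ha, hb,
          Bool.not_false, if_true, if_false, Bool.false_eq_true, Bool.not_true, smul_smul]
        congr 1
        ring
      · rw [unsh_swap_of_eq _ _ Q (by rw [ha, hb])]
        simp only [List.filter_append, List.filter_cons (x := a), List.filter_cons (x := b), ha, hb,
          Bool.not_true, if_true, if_false, Bool.false_eq_true]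
        rw [clsNamed_swapVertices _ _ hab, map_smul, smul_mul_assoc, smul_comm]

/-- An edge between external vertices always stays in the remainder. Pulling its factor to the front
past a component costs a Koszul sign that cancels its contribution to the unshuffle sign. -/
theorem multExt_cons_inl {c : GraphAlg n X →ₗ[ℚ] A} (hc : ∀ i, ∀ x ∈ gr n X i, c x ∈ A.gr i)
    (x y : X) (vs : List ℕ) (es : List (Edge X)) :
    multExt c vs ((.inl x, .inl y) :: es)
      = c (clsNamed n X [] [(.inl x, .inl y)]) * multExt c vs es := by
  induction hN : vs.length using Nat.strong_induction_on generalizing vs es with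
  | _ N ih =>
    rcases vs with _ | ⟨v, vs⟩
    · rw [multExt_nil, multExt_nil, List.map_cons, List.prod_cons]
    · rw [multExt_cons c (comp_cons_inl x y es v).symm, multExt_cons c rfl]
      have hv := comp_self es v
      generalize comp es v = S at *
      have ht : touch S ((.inl x, .inl y) : Edge X) = false := rfl
      have hu : unsh (sgnE n) (touch S) (((.inl x, .inl y) : Edge X) :: es)
          = sgnE n ^ (es.filter (touch S)).length * unsh (sgnE n) (touch S) es := by simp [unsh, ht]
      simp only [hu, List.filter_cons (x := ((.inl x, .inl y) : Edge X)), ht, Bool.not_false,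
        if_true, if_false, Bool.false_eq_true]
      rw [ih _ (hN ▸ length_filter_lt hv) _ _ rfl, ← mul_assoc (c _) (c _) _,
        mul_clsNamed_comm hc, mul_smul_comm, smul_mul_assoc, smul_smul, mul_assoc (c _) (c _) _]
      congr 1
      simp only [List.length_cons, List.length_nil, zero_add, mul_one, mul_zero, pow_zero]
      linear_combination (unsh (sgnV n) S (v :: vs) * unsh (sgnE n) (touch S) es) *
        pow_even_of_sq (sgnE_mul n) (es.filter (touch S)).length

/-- The components of the first graph are split off first, and the second graph, standing behind and
untouched, adds nothing to the unshuffle signs. Once `vs` is used up, only external edges of the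
first graph are left. -/
theorem multExt_append {c : GraphAlg n X →ₗ[ℚ] A} (hc : ∀ i, ∀ x ∈ gr n X i, c x ∈ A.gr i)
    {vs ws : List ℕ} {es fs : List (Edge X)} (h : Closed vs es) (h' : Closed ws fs)
    (hd : ∀ i ∈ vs, i ∉ ws) :
    multExt c (vs ++ ws) (es ++ fs) = multExt c vs es * multExt c ws fs := by
  induction hN : vs.length using Nat.strong_induction_on generalizing vs es with
  | _ N ih =>
    rcases vs with _ | ⟨v, vs⟩
    · clear ih
      induction es with
      | nil => simp [multExt_nil]
      | cons e es ih =>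
        obtain ⟨x, y, rfl⟩ := h.inl_inl List.mem_cons_self
        have ih := ih fun e he => h e (List.mem_cons_of_mem _ he)
        rw [List.nil_append] at ih ⊢
        rw [List.cons_append, multExt_cons_inl hc, ih, multExt_cons_inl hc, mul_assoc]
    · have hcomp := comp_append h h' hd (List.mem_cons_self (a := v))
      rw [List.cons_append, multExt_cons c hcomp.symm, multExt_cons c rfl, ← List.cons_append]
      have hv := comp_self es v
      have hws : ∀ i ∈ ws, comp es v i = false := by
        intro i hi
        by_contra hne
        exact hd i (h.comp_mem List.mem_cons_self (by simpa using hne)) hi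
      generalize comp es v = S at *
      have hfs : ∀ e ∈ fs, touch S e = false := by
        rintro ⟨u, w⟩ he
        have hu : ∀ u : Vtx X, (∀ i, u = .inr i → i ∈ ws) → intern S u = false := by
          rintro (u | u) hu
          · rfl
          · exact hws u (hu u rfl)
        simp only [touch, hu _ fun i => (h' _ he i).1, hu _ fun i => (h' _ he i).2, Bool.or_false]
      have g1 : ws.filter S = [] := List.filter_eq_nil_iff.2 (by simpa using hws)
      have g2 : (ws.filter fun i => !S i) = ws := List.filter_eq_self.2 (by simpa using hws)
      have g3 : fs.filter (touch S) = [] := List.filter_eq_nil_iff.2 (by simpa using hfs)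
      have g4 : (fs.filter fun e => !touch S e) = fs := List.filter_eq_self.2 (by simpa using hfs)
      rw [unsh_append, unsh_append, unsh_of_forall_not _ hws, unsh_of_forall_not _ hfs]
      simp only [List.filter_append, g1, g2, g3, g4, List.append_nil, List.length_nil, mul_zero,
        pow_zero, one_mul, mul_one]
      rw [ih _ (hN ▸ length_filter_lt hv) (h.filter_not S) _ rfl, smul_mul_assoc, mul_assoc]
      exact fun i hi => hd i (List.mem_filter.1 hi).1

theorem multExt_of_base (c : GraphAlg n X →ₗ[ℚ] A) (vs : List ℕ) {es : List (Edge X)} {e : Edge X}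
    (he : e ∈ es) (h : e.1 = .inl X.point ∨ e.2 = .inl X.point) : multExt c vs es = 0 := by
  induction hN : vs.length using Nat.strong_induction_on generalizing vs es with
  | _ N ih =>
    rcases vs with _ | ⟨v, vs⟩
    · rw [multExt_nil]
      obtain ⟨P, Q, rfl⟩ := List.append_of_mem he
      simp [clsNamed_of_base (List.mem_singleton_self e) h]
    · rw [multExt_cons c rfl]
      cases ht : touch (comp es v) e
      · rw [ih _ (hN ▸ length_filter_lt (comp_self es v)) _ (List.mem_filter.2 ⟨he, by simp [ht]⟩)
          rfl, mul_zero, smul_zero]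
      · rw [clsNamed_of_base (List.mem_filter.2 ⟨he, ht⟩) h, map_zero, zero_mul, smul_zero]

/-- Every factor is a value on a subgraph, which has no more internal vertices than the whole. This
locality is what permits the induction on the number of internal vertices. -/
theorem multExt_congr {c c' : GraphAlg n X →ₗ[ℚ] A} {N : ℕ}
    (hcc : ∀ g : LGraph X, g.numInt ≤ N → c (cls n X g) = c' (cls n X g)) {vs : List ℕ}
    (hvs : vs.length ≤ N) (es : List (Edge X)) : multExt c vs es = multExt c' vs es := by
  induction hN : vs.length using Nat.strong_induction_on generalizing vs es with
  | _ N ih =>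
    rcases vs with _ | ⟨v, vs⟩
    · rw [multExt_nil, multExt_nil]
      congr 1
      apply List.map_congr_left
      intro e _
      exact hcc _ (Nat.zero_le _)
    · rw [multExt_cons c rfl, multExt_cons c' rfl]
      have hlt := length_filter_lt (vs := vs) (comp_self es v)
      rw [ih _ (hN ▸ hlt) (hlt.le.trans hvs) _ rfl, clsNamed, hcc]
      exact (List.length_filter_le _ _).trans hvs

/-- Relabelling external vertices, even merging them, changes neither the internal components nor
the edges that touch them, so both recursions run in parallel. -/
theorem multExt_push {B : DGCAlg} {c : GraphAlg n X →ₗ[ℚ] A} {c' : GraphAlg n Y →ₗ[ℚ] B}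
    {f : X ⟶ Y} {φ : A ⟶ B} (hφ : ∀ x, φ.toAlgHom (c x) = c' (pushLin n f x)) {vs : List ℕ}
    {es : List (Edge X)} (h : AdmNamed X.point vs es) :
    φ.toAlgHom (multExt c vs es) = multExt c' vs (relabel (extMap f.toFun) es) := by
  induction hN : vs.length using Nat.strong_induction_on generalizing vs es with
  | _ N ih =>
    rcases vs with _ | ⟨v, vs⟩
    · rw [multExt_nil, multExt_nil, map_list_prod, List.map_map, List.map_map]
      congr 1
      apply List.map_congr_left
      intro e he
      simp only [Function.comp_apply, hφ]
      rw [pushLin_clsNamed f (h.sublist_nil (by simpa using he))]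
      rfl
    · rw [multExt_cons c rfl, multExt_cons c' (comp_extMap f.toFun es v).symm]
      have hv := comp_self es v
      have hS := saturated_comp es v
      generalize comp es v = S at *
      have hp := h.filter_touch hS
      rw [map_smul, map_mul, hφ, pushLin_clsNamed f hp, ih _ (hN ▸ length_filter_lt hv)
        (h.filter_not_touch hS) rfl, unsh_map]
      simp only [relabel, List.filter_map, Function.comp_def, touch_extMap]

end

/-! ### The multiplicative extension as an algebra map on the graph algebra -/

noncomputable section

variable {n : ℕ} {X Y : Pointed.{0}} {A : DGCAlg}

theorem comp_filter {X : Type} {S : ℕ → Bool} {es : List (Edge X)} (hS : Saturated S es) {b : ℕ}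
    (hb : S b = true) : comp (es.filter (touch S)) b = comp es b := by
  have key : ∀ i j, IntJoined es i j → S i = true → IntJoined (es.filter (touch S)) i j := by
    intro i j hij
    induction hij with
    | rel v w hvw =>
      exact fun hv => .rel _ _ (List.mem_filter.2 ⟨hvw, by simp [touch, intern, hv]⟩)
    | refl v => exact fun _ => .refl _
    | symm v w hvw ih => exact fun hw => .symm _ _ (ih ((hS.intJoined hvw).trans hw))
    | trans u v w huv _ ih1 ih2 =>
      exact fun hu => .trans _ _ _ (ih1 hu) (ih2 ((hS.intJoined huv).symm.trans hu))
  funext j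
  rw [Bool.eq_iff_iff, comp_eq_true, comp_eq_true]
  exact ⟨.mono fun i j hij => .rel _ _ (List.mem_filter.1 hij).1, fun h => key _ _ h hb⟩

/-- A component is its own only component, so the recursion stops after one stage with trivial signs
and the extension agrees with `c` there. -/
theorem multExt_component (c : GraphAlg n X →ₗ[ℚ] A) (v : ℕ) (vs : List ℕ) (es : List (Edge X)) :
    multExt c ((v :: vs).filter (comp es v)) (es.filter (touch (comp es v)))
      = c (clsNamed n X ((v :: vs).filter (comp es v)) (es.filter (touch (comp es v)))) := by
  have hv := comp_self es v
  have hS := comp_filter (saturated_comp es v) hv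
  generalize hT : comp es v = S at *
  have hvs : (v :: vs).filter S = v :: vs.filter S := by simp [hv]
  have h1 : ∀ i ∈ v :: vs.filter S, S i = true := by
    intro i hi
    rw [← hvs, List.mem_filter] at hi
    exact hi.2
  have h2 : ∀ e ∈ es.filter (touch S), touch S e = true := fun e he => (List.mem_filter.1 he).2
  rw [hvs, multExt_cons c hS.symm, unsh_of_forall _ h1, unsh_of_forall _ h2,
    List.filter_eq_self.2 h1, List.filter_eq_self.2 h2,
    (List.filter_eq_nil_iff (p := fun i => !S i)).2 fun i hi => by simp [h1 i hi],
    (List.filter_eq_nil_iff (p := fun e => !touch S e)).2 fun e he => by simp [h2 e he], multExt_nil]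
  simp

theorem vswap_eq_intMap {X : Type} (i : ℕ) :
    (vswap i : Vtx X → Vtx X) = intMap (Equiv.swap i (i + 1)) := by
  funext v
  rcases v with v | v
  · rfl
  · simp only [vswap, intMap, Equiv.swap_apply_def]

/-- A `swapVertices` step changes the names and keeps the list, whereas `multExt_swapVertices`
changes the list and keeps the names. The transposition converts one into the other. -/
theorem range_split {k i : ℕ} (hi : i + 1 < k) :
    ∃ Q, List.range k = List.range i ++ i :: (i + 1) :: Q ∧
      (List.range i ++ (i + 1) :: i :: Q).map (Equiv.swap i (i + 1)) = List.range k := by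
  obtain ⟨m, rfl⟩ := Nat.exists_eq_add_of_le (Nat.succ_le_of_lt hi)
  have h0 : List.range (i + 1 + 1 + m)
      = List.range i ++ i :: (i + 1) :: (List.range m).map (i + 1 + 1 + ·) := by
    rw [List.range_add, List.range_succ, List.range_succ]
    simp
  refine ⟨(List.range m).map (i + 1 + 1 + ·), h0, ?_⟩
  rw [Nat.succ_eq_add_one, h0]
  simp only [List.map_append, List.map_cons, Equiv.swap_apply_left, Equiv.swap_apply_right,
    List.map_map]
  congr 1
  · conv_rhs => rw [← List.map_id (List.range i)]
    apply List.map_congr_left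
    intro j hj
    have := List.mem_range.1 hj
    exact Equiv.swap_apply_of_ne_of_ne (by omega) (by omega)
  · congr 2
    apply List.map_congr_left
    intro j _
    exact Equiv.swap_apply_of_ne_of_ne (by simp only; omega) (by simp only; omega)

/-- The multiplicative map that agrees with `c` on the internally connected graphs. -/
def extLin (c : GraphAlg n X →ₗ[ℚ] A) (hc : ∀ i, ∀ x ∈ gr n X i, c x ∈ A.gr i) :
    GraphAlg n X →ₗ[ℚ] A :=
  liftLin (fun g => multExt c (List.range g.numInt) g.edges) (by
    intro g hg g' s h
    cases h with
    | swapEdges k P Q e f => exact multExt_swapEdges hc _ _ _ _ _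
    | flipEdge k P Q v w => exact multExt_flipEdge _ _ _ _ _ _
    | swapVertices k i hi l =>
      obtain ⟨Q, h1, h2⟩ := range_split hi
      have hcl := (wf_iff_closed.1 (Admissible.wf hg) : Closed (List.range k) l)
      have hp : (List.range k).Perm (List.range i ++ (i + 1) :: i :: Q) := by
        rw [h1]; exact List.Perm.append_left _ (List.Perm.swap _ _ _)
      -- Undo the renumbering by a renaming, at the price of listing the vertices in the swapped
      -- order.
      have h3 := multExt_rename c (hcl.perm_left hp) (ρ := Equiv.swap i (i + 1))
        (fun _ _ _ _ h => (Equiv.swap i (i + 1)).injective h)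
      rw [h2] at h3
      simp only [vswap_eq_intMap, h3]
      conv_lhs => rw [h1]
      exact multExt_swapVertices hc _ _ (by simp))

variable {c : GraphAlg n X →ₗ[ℚ] A} (hc : ∀ i, ∀ x ∈ gr n X i, c x ∈ A.gr i)

theorem extLin_cls {g : LGraph X} (hg : g ∈ AdmGraph X) :
    extLin c hc (cls n X g) = multExt c (List.range g.numInt) g.edges := liftLin_cls _ _ hg

theorem map_idxOf_self {vs : List ℕ} (h : vs.Nodup) : vs.map vs.idxOf = List.range vs.length := by
  apply List.ext_getElem
  · simp
  · intro i h1 h2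
    simp [h.idxOf_getElem]

theorem extLin_clsNamed {vs : List ℕ} {es : List (Edge X)} (h : AdmNamed X.point vs es) :
    extLin c hc (clsNamed n X vs es) = multExt c vs es := by
  rw [clsNamed, extLin_cls hc h.admissible]
  simp only
  rw [← map_idxOf_self h.nodup]
  apply multExt_rename c h.closed
  intro i hi j hj hij
  exact (List.idxOf_inj hi).1 hij

theorem extLin_one : extLin c hc 1 = 1 := by
  rw [← cls_one, extLin_cls hc (one_mem _)]
  exact (multExt_nil c _).trans rfl

theorem extLin_mul (x y : GraphAlg n X) :
    extLin c hc (x * y) = extLin c hc x * extLin c hc y := by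
  induction x using cls_induction with
  | h0 => simp
  | hadd a b ha hb => rw [add_mul, map_add, ha, hb, map_add, add_mul]
  | hcls g hg s =>
    induction y using cls_induction with
    | h0 => simp
    | hadd a b ha hb => rw [mul_add, map_add, ha, hb, map_add, mul_add]
    | hcls h hh t =>
      rw [smul_mul_assoc, mul_smul_comm, ← cls_mul hg hh]
      simp only [map_smul]
      rw [extLin_cls hc (mul_mem hg hh), extLin_cls hc hg, extLin_cls hc hh, smul_mul_assoc,
        mul_smul_comm, LGraph.mul_def]
      have hcl : Closed (List.range h.numInt) h.edges := wf_iff_closed.1 (Admissible.wf hh)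
      have hsh : (shift g.numInt : Vtx X → Vtx X) = intMap (g.numInt + ·) := by
        funext v; rcases v with v | v <;> rfl
      -- The shift in the product is an injective renaming of the second factor; it makes the names
      -- disjoint without changing the value.
      rw [← multExt_rename c hcl (ρ := (g.numInt + ·)) (by simp), ← multExt_append hc, hsh,
        List.range_add]
      · exact wf_iff_closed.1 (Admissible.wf hg)
      · have := wf_relabel (shift_inRange (k := g.numInt)) (Admissible.wf hh)
        intro e he i
        obtain ⟨⟨u, w⟩, he', rfl⟩ := List.mem_map.1 he
        have h3 := hcl _ he'
        constructor
        · rcases u with u | u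
          · simp [intMap]
          · have := (h3 u).1 rfl
            simp only [Prod.map, intMap, Sum.inr.injEq]
            rintro rfl
            exact List.mem_map_of_mem this
        · rcases w with w | w
          · simp [intMap]
          · have := (h3 w).2 rfl
            simp only [Prod.map, intMap, Sum.inr.injEq]
            rintro rfl
            exact List.mem_map_of_mem this
      · intro i hi hi'
        obtain ⟨j, -, rfl⟩ := List.mem_map.1 hi'
        have := List.mem_range.1 hi
        omega

theorem extLin_mem {i : ℤ} {x : GraphAlg n X} (hx : x ∈ gr n X i) : extLin c hc x ∈ A.gr i := by
  induction hx using Submodule.span_induction with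
  | zero => simp
  | add x y _ _ hx hy => rw [map_add]; exact add_mem hx hy
  | smul t x _ hx => rw [map_smul]; exact Submodule.smul_mem _ _ hx
  | mem x hx =>
    obtain ⟨g, hg, rfl, rfl⟩ := hx
    rw [extLin_cls hc hg]
    simpa [degree, dg] using multExt_mem hc (List.range g.numInt) g.edges

/-- If the relabelled graph is not admissible, its class is zero by convention, and on the other
side the edge at the base point makes one factor vanish. -/
theorem extLin_push {B : DGCAlg} {c' : GraphAlg n Y →ₗ[ℚ] B}
    (hc' : ∀ i, ∀ x ∈ gr n Y i, c' x ∈ B.gr i) {f : X ⟶ Y} {φ : A ⟶ B}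
    (hφ : ∀ x, φ.toAlgHom (c x) = c' (pushLin n f x)) (x : GraphAlg n X) :
    φ.toAlgHom (extLin c hc x) = extLin c' hc' (pushLin n f x) := by
  induction x using cls_induction with
  | h0 => simp
  | hadd a b ha hb => simp only [map_add, ha, hb]
  | hcls g hg t =>
    simp only [map_smul]
    rw [extLin_cls hc hg, multExt_push hφ (Admissible.named hg), pushLin_cls f hg]
    congr 1
    by_cases hp : pushGraph f.toFun g ∈ AdmGraph Y
    · rw [extLin_cls hc' hp]; rfl
    · rw [cls_of_notMem hp, map_zero]
      rw [pushGraph_mem_iff _ hg] at hp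
      simp only [NoBase, not_forall] at hp
      obtain ⟨e, he, h⟩ := hp
      refine multExt_of_base c' _ (List.mem_map.2 ⟨e, he, rfl⟩) ?_
      simp only [Prod.map]
      tauto

theorem extLin_congr {c' : GraphAlg n X →ₗ[ℚ] A} (hc' : ∀ i, ∀ x ∈ gr n X i, c' x ∈ A.gr i) {N : ℕ}
    (hcc : ∀ g : LGraph X, g.numInt ≤ N → c (cls n X g) = c' (cls n X g)) {g : LGraph X}
    (hg : g.numInt ≤ N) : extLin c hc (cls n X g) = extLin c' hc' (cls n X g) := by
  by_cases h : g ∈ AdmGraph X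
  · rw [extLin_cls hc h, extLin_cls hc' h]
    exact multExt_congr hcc (by simpa using hg) _
  · simp [cls_of_notMem h]

/-- Both `q` and `φ` are multiplicative, and `clsNamed_split` factors a graph with the same signs as
the recursion for `extLin`. So agreement on the factors suffices, and these have at most `N`
internal vertices. -/
theorem map_extLin {B : DGCAlg} (q : A ⟶ B) (φ : graphsObj n X ⟶ B) {N : ℕ}
    (h : ∀ g : LGraph X, g.numInt ≤ N → q.toAlgHom (c (cls n X g)) = φ.toAlgHom (cls n X g))
    {g : LGraph X} (hg : g ∈ AdmGraph X) (hgN : g.numInt ≤ N) :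
    q.toAlgHom (extLin c hc (cls n X g)) = φ.toAlgHom (cls n X g) := by
  have key : ∀ (vs : List ℕ) (es : List (Edge X)), AdmNamed X.point vs es → vs.length ≤ N →
      q.toAlgHom (multExt c vs es) = φ.toAlgHom (clsNamed n X vs es) := by
    intro vs es hadm hvs
    induction hM : vs.length using Nat.strong_induction_on generalizing vs es with
    | _ M ih =>
      rcases vs with _ | ⟨v, vs⟩
      · clear ih
        induction es with
        | nil => rw [clsNamed_nil_nil, multExt_nil]; exact (map_one q.toAlgHom).trans (map_one φ.toAlgHom).symm
        | cons e es ih =>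
          have ih := ih (hadm.sublist_nil fun _ => List.mem_cons_of_mem _)
          rw [multExt_nil] at ih ⊢
          rw [List.map_cons, List.prod_cons, map_mul, ih, clsNamed_nil_cons hadm]
          refine Eq.trans ?_ (map_mul φ.toAlgHom _ _).symm
          congr 1
          exact h _ (Nat.zero_le _)
      · have hS := saturated_comp es v
        have hlt := length_filter_lt (vs := vs) (comp_self es v)
        rw [multExt_cons c rfl, clsNamed_split hadm hS, map_smul, map_mul,
          ih _ (hM ▸ hlt) _ _ (hadm.filter_not_touch hS) (hlt.le.trans hvs) rfl]
        refine Eq.trans ?_ (map_smul φ.toAlgHom _ _).symm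
        congr 1
        refine Eq.trans ?_ (map_mul φ.toAlgHom _ _).symm
        congr 1
        exact h _ ((List.length_filter_le _ _).trans hvs)
  rw [extLin_cls hc hg, key _ _ (Admissible.named hg) (by simpa using hgN),
    clsNamed_range (Admissible.wf hg)]

/-- Both sides are derivations along `extLin c hc`, so they can be compared on single edges and
internally connected graphs. The hypothesis needs `extLin` and not just `c` on its right side,
because contracting an edge to an external vertex can disconnect a graph internally. -/
theorem d_extLin {N : ℕ}
    (h : ∀ g : LGraph X, g.numInt ≤ N →
      A.d (c (cls n X g)) = extLin c hc (differential n X (cls n X g)))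
    {g : LGraph X} (hg : g ∈ AdmGraph X) (hgN : g.numInt ≤ N) :
    A.d (extLin c hc (cls n X g)) = extLin c hc (differential n X (cls n X g)) := by
  have key : ∀ (vs : List ℕ) (es : List (Edge X)), AdmNamed X.point vs es → vs.length ≤ N →
      A.d (multExt c vs es) = extLin c hc (differential n X (clsNamed n X vs es)) := by
    intro vs es hadm hvs
    induction hM : vs.length using Nat.strong_induction_on generalizing vs es with
    | _ M ih =>
      rcases vs with _ | ⟨v, vs⟩
      · clear ih
        induction es with
        | nil =>
          rw [clsNamed_nil_nil, multExt_nil]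
          have h1 : differential n X 1 = 0 := (graphsObj n X).d_one
          rw [h1, map_zero]
          simpa using A.d_one
        | cons e es ih =>
          have hadm' := hadm.sublist_nil (es' := es) fun _ => List.mem_cons_of_mem _
          have hadm1 := hadm.sublist_nil (es' := [e]) (by simp)
          have ih := ih hadm'
          have h1 : multExt c [] (e :: es) = c (clsNamed n X [] [e]) * multExt c [] es := by
            rw [multExt_nil, multExt_nil, List.map_cons, List.prod_cons]
          have h2 : c (clsNamed n X [] [e]) = extLin c hc (clsNamed n X [] [e]) := by
            rw [extLin_clsNamed hc hadm1, multExt_nil]; simp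
          have hm := clsNamed_mem_gr (n := n) ([] : List ℕ) [e]
          rw [h1, clsNamed_nil_cons hadm, A.leibniz (hc _ _ hm), ih, differential_leibniz hm,
            map_add, map_smul, extLin_mul, extLin_mul, ← h2, extLin_clsNamed hc hadm']
          congr 2
          exact h _ (Nat.zero_le _)
      · have hS := saturated_comp es v
        have hlt := length_filter_lt (vs := vs) (comp_self es v)
        have hr := hadm.filter_not_touch hS
        have hm := clsNamed_mem_gr (n := n) ((v :: vs).filter (comp es v))
          (es.filter (touch (comp es v)))
        have h2 := extLin_clsNamed hc (hadm.filter_touch hS)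
        rw [multExt_component] at h2
        rw [multExt_cons c rfl, clsNamed_split hadm hS, map_smul, map_smul, map_smul,
          A.leibniz (hc _ _ hm), differential_leibniz hm,
          ih _ (hM ▸ hlt) _ _ hr (hlt.le.trans hvs) rfl, map_add, map_smul, extLin_mul, extLin_mul,
          h2, extLin_clsNamed hc hr]
        congr 3
        exact h _ ((List.length_filter_le _ _).trans hvs)
  rw [extLin_cls hc hg, key _ _ (Admissible.named hg) (by simpa using hgN),
    clsNamed_range (Admissible.wf hg)]

/-- The differential lowers the number of internal vertices. -/
theorem differential_cls_mem {g : LGraph X} (hg : g ∈ AdmGraph X) :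
    differential n X (cls n X g) ∈
      Submodule.span ℚ {x | ∃ g' ∈ AdmGraph X, g'.numInt < g.numInt ∧ x = cls n X g'} := by
  rw [differential_cls hg]
  apply pickSum_mem
  intro e r hp
  refine contract_rec (n := n) (admissible_perm hp.symm hg) (Submodule.zero_mem _) ?_
  intro t v b hb hm
  have hb' : b < g.numInt := hb
  exact Submodule.smul_mem _ _ (Submodule.subset_span ⟨_, hm, Nat.sub_lt (Nat.zero_lt_of_lt hb') one_pos, rfl⟩)

end

noncomputable section

/-! ### Symmetrization -/

section Symmetrization

variable {n m k : ℕ} {X Y : Type}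

/-- Reverse an edge if the Boolean is true. -/
def flipIf (b : Bool) (e : Edge X) : Edge X := if b then e.swap else e

theorem flipIf_flipIf (b b' : Bool) (e : Edge X) : flipIf b (flipIf b' e) = flipIf (b ^^ b') e := by
  cases b <;> cases b' <;> simp [flipIf]

theorem flipIf_map (b : Bool) (f : Vtx X → Vtx Y) (e : Edge X) :
    flipIf b (Prod.map f f e) = Prod.map f f (flipIf b e) := by
  cases b <;> rfl

/-- Extend a permutation of `0, …, k - 1` by the identity. -/
def permNat (τ : Equiv.Perm (Fin k)) (i : ℕ) : ℕ := if h : i < k then τ ⟨i, h⟩ else i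

theorem permNat_mul (τ ρ : Equiv.Perm (Fin k)) (i : ℕ) :
    permNat (τ * ρ) i = permNat τ (permNat ρ i) := by
  by_cases h : i < k <;> simp [permNat, h]

/-- Renumber the internal vertices. -/
abbrev vperm (τ : Equiv.Perm (Fin k)) : Vtx X → Vtx X := intMap (permNat τ)

theorem vperm_mul (τ ρ : Equiv.Perm (Fin k)) (v : Vtx X) :
    vperm (τ * ρ) v = vperm τ (vperm ρ v) := by
  rcases v with v | v
  · rfl
  · simp [intMap, permNat_mul]

theorem vperm_one (v : Vtx X) : vperm (1 : Equiv.Perm (Fin k)) v = v := by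
  rcases v with v | v
  · rfl
  · by_cases h : v < k <;> simp [intMap, permNat, h]

theorem vperm_swap (i : Fin k) :
    (vperm (Equiv.swap i.castSucc i.succ) : Vtx X → Vtx X) = vswap i := by
  funext v
  rcases v with v | v
  · rfl
  · simp only [intMap, vswap, permNat, Equiv.swap_apply_def, Sum.inr.injEq]
    split_ifs with h1 h2 h3 h4 h5 <;> simp_all [Fin.ext_iff]

theorem extMap_vperm (f : X → Y) (τ : Equiv.Perm (Fin k)) (v : Vtx X) :
    extMap f (vperm τ v) = vperm τ (extMap f v) := by
  rcases v with v | v <;> rfl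

/-- Permute and reverse the edges and renumber the internal vertices of a graph. -/
def act (π : Equiv.Perm (Fin m)) (ε : Fin m → Bool) (τ : Equiv.Perm (Fin k)) (u : Fin m → Edge X) :
    Fin m → Edge X := fun j => Prod.map (vperm τ) (vperm τ) (flipIf (ε j) (u (π j)))

/-- The sign of a permutation of the edges. -/
def signE (n : ℕ) (π : Equiv.Perm (Fin m)) : ℚ := ((Equiv.Perm.sign π : ℤ) : ℚ) ^ (n + 1)

/-- The sign of a permutation of the internal vertices. -/
def signV (n : ℕ) (τ : Equiv.Perm (Fin k)) : ℚ := ((Equiv.Perm.sign τ : ℤ) : ℚ) ^ n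

/-- The sign of a reversal of edges. -/
def signF (n : ℕ) (ε : Fin m → Bool) : ℚ := ∏ j, if ε j then sgnV n else 1

theorem signE_mul (π σ : Equiv.Perm (Fin m)) : signE n (π * σ) = signE n π * signE n σ := by
  simp [signE, mul_pow]

theorem signE_one : signE n (1 : Equiv.Perm (Fin m)) = 1 := by simp [signE]

theorem signE_swap {i j : Fin m} (h : i ≠ j) : signE n (Equiv.swap i j) = sgnE n := by
  simp [signE, Equiv.Perm.sign_swap h]

theorem signE_mul_self (π : Equiv.Perm (Fin m)) : signE n π * signE n π = 1 := by
  rw [signE, ← mul_pow, ← Int.cast_mul, Int.units_coe_mul_self]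
  simp

theorem signV_mul (π σ : Equiv.Perm (Fin k)) : signV n (π * σ) = signV n π * signV n σ := by
  simp [signV, mul_pow]

theorem signV_one : signV n (1 : Equiv.Perm (Fin k)) = 1 := by simp [signV]

theorem signV_swap {i j : Fin k} (h : i ≠ j) : signV n (Equiv.swap i j) = sgnV n := by
  simp [signV, Equiv.Perm.sign_swap h]

theorem signV_mul_self (π : Equiv.Perm (Fin k)) : signV n π * signV n π = 1 := by
  rw [signV, ← mul_pow, ← Int.cast_mul, Int.units_coe_mul_self]
  simp

theorem signF_xor (ε δ : Fin m → Bool) :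
    signF n (fun j => ε j ^^ δ j) = signF n ε * signF n δ := by
  rw [signF, signF, signF, ← Finset.prod_mul_distrib]
  refine Finset.prod_congr rfl fun j _ => ?_
  cases ε j <;> cases δ j <;> simp [← pow_add]

theorem signF_comp (ε : Fin m → Bool) (π : Equiv.Perm (Fin m)) :
    signF n (fun j => ε (π j)) = signF n ε :=
  Equiv.prod_comp π fun j => if ε j then sgnV n else 1

theorem signF_mul_self (ε : Fin m → Bool) : signF n ε * signF n ε = 1 := by
  rw [← signF_xor]
  simp [signF]

variable {M : Type*} [AddCommGroup M] [Module ℚ M]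

/-- The signed average of a function of graphs over all orderings and directions. -/
def symmetrize (n : ℕ) {m : ℕ} (k : ℕ) (θ : (Fin m → Edge X) → M) (u : Fin m → Edge X) : M :=
  (Fintype.card (Equiv.Perm (Fin m) × (Fin m → Bool) × Equiv.Perm (Fin k)) : ℚ)⁻¹ •
    ∑ x : Equiv.Perm (Fin m) × (Fin m → Bool) × Equiv.Perm (Fin k),
      (signE n x.1 * signF n x.2.1 * signV n x.2.2) • θ (act x.1 x.2.1 x.2.2 u)

/-- A renumbering of the graph merely permutes the summands of the average; what is left of it is
its sign. -/
theorem symmetrize_of_equiv (θ : (Fin m → Edge X) → M) {u u' : Fin m → Edge X} {s : ℚ}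
    (E : Equiv.Perm (Equiv.Perm (Fin m) × (Fin m → Bool) × Equiv.Perm (Fin k)))
    (hs : ∀ x, signE n x.1 * signF n x.2.1 * signV n x.2.2
      = s * (signE n (E x).1 * signF n (E x).2.1 * signV n (E x).2.2))
    (hu : ∀ x, act x.1 x.2.1 x.2.2 u' = act (E x).1 (E x).2.1 (E x).2.2 u) :
    symmetrize n k θ u' = s • symmetrize n k θ u := by
  rw [symmetrize, symmetrize, smul_comm s]
  congr 1
  rw [Finset.smul_sum]
  refine Eq.trans ?_ (Equiv.sum_comp E _)
  refine Finset.sum_congr rfl fun x _ => ?_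
  rw [smul_smul, hs, hu]

theorem symmetrize_perm (θ : (Fin m → Edge X) → M) (u : Fin m → Edge X) (σ : Equiv.Perm (Fin m)) :
    symmetrize n k θ (u ∘ σ) = signE n σ • symmetrize n k θ u := by
  refine symmetrize_of_equiv θ ((Equiv.mulLeft σ).prodCongr (Equiv.refl _)) ?_ fun x => rfl
  rintro ⟨π, ε, τ⟩
  simp only [Equiv.prodCongr_apply, Prod.map, Equiv.coe_mulLeft, Equiv.refl_apply, signE_mul]
  linear_combination (-(signE n π * signF n ε * signV n τ)) * signE_mul_self (n := n) σ

theorem symmetrize_vperm (θ : (Fin m → Edge X) → M) (u : Fin m → Edge X)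
    (ρ : Equiv.Perm (Fin k)) :
    symmetrize n k θ (fun j => Prod.map (vperm ρ) (vperm ρ) (u j))
      = signV n ρ • symmetrize n k θ u := by
  refine symmetrize_of_equiv θ
    ((Equiv.refl _).prodCongr ((Equiv.refl _).prodCongr (Equiv.mulRight ρ))) ?_ ?_
  · rintro ⟨π, ε, τ⟩
    simp only [Equiv.prodCongr_apply, Prod.map, Equiv.coe_mulRight, Equiv.refl_apply, signV_mul]
    linear_combination (-(signE n π * signF n ε * signV n τ)) * signV_mul_self (n := n) ρ
  · rintro ⟨π, ε, τ⟩
    funext j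
    simp only [act, Equiv.prodCongr_apply, Prod.map_apply, Equiv.coe_mulRight, Equiv.refl_apply,
      flipIf_map]
    rw [Prod.map_map]
    congr 1
    · funext v; exact (vperm_mul τ ρ v).symm
    · funext v; exact (vperm_mul τ ρ v).symm

/-- Add to `ε` the translate of `δ` by the permutation. -/
def xorEquiv (k : ℕ) (δ : Fin m → Bool) :
    Equiv.Perm (Equiv.Perm (Fin m) × (Fin m → Bool) × Equiv.Perm (Fin k)) where
  toFun x := (x.1, fun j => x.2.1 j ^^ δ (x.1 j), x.2.2)
  invFun x := (x.1, fun j => x.2.1 j ^^ δ (x.1 j), x.2.2)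
  left_inv x := by ext <;> simp
  right_inv x := by ext <;> simp

theorem symmetrize_flip (θ : (Fin m → Edge X) → M) (u : Fin m → Edge X) (δ : Fin m → Bool) :
    symmetrize n k θ (fun j => flipIf (δ j) (u j)) = signF n δ • symmetrize n k θ u := by
  -- In `act` the reversals are indexed after the permutation `π`, so `δ` enters as `δ ∘ π`, which
  -- has the same total sign.
  refine symmetrize_of_equiv θ (xorEquiv k δ) ?_ ?_
  · rintro ⟨π, ε, τ⟩
    simp only [xorEquiv, Equiv.coe_fn_mk, signF_xor, signF_comp]
    linear_combination (-(signE n π * signF n ε * signV n τ)) * signF_mul_self (n := n) δ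
  · rintro ⟨π, ε, τ⟩
    funext j
    simp only [act, xorEquiv, Equiv.coe_fn_mk, flipIf_flipIf]

/-- On an orbit where `θ` is already equivariant every sign occurs squared, so the average returns
the common value. This is where the order of the group has to be invertible. -/
theorem symmetrize_of_act (θ : (Fin m → Edge X) → M) (u : Fin m → Edge X) {a : M}
    (h : ∀ π ε, ∀ τ : Equiv.Perm (Fin k),
      θ (act π ε τ u) = (signE n π * signF n ε * signV n τ) • a) :
    symmetrize n k θ u = a := by
  rw [symmetrize]
  have : ∀ x : Equiv.Perm (Fin m) × (Fin m → Bool) × Equiv.Perm (Fin k),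
      (signE n x.1 * signF n x.2.1 * signV n x.2.2) • θ (act x.1 x.2.1 x.2.2 u) = a := by
    rintro ⟨π, ε, τ⟩
    rw [h, smul_smul]
    have h1 := signE_mul_self (n := n) π
    have h2 := signF_mul_self (n := n) ε
    have h3 := signV_mul_self (n := n) τ
    rw [show signE n π * signF n ε * signV n τ * (signE n π * signF n ε * signV n τ)
      = (signE n π * signE n π) * (signF n ε * signF n ε) * (signV n τ * signV n τ) by ring,
      h1, h2, h3]
    simp
  rw [Finset.sum_congr rfl fun x _ => this x, Finset.sum_const, Finset.card_univ,
    ← Nat.cast_smul_eq_nsmul ℚ, smul_smul, inv_mul_cancel₀, one_smul]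
  exact_mod_cast Fintype.card_ne_zero

theorem map_symmetrize {N : Type*} [AddCommGroup N] [Module ℚ N] (φ : M →ₗ[ℚ] N)
    (θ : (Fin m → Edge X) → M) (u : Fin m → Edge X) :
    φ (symmetrize n k θ u) = symmetrize n k (fun u => φ (θ u)) u := by
  simp [symmetrize, map_sum]

theorem symmetrize_congr {N : Type*} [AddCommGroup N] [Module ℚ N] {θ : (Fin m → Edge X) → N}
    {θ' : (Fin m → Edge Y) → N} {u : Fin m → Edge X} {u' : Fin m → Edge Y}
    (h : ∀ π ε, ∀ τ : Equiv.Perm (Fin k), θ (act π ε τ u) = θ' (act π ε τ u')) :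
    symmetrize n k θ u = symmetrize n k θ' u' := by
  simp [symmetrize, h]

theorem symmetrize_mem (θ : (Fin m → Edge X) → M) (u : Fin m → Edge X) (N : Submodule ℚ M)
    (h : ∀ π ε, ∀ τ : Equiv.Perm (Fin k), θ (act π ε τ u) ∈ N) : symmetrize n k θ u ∈ N :=
  N.smul_mem _ (N.sum_mem fun _ _ => N.smul_mem _ (h _ _ _))

theorem act_extMap (f : X → Y) (π : Equiv.Perm (Fin m)) (ε : Fin m → Bool)
    (τ : Equiv.Perm (Fin k)) (u : Fin m → Edge X) :
    act π ε τ (fun j => Prod.map (extMap f) (extMap f) (u j))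
      = fun j => Prod.map (extMap f) (extMap f) (act π ε τ u j) := by
  funext j
  simp only [act, flipIf_map]
  rw [Prod.map_map, Prod.map_map]
  congr 1 <;> exact (funext (extMap_vperm f τ)).symm

/-- Elementary changes are phrased with lists and averages with functions on `Fin m`; this
translates from lists to functions, and `ofFn_swap` goes back. -/
theorem exists_ofFn_swap {α : Type*} (P Q : List α) (a b : α) :
    ∃ (m : ℕ) (u : Fin m → α) (i j : Fin m), i ≠ j ∧ P ++ a :: b :: Q = List.ofFn u ∧
      P ++ b :: a :: Q = List.ofFn (u ∘ Equiv.swap i j) := by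
  induction P with
  | nil =>
    refine ⟨Q.length + 2, Fin.cons a (Fin.cons b Q.get), 0, 1, by simp, ?_, ?_⟩
    · simp [List.ofFn_succ]
    · have h2 : ∀ j : Fin Q.length, Equiv.swap (0 : Fin (Q.length + 2)) 1 j.succ.succ = j.succ.succ :=
        fun j => Equiv.swap_apply_of_ne_of_ne (by simp [Fin.ext_iff]) (by simp [Fin.ext_iff])
      have h3 : Equiv.swap (0 : Fin (Q.length + 2)) 1 (Fin.succ 0) = 0 := Equiv.swap_apply_right _ _
      have h4 : (1 : Fin (Q.length + 2)) = Fin.succ 0 := rfl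
      simp only [List.ofFn_succ, Function.comp_apply, h2, h3, Equiv.swap_apply_left, Fin.cons_zero,
        Fin.cons_succ, List.nil_append, List.get_eq_getElem, List.ofFn_getElem]
      rw [h4]
      simp
  | cons p P ih =>
    obtain ⟨m, u, i, j, hij, h1, h2⟩ := ih
    refine ⟨m + 1, Fin.cons p u, i.succ, j.succ, by simpa using hij, ?_, ?_⟩
    · simp [List.ofFn_succ, h1]
    · have h3 : Equiv.swap i.succ j.succ 0 = 0 :=
        Equiv.swap_apply_of_ne_of_ne (Fin.succ_ne_zero i).symm (Fin.succ_ne_zero j).symm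
      have h4 : ∀ l : Fin m, Equiv.swap i.succ j.succ l.succ = (Equiv.swap i j l).succ := by
        intro l
        rw [Equiv.swap_apply_def, Equiv.swap_apply_def]
        simp only [Fin.succ_inj]
        split_ifs <;> rfl
      simp [List.ofFn_succ, h2, h3, h4, Function.comp_def]

theorem exists_ofFn_flip (P Q : List (Edge X)) (v w : Vtx X) :
    ∃ (m : ℕ) (u : Fin m → Edge X) (δ : Fin m → Bool), (∀ n, signF n δ = sgnV n) ∧
      P ++ (v, w) :: Q = List.ofFn u ∧ P ++ (w, v) :: Q = List.ofFn fun j => flipIf (δ j) (u j) := by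
  induction P with
  | nil =>
    refine ⟨Q.length + 1, Fin.cons (v, w) Q.get, Fin.cons true fun _ => false, ?_, ?_, ?_⟩
    · intro n; simp [signF, Fin.prod_univ_succ]
    · simp [List.ofFn_succ]
    · simp [List.ofFn_succ, flipIf]
  | cons p P ih =>
    obtain ⟨m, u, δ, h0, h1, h2⟩ := ih
    refine ⟨m + 1, Fin.cons p u, Fin.cons false δ, ?_, ?_, ?_⟩
    · intro n
      rw [← h0 n]
      simp [signF, Fin.prod_univ_succ]
    · simp [List.ofFn_succ, h1]
    · simp [List.ofFn_succ, h2, flipIf]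

theorem ofFn_swap {α : Type*} (u : Fin (m + 1) → α) (i : Fin m) :
    ∃ P a b Q, List.ofFn u = P ++ a :: b :: Q ∧
      List.ofFn (u ∘ Equiv.swap i.castSucc i.succ) = P ++ b :: a :: Q := by
  induction m with
  | zero => exact i.elim0
  | succ m ih =>
    refine Fin.cases ?_ (fun i => ?_) i
    · refine ⟨[], u 0, u 1, List.ofFn fun j : Fin m => u j.succ.succ, ?_, ?_⟩
      · simp [List.ofFn_succ]
      · have h2 : ∀ j : Fin m, Equiv.swap (0 : Fin (m + 2)) 1 j.succ.succ = j.succ.succ :=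
          fun j => Equiv.swap_apply_of_ne_of_ne (by simp [Fin.ext_iff]) (by simp [Fin.ext_iff])
        simp [List.ofFn_succ, h2]
    · obtain ⟨P, a, b, Q, h1, h2⟩ := ih (fun j => u j.succ) i
      refine ⟨u 0 :: P, a, b, Q, ?_, ?_⟩
      · rw [List.ofFn_succ, h1]; rfl
      · have h3 : Equiv.swap i.succ.castSucc i.succ.succ 0 = 0 :=
          Equiv.swap_apply_of_ne_of_ne (by simp [Fin.ext_iff]) (by simp [Fin.ext_iff])
        have h4 : ∀ l : Fin (m + 1), Equiv.swap i.succ.castSucc i.succ.succ l.succ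
            = (Equiv.swap i.castSucc i.succ l).succ := by
          intro l
          rw [Equiv.swap_apply_def, Equiv.swap_apply_def, ← Fin.succ_castSucc]
          simp only [Fin.succ_inj]
          split_ifs <;> rfl
        rw [List.ofFn_succ]
        simp only [Function.comp_apply, h3, h4]
        rw [List.cons_append, ← h2]
        rfl

end Symmetrization

/-! ### Arbitrary renumberings as sequences of elementary changes -/

section SymmetrizeClass

variable {n m k : ℕ} {X : Pointed.{0}}

/-- Sequences of elementary changes of the numbering and directions, with the product of the signs. -/
inductive Steps (n : ℕ) {X : Type} : LGraph X → ℚ → LGraph X → Prop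
  | refl (g : LGraph X) : Steps n g 1 g
  | head {g g' g'' : LGraph X} {c c' : ℚ} : Step n g c g' → Steps n g' c' g'' → Steps n g (c * c') g''

theorem Steps.single {X : Type} {g g' : LGraph X} {c : ℚ} (h : Step n g c g') : Steps n g c g' := by
  simpa using Steps.head h (.refl _)

theorem Steps.trans {X : Type} {g g' g'' : LGraph X} {c c' : ℚ} (h : Steps n g c g')
    (h' : Steps n g' c' g'') : Steps n g (c * c') g'' := by
  induction h with
  | refl g => simpa using h'
  | head h1 _ ih => rw [mul_assoc]; exact .head h1 (ih h')

theorem Steps.cls_eq {g g' : LGraph X} {c : ℚ} (h : Steps n g c g') :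
    cls n X g = c • cls n X g' := by
  induction h with
  | refl g => simp
  | head h1 _ ih => rw [cls_step h1, ih, smul_smul]

theorem Steps.mem_iff {g g' : LGraph X} {c : ℚ} (h : Steps n g c g') :
    g ∈ AdmGraph X ↔ g' ∈ AdmGraph X := by
  induction h with
  | refl g => rfl
  | head h1 _ ih => exact Iff.trans ⟨h1.admissible, h1.symm.admissible⟩ ih

theorem Steps.push {X Y : Type} (f : X → Y) {g g' : LGraph X} {c : ℚ} (h : Steps n g c g') :
    Steps n (pushGraph f g) c (pushGraph f g') := by
  induction h with
  | refl g => exact .refl _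
  | head h1 _ ih => exact .head (h1.push f) ih

/-- Adjacent transpositions generate the symmetric group as a monoid, and each of them is a single
`Step`. -/
theorem steps_perm (u : Fin m → Edge X) (π : Equiv.Perm (Fin m)) :
    Steps n ⟨k, List.ofFn (u ∘ π)⟩ (signE n π) ⟨k, List.ofFn u⟩ := by
  rcases m with _ | m
  · rw [Subsingleton.elim π 1, signE_one]
    exact .refl _
  · have hπ : π ∈ Submonoid.closure (Set.range fun i : Fin m => Equiv.swap i.castSucc i.succ) := by
      rw [Equiv.Perm.mclosure_swap_castSucc_succ]; trivial
    induction hπ using Submonoid.closure_induction generalizing u with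
    | mem σ hσ =>
      obtain ⟨i, rfl⟩ := hσ
      obtain ⟨P, a, b, Q, h1, h2⟩ := ofFn_swap u i
      simp only
      rw [h1, h2, signE_swap (by simp [Fin.ext_iff])]
      exact .single (.swapEdges _ _ _ _ _)
    | one => rw [signE_one]; exact .refl _
    | mul σ ρ _ _ h1 h2 =>
      rw [signE_mul, mul_comm]
      exact (h2 (u ∘ σ)).trans (h1 u)

theorem steps_flip (u : Fin m → Edge X) (ε : Fin m → Bool) :
    Steps n ⟨k, List.ofFn fun j => flipIf (ε j) (u j)⟩ (signF n ε) ⟨k, List.ofFn u⟩ := by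
  -- The prefix `P` makes room for the head edge while the tail is treated by induction.
  have : ∀ P, Steps n ⟨k, P ++ List.ofFn fun j => flipIf (ε j) (u j)⟩ (signF n ε)
      ⟨k, P ++ List.ofFn u⟩ := by
    induction m with
    | zero => intro P; simpa [signF] using Steps.refl _
    | succ m ih =>
      intro P
      have h1 := ih (fun j => u j.succ) (fun j => ε j.succ) (P ++ [flipIf (ε 0) (u 0)])
      simp only [List.append_assoc, List.cons_append, List.nil_append] at h1
      have h2 : signF n ε = (signF n fun j => ε j.succ) * (if ε 0 then sgnV n else 1) := by
        simp [signF, Fin.prod_univ_succ, mul_comm]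
      rw [List.ofFn_succ, List.ofFn_succ, h2]
      refine h1.trans ?_
      cases ε 0
      · exact .refl _
      · simp only [flipIf, if_true]
        exact .single (.flipEdge _ _ _ _ _)
  simpa using this []

theorem steps_vperm (l : List (Edge X)) (τ : Equiv.Perm (Fin k)) :
    Steps n ⟨k, relabel (vperm τ) l⟩ (signV n τ) ⟨k, l⟩ := by
  have h1 : ∀ l : List (Edge X), relabel (vperm (1 : Equiv.Perm (Fin k))) l = l := by
    intro l
    have : (vperm (1 : Equiv.Perm (Fin k)) : Vtx X → Vtx X) = id := funext vperm_one
    simp [relabel, this]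
  rcases k with _ | k
  · rw [Subsingleton.elim τ 1, signV_one, h1]
    exact .refl _
  · have hτ : τ ∈ Submonoid.closure (Set.range fun i : Fin k => Equiv.swap i.castSucc i.succ) := by
      rw [Equiv.Perm.mclosure_swap_castSucc_succ]; trivial
    induction hτ using Submonoid.closure_induction generalizing l with
    | mem σ hσ =>
      obtain ⟨i, rfl⟩ := hσ
      simp only
      rw [vperm_swap, signV_swap (by simp [Fin.ext_iff])]
      exact .single (Step.swapVertices _ _ (by omega) _).symm
    | one => rw [signV_one, h1]; exact .refl _
    | mul σ ρ _ _ h1 h2 =>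
      have : relabel (vperm (σ * ρ)) l = relabel (vperm σ) (relabel (vperm ρ) l) := by
        rw [relabel_relabel]
        exact congrArg (relabel · l) (funext (vperm_mul σ ρ))
      rw [this, signV_mul]
      exact (h1 _).trans (h2 l)

theorem steps_act (u : Fin m → Edge X) (π : Equiv.Perm (Fin m)) (ε : Fin m → Bool)
    (τ : Equiv.Perm (Fin k)) :
    Steps n ⟨k, List.ofFn (act π ε τ u)⟩ (signE n π * signF n ε * signV n τ)
      ⟨k, List.ofFn u⟩ := by
  have h1 : List.ofFn (act π ε τ u)
      = relabel (vperm τ) (List.ofFn fun j => flipIf (ε j) ((u ∘ π) j)) := by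
    rw [relabel, List.map_ofFn]; rfl
  rw [h1, mul_comm, mul_comm (signE n π)]
  exact (steps_vperm _ τ).trans ((steps_flip _ ε).trans (steps_perm u π))

end SymmetrizeClass

end

noncomputable section

/-! ### The linear diagram of graphs is projective -/

section Explode

variable {n m k : ℕ} {X Y : Type}

/-- Replace an external end point by the half-edge `h`. -/
def explodeVtx (h : Fin m × Bool) : Vtx X → Vtx (Option (Fin m × Bool))
  | .inl _ => .inl (some h)
  | .inr i => .inr i

/-- The graph obtained by separating all half-edges at the external vertices. -/
def explode (u : Fin m → Edge X) : Fin m → Edge (Option (Fin m × Bool)) :=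
  fun j => (explodeVtx (j, false) (u j).1, explodeVtx (j, true) (u j).2)

/-- The external vertex, or the base point for an internal vertex. -/
def extPart (pt : X) : Vtx X → X
  | .inl x => x
  | .inr _ => pt

/-- The external vertex to which a half-edge is incident. -/
def label (pt : X) (u : Fin m → Edge X) : Option (Fin m × Bool) → X
  | none => pt
  | some (j, false) => extPart pt (u j).1
  | some (j, true) => extPart pt (u j).2

/-- Every graph is the image of its exploded graph under the incidence map. Half-edges at internal
vertices are labelled by the base point, which is harmless because no edge of the exploded graph
ends at them. -/
theorem label_explode (pt : X) (u : Fin m → Edge X) (j : Fin m) :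
    Prod.map (extMap (label pt u)) (extMap (label pt u)) (explode u j) = u j := by
  have h1 : extMap (label pt u) (explodeVtx (j, false) (u j).1) = (u j).1 := by
    cases h : (u j).1 <;> simp [explodeVtx, extMap, label, extPart, h]
  have h2 : extMap (label pt u) (explodeVtx (j, true) (u j).2) = (u j).2 := by
    cases h : (u j).2 <;> simp [explodeVtx, extMap, label, extPart, h]
  exact Prod.ext h1 h2

theorem relabel_label_explode (pt : X) (u : Fin m → Edge X) :
    relabel (extMap (label pt u)) (List.ofFn (explode u)) = List.ofFn u := by
  rw [relabel, List.map_ofFn]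
  exact congrArg List.ofFn (funext (label_explode pt u))

theorem explodeVtx_extMap (f : X → Y) (h : Fin m × Bool) (v : Vtx X) :
    explodeVtx h (extMap f v) = explodeVtx h v := by
  rcases v with v | v <;> rfl

/-- The exploded graph forgets the external vertices, so a graph and all its images share it. Values
chosen on exploded graphs thus extend naturally. -/
theorem explode_extMap (f : X → Y) (u : Fin m → Edge X) :
    explode (fun j => Prod.map (extMap f) (extMap f) (u j)) = explode u := by
  funext j
  simp [explode, explodeVtx_extMap]

theorem label_extMap {pt : X} {pt' : Y} {f : X → Y} (hf : f pt = pt') (u : Fin m → Edge X)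
    (x : Option (Fin m × Bool)) :
    label pt' (fun j => Prod.map (extMap f) (extMap f) (u j)) x = f (label pt u x) := by
  have h : ∀ v : Vtx X, extPart pt' (extMap f v) = f (extPart pt v) := by
    rintro (v | v)
    · rfl
    · exact hf.symm
  rcases x with _ | ⟨j, _ | _⟩
  · exact hf.symm
  · exact h _
  · exact h _

/-- Valences of internal vertices are unchanged. A path to an external vertex may pass through
others that the explosion cuts apart, but its part up to the first external vertex survives. -/
theorem admissible_explode {pt : X} {u : Fin m → Edge X} (h : Admissible pt k (List.ofFn u)) :
    Admissible none k (List.ofFn (explode u)) := by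
  have hr : ∀ (x : Fin m × Bool) (v : Vtx X), InRange k v → InRange k (explodeVtx x v) := by
    rintro x (v | v) hv
    · trivial
    · exact hv
  have hb : ∀ (x : Fin m × Bool) (v : Vtx X), explodeVtx x v ≠ .inl none := by
    rintro x (v | v) <;> simp [explodeVtx]
  have hh : ∀ (i : ℕ) (x : Fin m × Bool) (v : Vtx X), hit i (explodeVtx x v) = hit i v := by
    rintro i x (v | v) <;> rfl
  refine ⟨?_, ?_, ?_, ?_⟩
  · intro e he
    obtain ⟨j, rfl⟩ := List.mem_ofFn.1 he
    have := h.inRange (u j) (List.mem_ofFn.2 ⟨j, rfl⟩)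
    exact ⟨hr _ _ this.1, hr _ _ this.2⟩
  · intro e he
    obtain ⟨j, rfl⟩ := List.mem_ofFn.1 he
    exact ⟨hb _ _, hb _ _⟩
  · intro i hi
    have := h.trivalent i hi
    simpa [valence, List.map_ofFn, Function.comp_def, explode, hh] using this
  · intro i hi
    obtain ⟨x, hx⟩ := h.connected i hi
    -- External vertices satisfy this vacuously, so it is constant along paths of the original graph
    -- although the explosion breaks them.
    let good : Vtx X → Prop := fun v =>
      ∀ i, v = .inr i → ∃ y, Joined (List.ofFn (explode u)) (.inr i) (.inl y)
    have all : ∀ v w, Joined (List.ofFn u) v w → (good v ↔ good w) := by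
      intro v w hvw
      induction hvw with
      | refl v => rfl
      | symm v w _ ih => exact ih.symm
      | trans u v w _ _ ih1 ih2 => exact ih1.trans ih2
      | rel v w hvw =>
        obtain ⟨j, hj⟩ := List.mem_ofFn.1 hvw
        have he : (explodeVtx (j, false) v, explodeVtx (j, true) w) ∈ List.ofFn (explode u) :=
          List.mem_ofFn.2 ⟨j, by simp [explode, hj]⟩
        have hj1 : Joined (List.ofFn (explode u)) _ _ := .rel _ _ he
        rcases v with v | v <;> rcases w with w | w
        · simp [good]
        · refine ⟨fun _ i hi => ?_, fun _ i hi => by simp at hi⟩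
          obtain rfl : w = i := by simpa using hi
          exact ⟨_, .symm _ _ hj1⟩
        · refine ⟨fun _ i hi => by simp at hi, fun _ i hi => ?_⟩
          obtain rfl : v = i := by simpa using hi
          exact ⟨_, hj1⟩
        · refine ⟨fun hv i hi => ?_, fun hw i hi => ?_⟩
          · obtain rfl : w = i := by simpa using hi
            obtain ⟨y, hy⟩ := hv v rfl
            exact ⟨y, .trans _ _ _ (.symm _ _ hj1) hy⟩
          · obtain rfl : v = i := by simpa using hi
            obtain ⟨y, hy⟩ := hw w rfl
            exact ⟨y, .trans _ _ _ hj1 hy⟩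
    exact (all _ _ hx).2 (fun i hi => by simp at hi) i rfl

end Explode

/-- The pointed set of half-edges. -/
def halfEdges (m : ℕ) : Gamma :=
  ⟨⟨Option (Fin m × Bool), none⟩, inferInstanceAs (Finite (Option (Fin m × Bool)))⟩

/-- The incidence map of a graph. -/
def labelHom {m : ℕ} (T : Gamma) (u : Fin m → Edge T.obj) : halfEdges m ⟶ T :=
  ObjectProperty.homMk ⟨label T.obj.point u, rfl⟩

/-- Send a half-edge to the base point. -/
def kill {m : ℕ} (h : Fin m × Bool) (x : Option (Fin m × Bool)) : Option (Fin m × Bool) :=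
  if x = some h then none else x

theorem kill_kill {m : ℕ} (h : Fin m × Bool) (x : Option (Fin m × Bool)) :
    kill h (kill h x) = kill h x := by
  unfold kill; split_ifs <;> rfl

theorem kill_comm {m : ℕ} (h h' : Fin m × Bool) (x : Option (Fin m × Bool)) :
    kill h' (kill h x) = kill h (kill h' x) := by
  unfold kill; split_ifs <;> simp_all

/-- The pointed map that sends a half-edge to the base point. -/
def killHom {m : ℕ} (h : Fin m × Bool) : halfEdges m ⟶ halfEdges m :=
  ObjectProperty.homMk ⟨kill h, rfl⟩

theorem gammaHom_ext {S T : Gamma} {f g : S ⟶ T} (h : ∀ x, f.hom.toFun x = g.hom.toFun x) :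
    f = g := by
  apply ObjectProperty.hom_ext
  apply Pointed.Hom.ext
  funext x
  exact h x

/-- Together with `killHom_comm`, this makes the operators `1 - A.map (killHom h)` commuting
projections onto the elements annihilated by `killHom h`. -/
theorem killHom_killHom {m : ℕ} (h : Fin m × Bool) : killHom h ≫ killHom h = killHom h :=
  gammaHom_ext (kill_kill h)

theorem killHom_comm {m : ℕ} (h h' : Fin m × Bool) :
    killHom h ≫ killHom h' = killHom h' ≫ killHom h :=
  gammaHom_ext (kill_comm h h')

/-- Natural families of linear maps on the graph algebras. -/
structure LinFamily (n : ℕ) (A : Gamma ⥤ DGCAlg) where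
  toLin (T : Gamma) : GraphAlg n T.obj →ₗ[ℚ] A.obj T
  natural {S T : Gamma} (f : S ⟶ T) (x : GraphAlg n S.obj) :
    (A.map f).toAlgHom (toLin S x) = toLin T (pushLin n f.hom x)

section Projective

variable {n : ℕ} {A : Gamma ⥤ DGCAlg}

theorem map_comp_apply {S T U : Gamma} (f : S ⟶ T) (g : T ⟶ U) (a : A.obj S) :
    (A.map g).toAlgHom ((A.map f).toAlgHom a) = (A.map (f ≫ g)).toAlgHom a := by
  rw [A.map_comp]; rfl

/-- Apply to `a` the projection `1 - A.map (killHom h)` for each `h` that kills `x`. The subtracted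
pair has first entry zero and lies in `R`, so `x` is kept; since the projections commute, conditions
already achieved persist. -/
theorem exists_reduced {m : ℕ} (R : ∀ T : Gamma, Submodule ℚ (GraphAlg n T.obj × A.obj T))
    (hR : ∀ {S T : Gamma} (f : S ⟶ T) x a, (x, a) ∈ R S →
      (pushLin n f.hom x, (A.map f).toAlgHom a) ∈ R T)
    {x : GraphAlg n (halfEdges m).obj} (hx : ∃ a, (x, a) ∈ R (halfEdges m)) :
    ∃ a, (x, a) ∈ R (halfEdges m) ∧ ∀ h : Fin m × Bool, pushLin n (killHom h).hom x = 0 →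
      (A.map (killHom h)).toAlgHom a = 0 := by
  have key : ∀ F : Finset (Fin m × Bool), (∀ h ∈ F, pushLin n (killHom h).hom x = 0) →
      ∃ a, (x, a) ∈ R (halfEdges m) ∧ ∀ h ∈ F, (A.map (killHom h)).toAlgHom a = 0 := by
    intro F
    induction F using Finset.induction_on with
    | empty => simpa using hx
    | insert h F _ ih =>
      intro hF
      obtain ⟨a, ha, haF⟩ := ih fun h' hh' => hF h' (Finset.mem_insert_of_mem hh')
      refine ⟨a - (A.map (killHom h)).toAlgHom a, ?_, ?_⟩
      · have h1 := hR (killHom h) x a ha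
        rw [hF h (Finset.mem_insert_self _ _)] at h1
        simpa using sub_mem ha h1
      · intro h' hh'
        rw [map_sub, map_comp_apply]
        rcases Finset.mem_insert.1 hh' with rfl | hh'
        · rw [killHom_killHom, sub_self]
        · rw [killHom_comm, ← map_comp_apply, haF h' hh', map_zero, sub_zero]
  classical
  obtain ⟨a, ha, h⟩ := key (Finset.univ.filter fun h => pushLin n (killHom h).hom x = 0) (by simp)
  exact ⟨a, ha, fun h' hh' => h h' (by simpa using hh')⟩

/-- Choose a reduced value on each exploded graph and push it along the incidence map; naturality is
then functoriality of `A`. These values need not respect renumberings, which is repaired by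
averaging in `exists_linFamily`. -/
theorem exists_presection (R : ℕ → ℕ → ∀ T : Gamma, Submodule ℚ (GraphAlg n T.obj × A.obj T))
    (hR : ∀ m k {S T : Gamma} (f : S ⟶ T) x a, (x, a) ∈ R m k S →
      (pushLin n f.hom x, (A.map f).toAlgHom a) ∈ R m k T)
    (htot : ∀ (T : Gamma) (g : LGraph T.obj), g ∈ AdmGraph T.obj →
      ∃ a, (cls n T.obj g, a) ∈ R g.edges.length g.numInt T) :
    ∃ θ : ∀ (T : Gamma) (m _ : ℕ), (Fin m → Edge T.obj) → A.obj T,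
      (∀ (T : Gamma) (m k : ℕ) (u : Fin m → Edge T.obj),
        (⟨k, List.ofFn u⟩ : LGraph T.obj) ∈ AdmGraph T.obj →
        (cls n T.obj ⟨k, List.ofFn u⟩, θ T m k u) ∈ R m k T) ∧
      (∀ {S T : Gamma} (f : S ⟶ T) (m k : ℕ) (u : Fin m → Edge S.obj),
        (A.map f).toAlgHom (θ S m k u)
          = θ T m k fun j => Prod.map (extMap f.hom.toFun) (extMap f.hom.toFun) (u j)) ∧
      (∀ {S T : Gamma} (f : S ⟶ T) (m k : ℕ) (u : Fin m → Edge S.obj),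
        (⟨k, List.ofFn u⟩ : LGraph S.obj) ∈ AdmGraph S.obj →
        pushGraph f.hom.toFun (⟨k, List.ofFn u⟩ : LGraph S.obj) ∉ AdmGraph T.obj →
        (A.map f).toAlgHom (θ S m k u) = 0) := by
  have hex : ∀ (m k : ℕ) (w : Fin m → Edge (halfEdges m).obj), ∃ a : A.obj (halfEdges m),
      (⟨k, List.ofFn w⟩ : LGraph (halfEdges m).obj) ∈ AdmGraph (halfEdges m).obj →
        (cls n (halfEdges m).obj ⟨k, List.ofFn w⟩, a) ∈ R m k (halfEdges m) ∧
        ∀ h : Fin m × Bool, pushLin n (killHom h).hom (cls n (halfEdges m).obj ⟨k, List.ofFn w⟩) = 0 →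
          (A.map (killHom h)).toAlgHom a = 0 := by
    intro m k w
    by_cases hw : (⟨k, List.ofFn w⟩ : LGraph (halfEdges m).obj) ∈ AdmGraph (halfEdges m).obj
    · have := htot _ _ hw
      simp only [List.length_ofFn] at this
      obtain ⟨a, ha⟩ := exists_reduced (R m k) (hR m k) this
      exact ⟨a, fun _ => ha⟩
    · exact ⟨0, fun h => absurd h hw⟩
  choose e he using hex
  let θ : ∀ (T : Gamma) (m k : ℕ), (Fin m → Edge T.obj) → A.obj T := fun T m k u =>
    (A.map (labelHom T u)).toAlgHom (e m k (explode u))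
  have hpush : ∀ (T : Gamma) (m k : ℕ) (u : Fin m → Edge T.obj),
      pushGraph (labelHom T u).hom.toFun (⟨k, List.ofFn (explode u)⟩ : LGraph (halfEdges m).obj)
        = ⟨k, List.ofFn u⟩ := by
    intro T m k u
    exact LGraph.ext rfl (relabel_label_explode T.obj.point u)
  have hθR : ∀ (T : Gamma) (m k : ℕ) (u : Fin m → Edge T.obj),
      (⟨k, List.ofFn u⟩ : LGraph T.obj) ∈ AdmGraph T.obj →
      (cls n T.obj ⟨k, List.ofFn u⟩, θ T m k u) ∈ R m k T := by
    intro T m k u hu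
    have hadm : (⟨k, List.ofFn (explode u)⟩ : LGraph (halfEdges m).obj) ∈ AdmGraph (halfEdges m).obj :=
      admissible_explode hu
    have := hR m k (labelHom T u) _ _ (he m k (explode u) hadm).1
    rwa [pushLin_cls _ hadm, hpush] at this
  have hθnat : ∀ {S T : Gamma} (f : S ⟶ T) (m k : ℕ) (u : Fin m → Edge S.obj),
      (A.map f).toAlgHom (θ S m k u)
        = θ T m k fun j => Prod.map (extMap f.hom.toFun) (extMap f.hom.toFun) (u j) := by
    intro S T f m k u
    simp only [θ, explode_extMap, map_comp_apply]
    congr 3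
    apply gammaHom_ext
    intro x
    exact (label_extMap f.hom.map_point u x).symm
  have hθzero : ∀ {S T : Gamma} (f : S ⟶ T) (m k : ℕ) (u : Fin m → Edge S.obj),
      (⟨k, List.ofFn u⟩ : LGraph S.obj) ∈ AdmGraph S.obj →
      pushGraph f.hom.toFun (⟨k, List.ofFn u⟩ : LGraph S.obj) ∉ AdmGraph T.obj →
      (A.map f).toAlgHom (θ S m k u) = 0 := by
    intro S T f m k u hu hf
    have hadm : (⟨k, List.ofFn (explode u)⟩ : LGraph (halfEdges m).obj) ∈ AdmGraph (halfEdges m).obj :=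
      admissible_explode hu
    rw [pushGraph_mem_iff _ hu] at hf
    simp only [NoBase, not_forall] at hf
    obtain ⟨_, hj, hne⟩ := hf
    obtain ⟨j, rfl⟩ := List.mem_ofFn.1 hj
    have key : ∀ h : Fin m × Bool, f.hom.toFun (label S.obj.point u (some h)) = T.obj.point →
        ((explode u h.1).1 = .inl (some h) ∨ (explode u h.1).2 = .inl (some h)) →
        (A.map f).toAlgHom (θ S m k u) = 0 := by
      intro h h1 h2
      -- As `f` sends the label of `h` to the base point, sending `h` there beforehand changes
      -- nothing. The chosen value is reduced and `h` is an external end of the exploded graph, so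
      -- `killHom h` annihilates it.
      have hfac : labelHom S u ≫ f = killHom h ≫ labelHom S u ≫ f := by
        apply gammaHom_ext
        intro x
        change f.hom.toFun (label S.obj.point u x) = f.hom.toFun (label S.obj.point u (kill h x))
        by_cases hx : (show Option (Fin m × Bool) from x) = some h
        · have hk : kill h x = none := if_pos hx
          rw [hk, show x = some h from hx, h1]
          exact f.hom.map_point.symm
        · have hk : kill h x = x := if_neg hx
          rw [hk]
      simp only [θ, map_comp_apply]
      rw [hfac, ← map_comp_apply, (he m k (explode u) hadm).2 h, map_zero]
      rw [pushLin_cls _ hadm]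
      apply cls_of_notMem
      intro hmem
      have h3 := hmem.base _ (List.mem_map.2 ⟨explode u h.1, List.mem_ofFn.2 ⟨h.1, rfl⟩, rfl⟩)
      have h4 : extMap (killHom h).hom.toFun (.inl (some h)) = .inl (halfEdges m).obj.point := by
        change Sum.inl (kill h (some h)) = _
        rw [kill, if_pos rfl]; rfl
      rcases h2 with h2 | h2
      · exact h3.1 (by simp only [Prod.map, h2]; exact h4)
      · exact h3.2 (by simp only [Prod.map, h2]; exact h4)
    have hext : ∀ v : Vtx S.obj, extMap f.hom.toFun v = .inl T.obj.point →
        f.hom.toFun (extPart S.obj.point v) = T.obj.point ∧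
          ∀ h : Fin m × Bool, explodeVtx h v = .inl (some h) := by
      rintro (v | v) hv
      · exact ⟨by simpa [extMap, extPart] using hv, fun _ => rfl⟩
      · simp [extMap] at hv
    by_cases h1 : extMap f.hom.toFun (u j).1 = .inl T.obj.point
    · exact key (j, false) (hext _ h1).1 (.inl ((hext _ h1).2 _))
    · have h2 : extMap f.hom.toFun (u j).2 = .inl T.obj.point := by
        by_contra h2; exact hne ⟨h1, h2⟩
      exact key (j, true) (hext _ h2).1 (.inr ((hext _ h2).2 _))
  exact ⟨θ, hθR, hθnat, hθzero⟩

/-- Passing through the sigma type avoids transporting functions along the equality of `(List.ofFn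
u).length` and `m`. -/
theorem sigma_get_ofFn {α : Type*} {m : ℕ} (u : Fin m → α) :
    (⟨(List.ofFn u).length, (List.ofFn u).get⟩ : Σ m, Fin m → α) = ⟨m, u⟩ :=
  List.equivSigmaTuple.apply_symm_apply ⟨m, u⟩

/-- The linear diagram of graphs is projective. -/
theorem exists_linFamily (R : ℕ → ℕ → ∀ T : Gamma, Submodule ℚ (GraphAlg n T.obj × A.obj T))
    (hR : ∀ m k {S T : Gamma} (f : S ⟶ T) x a, (x, a) ∈ R m k S →
      (pushLin n f.hom x, (A.map f).toAlgHom a) ∈ R m k T)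
    (htot : ∀ (T : Gamma) (g : LGraph T.obj), g ∈ AdmGraph T.obj →
      ∃ a, (cls n T.obj g, a) ∈ R g.edges.length g.numInt T) :
    ∃ F : LinFamily n A, ∀ (T : Gamma) (g : LGraph T.obj), g ∈ AdmGraph T.obj →
      (cls n T.obj g, F.toLin T (cls n T.obj g)) ∈ R g.edges.length g.numInt T := by
  obtain ⟨θ, hθR, hθnat, hθzero⟩ := exists_presection R hR htot
  -- Averaging over all orderings and directions turns the presection into a function of oriented
  -- graphs.
  let val : ∀ T : Gamma, LGraph T.obj → A.obj T := fun T g =>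
    symmetrize n g.numInt (θ T g.edges.length g.numInt) g.edges.get
  have hval : ∀ (T : Gamma) (m k : ℕ) (u : Fin m → Edge T.obj),
      val T ⟨k, List.ofFn u⟩ = symmetrize n k (θ T m k) u := by
    intro T m k u
    let Φ : (Σ m, Fin m → Edge T.obj) → A.obj T := fun s => symmetrize n k (θ T s.1 k) s.2
    change Φ ⟨(List.ofFn u).length, (List.ofFn u).get⟩ = Φ ⟨m, u⟩
    rw [sigma_get_ofFn]
  have hgraph : ∀ {T : Gamma} (g : LGraph T.obj), ∃ (m : ℕ) (u : Fin m → Edge T.obj),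
      g = ⟨g.numInt, List.ofFn u⟩ := fun g =>
    ⟨g.edges.length, g.edges.get, LGraph.ext rfl (List.ofFn_get g.edges).symm⟩
  have hstep : ∀ (T : Gamma) (g : LGraph T.obj), g ∈ AdmGraph T.obj → ∀ g' c, Step n g c g' →
      val T g = c • val T g' := by
    intro T g _ g' c h
    cases h with
    | swapEdges k P Q e f =>
      obtain ⟨m, u, i, j, hij, h1, h2⟩ := exists_ofFn_swap P Q f e
      rw [h1, h2, hval, hval, symmetrize_perm, signE_swap hij]
    | flipEdge k P Q v w =>
      obtain ⟨m, u, δ, h0, h1, h2⟩ := exists_ofFn_flip P Q w v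
      rw [h1, h2, hval, hval, symmetrize_flip, h0]
    | swapVertices k i hi l =>
      obtain ⟨k, rfl⟩ : ∃ k', k = k' + 1 := ⟨k - 1, by omega⟩
      obtain ⟨m, u, rfl⟩ : ∃ (m : ℕ) (u : Fin m → Edge T.obj), l = List.ofFn u :=
        ⟨_, l.get, (List.ofFn_get l).symm⟩
      have hik : i < k := by omega
      have h1 := symmetrize_vperm (n := n) (θ T m (k + 1)) u
        (Equiv.swap (Fin.castSucc (⟨i, hik⟩ : Fin k)) (Fin.succ (⟨i, hik⟩ : Fin k)))
      rw [vperm_swap, signV_swap (by simp [Fin.ext_iff])] at h1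
      rw [relabel, List.map_ofFn, hval, hval]
      change _ = sgnV n • symmetrize n (k + 1) (θ T m (k + 1)) _
      simp only [Function.comp_def]
      rw [h1, smul_smul, sgnV_mul, one_smul]
  refine ⟨⟨fun T => liftLin (val T) (hstep T), ?_⟩, ?_⟩
  · intro S T f x
    induction x using cls_induction with
    | h0 => simp
    | hadd a b ha hb => simp only [map_add, ha, hb]
    | hcls g hg c =>
      simp only [map_smul]
      congr 1
      rw [liftLin_cls _ _ hg, pushLin_cls _ hg]
      obtain ⟨m, u, hgu⟩ := hgraph g
      generalize g.numInt = k at hgu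
      subst hgu
      rw [hval]
      have hmap := map_symmetrize (n := n) (k := k) (A.map f).toAlgHom.toLinearMap (θ S m k) u
      simp only [AlgHom.toLinearMap_apply] at hmap
      rw [hmap]
      have hadm : ∀ π ε, ∀ τ : Equiv.Perm (Fin k),
          (⟨k, List.ofFn (act π ε τ u)⟩ : LGraph S.obj) ∈ AdmGraph S.obj :=
        fun π ε τ => (steps_act (n := n) u π ε τ).mem_iff.2 hg
      by_cases hp : pushGraph f.hom.toFun (⟨k, List.ofFn u⟩ : LGraph S.obj) ∈ AdmGraph T.obj
      · rw [liftLin_cls _ _ hp]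
        have hpg : pushGraph f.hom.toFun (⟨k, List.ofFn u⟩ : LGraph S.obj)
            = ⟨k, List.ofFn fun j => Prod.map (extMap f.hom.toFun) (extMap f.hom.toFun) (u j)⟩ := by
          refine LGraph.ext rfl ?_
          simp [pushGraph, relabel, List.map_ofFn, Function.comp_def]
        rw [hpg, hval]
        apply symmetrize_congr
        intro π ε τ
        rw [hθnat, act_extMap]
      -- Every renumbering of the graph still has an edge that goes to the base point, so each
      -- summand of the average vanishes.
      · rw [cls_of_notMem hp, map_zero]
        apply symmetrize_of_act
        intro π ε τ
        rw [smul_zero]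
        refine hθzero f m k _ (hadm π ε τ) ?_
        rwa [((steps_act (n := n) u π ε τ).push f.hom.toFun).mem_iff]
  · intro T g hg
    obtain ⟨m, u, hgu⟩ := hgraph g
    generalize g.numInt = k at hgu
    subst hgu
    change (_, liftLin (val T) (hstep T) _) ∈ _
    rw [liftLin_cls _ _ hg, hval]
    simp only [List.length_ofFn]
    -- The average of the pairs stays in the subspace `R m k T`. By `h4` its first entry is the
    -- class itself, which is already equivariant; its second entry is the value of the family.
    have h1 := symmetrize_mem (n := n) (k := k)
      (fun u => (cls n T.obj ⟨k, List.ofFn u⟩, θ T m k u)) u (R m k T)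
      fun π ε τ => hθR T m k _ ((steps_act (n := n) u π ε τ).mem_iff.2 hg)
    have h2 := map_symmetrize (n := n) (k := k) (LinearMap.fst ℚ (GraphAlg n T.obj) (A.obj T))
      (fun u => (cls n T.obj ⟨k, List.ofFn u⟩, θ T m k u)) u
    have h3 := map_symmetrize (n := n) (k := k) (LinearMap.snd ℚ (GraphAlg n T.obj) (A.obj T))
      (fun u => (cls n T.obj ⟨k, List.ofFn u⟩, θ T m k u)) u
    simp only [LinearMap.fst_apply, LinearMap.snd_apply] at h2 h3
    have h4 := symmetrize_of_act (n := n) (k := k)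
      (fun u : Fin m → Edge T.obj => cls n T.obj ⟨k, List.ofFn u⟩) u
      fun π ε τ => (steps_act (n := n) u π ε τ).cls_eq
    rwa [← h4, ← h2, ← h3]

end Projective

end

noncomputable section

/-! ### Lifting along trivial fibrations -/

/-- Along a trivial fibration of dg commutative algebras, an element can be lifted together with a
prescribed compatible differential. -/
theorem DGCAlg.exists_lift {A B : DGCAlg} {p : A ⟶ B} (hp : trivialFibrations DGCAlg p) {i : ℤ}
    {b : B} (hb : b ∈ B.gr i) {z : A} (hz : z ∈ A.gr (i + 1)) (hdz : A.d z = 0)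
    (hpz : p.toAlgHom z = B.d b) : ∃ a ∈ A.gr i, p.toAlgHom a = b ∧ A.d a = z := by
  have hfib : ∀ i, ∀ b ∈ B.gr i, ∃ a ∈ A.gr i, p.toAlgHom a = b := hp.1
  have hwe : ∀ i, Function.Bijective (cohomologyMap p i) := hp.2
  -- For an arbitrary lift `a₁` of `b`, the error `z - d a₁` is a cocycle in the kernel of `p`,
  -- hence exact because `p` is injective on cohomology.
  obtain ⟨a₁, ha₁, hpa₁⟩ := hfib i b hb
  have hw : z - A.d a₁ ∈ A.cocycles (i + 1) := by
    refine ⟨sub_mem hz (A.d_mem ha₁), ?_⟩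
    rw [SetLike.mem_coe, LinearMap.mem_ker, map_sub, hdz, A.d_d, sub_zero]
  have hpw : p.toAlgHom (z - A.d a₁) = 0 := by rw [map_sub, p.map_d, hpa₁, hpz, sub_self]
  have hw0 : Submodule.Quotient.mk ⟨z - A.d a₁, hw⟩ = (0 : A.Cohomology (i + 1)) := by
    apply (hwe (i + 1)).1
    rw [map_zero]
    have h0 : cocyclesMap p (i + 1) ⟨z - A.d a₁, hw⟩ = 0 := Subtype.ext hpw
    exact (congrArg Submodule.Quotient.mk h0).trans (Submodule.Quotient.mk_zero _)
  rw [Submodule.Quotient.mk_eq_zero] at hw0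
  obtain ⟨a₂, ha₂, hda₂⟩ := hw0
  rw [add_sub_cancel_right] at ha₂
  replace hda₂ : A.d a₂ = z - A.d a₁ := hda₂
  -- Adding `a₂` repairs the differential but moves the image by the cocycle `p a₂`. Surjectivity on
  -- cohomology gives a cocycle `a₃` whose image differs from it by a coboundary, and lifting that
  -- coboundary to `d a₄` restores the image without affecting the differential.
  have hc : p.toAlgHom a₂ ∈ B.cocycles i := by
    refine ⟨p.map_gr i _ ha₂, ?_⟩
    rw [SetLike.mem_coe, LinearMap.mem_ker, ← p.map_d, hda₂, hpw]
  obtain ⟨y, hy⟩ := (hwe i).2 (Submodule.Quotient.mk ⟨_, hc⟩)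
  obtain ⟨⟨a₃, ha₃⟩, rfl⟩ := Submodule.Quotient.mk_surjective _ y
  have hy' : Submodule.Quotient.mk (cocyclesMap p i ⟨a₃, ha₃⟩)
      = (Submodule.Quotient.mk ⟨_, hc⟩ : B.Cohomology i) := hy
  rw [Submodule.Quotient.eq] at hy'
  obtain ⟨b', hb', hdb'⟩ := hy'
  replace hdb' : B.d b' = p.toAlgHom a₃ - p.toAlgHom a₂ := hdb'
  obtain ⟨a₄, ha₄, hpa₄⟩ := hfib _ b' hb'
  have hda₄ : A.d a₄ ∈ A.gr i := by simpa using A.d_mem ha₄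
  have hda₃ : A.d a₃ = 0 := ha₃.2
  refine ⟨a₁ + a₂ - a₃ + A.d a₄, add_mem (sub_mem (add_mem ha₁ ha₂) ha₃.1) hda₄, ?_, ?_⟩
  · rw [map_add, map_sub, map_add, p.map_d, hpa₄, hdb', hpa₁]
    abel
  · rw [map_add, map_sub, map_add, A.d_d, hda₂, hda₃]
    abel

/-! ### Partial lifts and the induction on the number of internal vertices -/

section PartialLift

variable {n : ℕ}

/-- The span of the graphs with less than `k` internal vertices. -/
def fewInt (n : ℕ) (X : Pointed.{0}) (k : ℕ) : Submodule ℚ (GraphAlg n X) :=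
  Submodule.span ℚ {x | ∃ g ∈ AdmGraph X, g.numInt < k ∧ x = cls n X g}

theorem eqOn_fewInt {X : Pointed.{0}} {M : Type*} [AddCommGroup M] [Module ℚ M]
    {φ ψ : GraphAlg n X →ₗ[ℚ] M} {k : ℕ}
    (h : ∀ g ∈ AdmGraph X, g.numInt < k → φ (cls n X g) = ψ (cls n X g)) {x : GraphAlg n X}
    (hx : x ∈ fewInt n X k) : φ x = ψ x := by
  refine LinearMap.eqOn_span (f := φ) (g := ψ) ?_ hx
  rintro _ ⟨g, hg, hk, rfl⟩
  exact h g hg hk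

theorem extLin_congr_fewInt {X : Pointed.{0}} {A : DGCAlg} {c c' : GraphAlg n X →ₗ[ℚ] A}
    (hc : ∀ i, ∀ x ∈ gr n X i, c x ∈ A.gr i) (hc' : ∀ i, ∀ x ∈ gr n X i, c' x ∈ A.gr i) {k : ℕ}
    (h : ∀ g : LGraph X, g.numInt < k → c (cls n X g) = c' (cls n X g)) {x : GraphAlg n X}
    (hx : x ∈ fewInt n X k) : extLin c hc x = extLin c' hc' x :=
  eqOn_fewInt (fun g _ hk => extLin_congr hc hc' (N := g.numInt)
    (fun g' hg' => h g' (hg'.trans_lt hk)) le_rfl) hx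

variable {A B : Gamma ⥤ DGCAlg}

/-- A natural linear map on the graphs that preserves degrees and whose multiplicative extension is,
on graphs with less than `k` internal vertices, a lift of `φ` along `p` commuting with the
differentials. -/
structure IsPartialLift (p : A ⟶ B) (φ : graphs n ⟶ B) (F : LinFamily n A) (k : ℕ) : Prop where
  graded : ∀ (T : Gamma) (i : ℤ), ∀ x ∈ gr n T.obj i, F.toLin T x ∈ (A.obj T).gr i
  lift : ∀ (T : Gamma) (g : LGraph T.obj), g.numInt < k →
    (p.app T).toAlgHom (F.toLin T (cls n T.obj g)) = (φ.app T).toAlgHom (cls n T.obj g)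
  d : ∀ (T : Gamma) (g : LGraph T.obj), g.numInt < k →
    (A.obj T).d (F.toLin T (cls n T.obj g))
      = extLin (F.toLin T) (graded T) (differential n T.obj (cls n T.obj g))

variable {p : A ⟶ B} {φ : graphs n ⟶ B}

theorem app_map {A B : Gamma ⥤ DGCAlg} (p : A ⟶ B) {S T : Gamma} (f : S ⟶ T) (a : A.obj S) :
    (p.app T).toAlgHom ((A.map f).toAlgHom a) = (B.map f).toAlgHom ((p.app S).toAlgHom a) :=
  DFunLike.congr_fun (congrArg DGCAlg.Hom.toAlgHom (p.naturality f)) a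

namespace IsPartialLift

variable {F : LinFamily n A} {k : ℕ}

/-- The conditions of a partial lift are imposed on `F`; here and in the next lemma multiplicativity
carries them over to the extension. -/
theorem lift_extLin (h : IsPartialLift p φ F k) {T : Gamma} {x : GraphAlg n T.obj}
    (hx : x ∈ fewInt n T.obj k) :
    (p.app T).toAlgHom (extLin (F.toLin T) (h.graded T) x) = (φ.app T).toAlgHom x :=
  eqOn_fewInt (φ := (p.app T).toAlgHom.toLinearMap ∘ₗ extLin (F.toLin T) (h.graded T))
    (ψ := (φ.app T).toAlgHom.toLinearMap)
    (fun g hg hk => map_extLin (h.graded T) (p.app T) (φ.app T) (N := g.numInt)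
      (fun g' hg' => h.lift T g' (hg'.trans_lt hk)) hg le_rfl) hx

theorem d_extLin (h : IsPartialLift p φ F k) {T : Gamma} {x : GraphAlg n T.obj}
    (hx : x ∈ fewInt n T.obj k) :
    (A.obj T).d (extLin (F.toLin T) (h.graded T) x)
      = extLin (F.toLin T) (h.graded T) (differential n T.obj x) :=
  eqOn_fewInt (φ := (A.obj T).d ∘ₗ extLin (F.toLin T) (h.graded T))
    (ψ := extLin (F.toLin T) (h.graded T) ∘ₗ differential n T.obj)
    (fun g hg hk => GraphComplex.d_extLin (h.graded T) (N := g.numInt)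
      (fun g' hg' => h.d T g' (hg'.trans_lt hk)) hg le_rfl) hx

end IsPartialLift

theorem graded_of_cls {X : Pointed.{0}} {A : DGCAlg} {c : GraphAlg n X →ₗ[ℚ] A}
    (h : ∀ g ∈ AdmGraph X, c (cls n X g) ∈ A.gr (degree n g)) (i : ℤ) (x : GraphAlg n X)
    (hx : x ∈ gr n X i) : c x ∈ A.gr i := by
  have : gr n X i ≤ (A.gr i).comap c := by
    rw [gr, Submodule.span_le]
    rintro _ ⟨g, hg, rfl, rfl⟩
    exact h g hg
  exact this hx

/-- The possible values of a partial lift on the graphs with `m` edges and `k` internal vertices, if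
it is to extend the partial lift `F`. -/
def liftRel (p : A ⟶ B) (φ : graphs n ⟶ B) {F : LinFamily n A} {k : ℕ} (h : IsPartialLift p φ F k)
    (m k' : ℕ) (T : Gamma) : Submodule ℚ (GraphAlg n T.obj × A.obj T) :=
  if k' < k then (F.toLin T).graph
  else if k' = k then
    ((A.obj T).gr (dg n m k)).comap (LinearMap.snd ℚ _ _) ⊓
      (LinearMap.eqLocus ((p.app T).toAlgHom.toLinearMap ∘ₗ LinearMap.snd ℚ _ _)
        ((φ.app T).toAlgHom.toLinearMap ∘ₗ LinearMap.fst ℚ (GraphAlg n T.obj) _) ⊓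
      LinearMap.eqLocus ((A.obj T).d ∘ₗ LinearMap.snd ℚ _ _)
        (extLin (F.toLin T) (h.graded T) ∘ₗ differential n T.obj ∘ₗ LinearMap.fst ℚ _ _))
  else (0 : GraphAlg n T.obj →ₗ[ℚ] A.obj T).graph

/-- By `exists_linFamily` it suffices that `liftRel` is natural and total. Totality at level `k` is
`DGCAlg.exists_lift` with `z = extLin F (d x)`: as `d x` has fewer internal vertices, the extension
of `F` is already compatible there, so `z` is a cocycle over `d (φ x)`. -/
theorem exists_extend (hp : trivialFibrations (Gamma ⥤ DGCAlg) p) {F : LinFamily n A} {k : ℕ}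
    (h : IsPartialLift p φ F k) : ∃ F' : LinFamily n A, IsPartialLift p φ F' (k + 1) ∧
      ∀ (T : Gamma) (g : LGraph T.obj), g.numInt < k →
        F'.toLin T (cls n T.obj g) = F.toLin T (cls n T.obj g) := by
  have hp' : ∀ T, trivialFibrations DGCAlg (p.app T) := fun T => ⟨hp.1 T, hp.2 T⟩
  have hlt : ∀ {m k' : ℕ} {T : Gamma} {x : GraphAlg n T.obj} {a : A.obj T}, k' < k →
      ((x, a) ∈ liftRel p φ h m k' T ↔ a = F.toLin T x) := by
    intro m k' T x a hk
    rw [liftRel, if_pos hk, LinearMap.mem_graph_iff]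
  have heq : ∀ {m : ℕ} {T : Gamma} {x : GraphAlg n T.obj} {a : A.obj T},
      ((x, a) ∈ liftRel p φ h m k T ↔ a ∈ (A.obj T).gr (dg n m k) ∧
        (p.app T).toAlgHom a = (φ.app T).toAlgHom x ∧
        (A.obj T).d a = extLin (F.toLin T) (h.graded T) (differential n T.obj x)) := by
    intro m T x a
    rw [liftRel, if_neg (lt_irrefl k), if_pos rfl]
    rfl
  have hgt : ∀ {m k' : ℕ} {T : Gamma} {x : GraphAlg n T.obj} {a : A.obj T}, k < k' →
      ((x, a) ∈ liftRel p φ h m k' T ↔ a = 0) := by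
    intro m k' T x a hk
    rw [liftRel, if_neg hk.le.not_gt, if_neg hk.ne', LinearMap.mem_graph_iff, LinearMap.zero_apply]
  obtain ⟨F', hF'⟩ := exists_linFamily (liftRel p φ h) (by
    intro m k' S T f x a hxa
    rcases lt_trichotomy k' k with hk | rfl | hk
    · rw [hlt hk] at hxa ⊢
      rw [hxa, F.natural]
    · rw [heq] at hxa ⊢
      refine ⟨(A.map f).map_gr _ _ hxa.1, ?_, ?_⟩
      · rw [app_map, hxa.2.1]
        exact (app_map φ f x).symm
      · rw [← (A.map f).map_d, hxa.2.2,
          extLin_push (h.graded S) (h.graded T) (F.natural f), pushLin_differential]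
    · rw [hgt hk] at hxa ⊢
      rw [hxa, map_zero]) (by
    intro T g hg
    rcases lt_trichotomy g.numInt k with hk | hk | hk
    · exact ⟨_, (hlt hk).2 rfl⟩
    · have hx : differential n T.obj (cls n T.obj g) ∈ fewInt n T.obj k := by
        rw [← hk]; exact differential_cls_mem hg
      have hdeg := differential_mem (cls_mem_gr (n := n) g)
      rw [hk]
      obtain ⟨a, ha, hpa, hda⟩ := DGCAlg.exists_lift (hp' T)
        ((φ.app T).map_gr _ (cls n T.obj g) (cls_mem_gr g)) (extLin_mem (h.graded T) hdeg)
        (by rw [h.d_extLin hx, differential_differential, map_zero])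
        ((h.lift_extLin hx).trans ((φ.app T).map_d (cls n T.obj g)))
      refine ⟨a, heq.2 ⟨?_, hpa, hda⟩⟩
      rw [← hk]
      exact ha
    · exact ⟨0, (hgt hk).2 rfl⟩)
  have hagree : ∀ (T : Gamma) (g : LGraph T.obj), g.numInt < k →
      F'.toLin T (cls n T.obj g) = F.toLin T (cls n T.obj g) := by
    intro T g hk
    by_cases hg : g ∈ AdmGraph T.obj
    · exact (hlt hk).1 (hF' T g hg)
    · simp [cls_of_notMem hg]
  have hgr : ∀ (T : Gamma) (i : ℤ), ∀ x ∈ gr n T.obj i, F'.toLin T x ∈ (A.obj T).gr i := by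
    intro T
    refine graded_of_cls fun g hg => ?_
    rcases lt_trichotomy g.numInt k with hk | hk | hk
    · rw [hagree T g hk]
      exact h.graded T _ _ (cls_mem_gr g)
    · have := hF' T g hg
      rw [hk, heq] at this
      have h1 := this.1
      rwa [← hk] at h1
    · rw [(hgt hk).1 (hF' T g hg)]
      exact Submodule.zero_mem _
  have hlast : ∀ (T : Gamma) (g : LGraph T.obj), g ∈ AdmGraph T.obj → g.numInt = k →
      (p.app T).toAlgHom (F'.toLin T (cls n T.obj g)) = (φ.app T).toAlgHom (cls n T.obj g) ∧
      (A.obj T).d (F'.toLin T (cls n T.obj g))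
        = extLin (F.toLin T) (h.graded T) (differential n T.obj (cls n T.obj g)) := by
    intro T g hg hk
    have := hF' T g hg
    rw [hk, heq] at this
    exact this.2
  refine ⟨F', ⟨hgr, ?_, ?_⟩, hagree⟩
  · intro T g hk
    by_cases hg : g ∈ AdmGraph T.obj
    · rcases (Nat.lt_succ_iff.1 hk).lt_or_eq with hk | hk
      · rw [hagree T g hk, h.lift T g hk]
      · exact (hlast T g hg hk).1
    · rw [cls_of_notMem hg, map_zero, map_zero]
      exact (map_zero (φ.app T).toAlgHom).symm
  · intro T g hk
    by_cases hg : g ∈ AdmGraph T.obj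
    · have hx : differential n T.obj (cls n T.obj g) ∈ fewInt n T.obj g.numInt :=
        differential_cls_mem hg
      -- The differential of `g` involves only graphs with fewer than `k` internal vertices, where
      -- `F'` and `F` agree.
      rw [extLin_congr_fewInt (hgr T) (h.graded T)
        (fun g' hg' => hagree T g' (hg'.trans_le (Nat.lt_succ_iff.1 hk))) hx]
      rcases (Nat.lt_succ_iff.1 hk).lt_or_eq with hk | hk
      · rw [hagree T g hk, h.d T g hk]
      · exact (hlast T g hg hk).2
    · simp [cls_of_notMem hg]

/-- The stages stabilize on every graph, and their limit is assembled by one more application of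
`exists_linFamily`. -/
theorem exists_lift_family (hp : trivialFibrations (Gamma ⥤ DGCAlg) p) (φ : graphs n ⟶ B) :
    ∃ F : LinFamily n A, ∀ k, IsPartialLift p φ F k := by
  have h0 : IsPartialLift p φ ⟨fun _ => 0, by simp⟩ 0 := by
    refine ⟨by simp, ?_, ?_⟩ <;> exact fun _ _ h => absurd h (Nat.not_lt_zero _)
  choose next hnext hagree using fun k (F : {F : LinFamily n A // IsPartialLift p φ F k}) =>
    exists_extend hp F.2
  let c : ∀ k, {F : LinFamily n A // IsPartialLift p φ F k} := fun k =>
    Nat.rec ⟨_, h0⟩ (fun k F => ⟨next k F, hnext k F⟩) k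
  have hc : ∀ k j (T : Gamma) (g : LGraph T.obj), g.numInt < k →
      (c (k + j)).1.toLin T (cls n T.obj g) = (c k).1.toLin T (cls n T.obj g) := by
    intro k j T g hg
    induction j with
    | zero => rfl
    | succ j ih => exact (hagree (k + j) (c (k + j)) T g (by omega)).trans ih
  -- Stage `k + 1` is the first one that constrains the graphs with `k` internal vertices, and later
  -- stages agree with it there.
  obtain ⟨F, hF⟩ := exists_linFamily (n := n) (A := A) (fun _ k T => ((c (k + 1)).1.toLin T).graph)
    (by
      intro m k S T f x a hxa
      rw [LinearMap.mem_graph_iff] at hxa ⊢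
      simp only at hxa ⊢
      rw [hxa, LinFamily.natural])
    (fun T g _ => ⟨(c _).1.toLin T _, (LinearMap.mem_graph_iff _ _).2 rfl⟩)
  have hFc : ∀ (T : Gamma) (k : ℕ) (g : LGraph T.obj), g.numInt < k →
      F.toLin T (cls n T.obj g) = (c k).1.toLin T (cls n T.obj g) := by
    intro T k g hk
    by_cases hg : g ∈ AdmGraph T.obj
    · obtain ⟨j, rfl⟩ := Nat.exists_eq_add_of_le hk
      exact ((LinearMap.mem_graph_iff _ _).1 (hF T g hg)).trans
        (hc _ j T g (Nat.lt_succ_self _)).symm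
    · simp [cls_of_notMem hg]
  have hgr : ∀ (T : Gamma) (i : ℤ), ∀ x ∈ gr n T.obj i, F.toLin T x ∈ (A.obj T).gr i := by
    intro T
    refine graded_of_cls fun g hg => ?_
    rw [hFc T _ g (Nat.lt_succ_self _)]
    exact (c _).2.graded T _ _ (cls_mem_gr g)
  refine ⟨F, fun k => ⟨hgr, ?_, ?_⟩⟩
  · intro T g hk
    rw [hFc T k g hk, (c k).2.lift T g hk]
  · intro T g hk
    by_cases hg : g ∈ AdmGraph T.obj
    · have hx : differential n T.obj (cls n T.obj g) ∈ fewInt n T.obj g.numInt :=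
        differential_cls_mem hg
      rw [hFc T k g hk, (c k).2.d T g hk]
      exact extLin_congr_fewInt _ _ (fun g' hg' => (hFc T k g' (hg'.trans hk)).symm) hx
    · simp [cls_of_notMem hg]

/-- Every morphism from the diagram of graphs lifts along every trivial fibration. -/
theorem graphs_exists_lift (hp : trivialFibrations (Gamma ⥤ DGCAlg) p) (φ : graphs n ⟶ B) :
    ∃ ψ : graphs n ⟶ A, ψ ≫ p = φ := by
  obtain ⟨F, hF⟩ := exists_lift_family hp φ
  -- Each class has finitely many internal vertices, so identities between linear maps may be
  -- checked on the subspaces `fewInt`.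
  have hall : ∀ (T : Gamma) {M : Type} [AddCommGroup M] [Module ℚ M]
      {f g : GraphAlg n T.obj →ₗ[ℚ] M}, (∀ k, ∀ x ∈ fewInt n T.obj k, f x = g x) →
      ∀ x, f x = g x := by
    intro T M _ _ f g h x
    induction x using cls_induction with
    | h0 => simp
    | hadd a b ha hb => rw [map_add, map_add, ha, hb]
    | hcls γ hγ s =>
      exact h (γ.numInt + 1) _ (Submodule.smul_mem _ _
        (Submodule.subset_span ⟨γ, hγ, Nat.lt_succ_self _, rfl⟩))
  let hgr := (hF 0).graded
  let ψ (T : Gamma) : graphsObj n T.obj ⟶ A.obj T :=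
    { toAlgHom := AlgHom.ofLinearMap (extLin (F.toLin T) (hgr T)) (extLin_one _) (extLin_mul _)
      map_gr := fun _ _ hx => extLin_mem (hgr T) hx
      map_d := fun x => (hall T (f := (A.obj T).d ∘ₗ extLin (F.toLin T) (hgr T))
        (g := extLin (F.toLin T) (hgr T) ∘ₗ differential n T.obj)
        (fun k y hy => (hF k).d_extLin hy) x).symm }
  refine ⟨{ app := ψ, naturality := ?_ }, ?_⟩
  · intro S T f
    apply DGCAlg.hom_ext
    intro x
    exact (extLin_push (hgr S) (hgr T) (F.natural f) x).symm
  · ext T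
    apply DGCAlg.hom_ext
    intro x
    exact hall T (f := (p.app T).toAlgHom.toLinearMap ∘ₗ extLin (F.toLin T) (hgr T))
      (g := (φ.app T).toAlgHom.toLinearMap) (fun k y hy => (hF k).lift_extLin hy) x

end PartialLift

/-! ### Cofibrancy of the diagrams of graphs -/

/-- An object is cofibrant if all morphisms from it lift along trivial fibrations. -/
theorem isCofibrant_of_exists_lift {C : Type*} [Category C] [CategoryWithFibrations C]
    [CategoryWithWeakEquivalences C] [HasInitial C] {G : Gamma ⥤ C}
    (h : ∀ {A B : Gamma ⥤ C} (p : A ⟶ B), trivialFibrations (Gamma ⥤ C) p →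
      ∀ φ : G ⟶ B, ∃ ψ : G ⟶ A, ψ ≫ p = φ) : IsCofibrant G := by
  refine ⟨fun A B p hp => ⟨fun {f g} sq => ?_⟩⟩
  obtain ⟨ψ, hψ⟩ := h p hp g
  exact ⟨⟨{ l := ψ, fac_left := initialIsInitial.hom_ext _ _, fac_right := hψ }⟩⟩

theorem isCofibrant_graphs (n : ℕ) : IsCofibrant (graphs n) :=
  isCofibrant_of_exists_lift fun _ hp φ => graphs_exists_lift hp φ

/-- The inclusion into `ℤ`-graded algebras preserves trivial fibrations, so the lifting problem can
be solved there; since the subcategory is full, the solution already belongs to it. -/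
theorem isCofibrant_graphsNonneg (n : ℕ) (hn : 3 ≤ n) : IsCofibrant (graphsNonneg n hn) := by
  refine isCofibrant_of_exists_lift fun {A B} p hp φ => ?_
  let J : DgCom ⥤ DGCAlg := ObjectProperty.ι _
  obtain ⟨ψ, hψ⟩ := graphs_exists_lift (n := n) (p := Functor.whiskerRight p J)
    ⟨fun T => hp.1 T, fun T => hp.2 T⟩ (Functor.whiskerRight φ J)
  refine ⟨{ app := fun T => ObjectProperty.homMk (ψ.app T), naturality := ?_ }, ?_⟩
  · intro S T f
    exact ObjectProperty.hom_ext _ (ψ.naturality f)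
  · exact NatTrans.ext (funext fun T => ObjectProperty.hom_ext _ (NatTrans.congr_app hψ T))

end

end GraphComplex

/-- The left Hopf `Γ`-module of graphs is cofibrant in the projective model structure, among the
`Γ`-diagrams of `ℤ`-graded dg commutative algebras for every `n`, and among those of non-negatively
graded dg commutative algebras for `n ≥ 3`. -/
theorem proposition3p4 (n : ℕ) :
    HomotopicalAlgebra.IsCofibrant (GraphComplex.graphs n) ∧
      ∀ hn : 3 ≤ n, HomotopicalAlgebra.IsCofibrant (GraphComplex.graphsNonneg n hn) := by
  exact ⟨GraphComplex.isCofibrant_graphs n, GraphComplex.isCofibrant_graphsNonneg n⟩
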